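/- **Setting.** Fix $\rho\in(0,1)$ and a function $\varphi(x)=\sum_{i=1}^{L}a_i\cos(b_ix)$ with $|\varphi|,|\varphi'|,|\varphi''|\le 100$, $|\varphi^{(k)}(x)|\le(100+|x|)^k$ for all $k\ge1$, and $\mathbb E\varphi(Z)=0$, $\mathbb E\varphi(Z)^2=1$ for $Z\sim\mathcal N(0,1)$. Let $\phi(u)=\mathbb E[\varphi(X)\varphi(Y)]$ for standard normal $X,Y$ with correlation $u$, and let $\Lambda>0$ satisfy $|\phi^{(k)}(0)/k!|\le\Lambda 2^k$ for all $k\ge 0$. Put $c=10^{-20}\rho^{20}|\phi''(0)|^2\Lambda^{-2}$. Let $K_0,K_1,\dots$ be multiples of $12$ with $K_{t+1}=cK_t^2$ up to rounding to a neighbouring multiple of $12$ (i.e. $|K_{t+1}-cK_t^2|<12$), where $K_0$ is large enough that $cK_0\ge3$. Let $t^*=\min\{t\ge0:K_t\ge(\log n)^{1.1}\}$. Let $\epsilon=\epsilon_n>0$ with $\epsilon=o((\log n)^{-20})$. *Matrices.* Let $\pi_*$ be a permutation of $[n]$, and let $A,B$ be random symmetric $n\times n$ matrices such that the pairs $(A_{i,j},B_{\pi_*(i),\pi_*(j)})$,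 $i<j$, are independent bivariate standard normal with correlation $\rho$. Let $E,F$ be random symmetric matrices, depending arbitrarily on $A,B$; $Q$ (resp. $R$) denotes the set of indices of nonzero rows of $E$ (resp. $F$), and $|Q|,|R|\le\epsilon n$. Let $G,H$ be symmetric with i.i.d. $\mathcal N(0,1)$ entries $G_{i,j},H_{i,j}$, $i<j$, independent of $(A,B,E,F)$. For matrices $X,Y$ let $N(X,Y)$ have entries $(X_{i,j}+Y_{i,j})/\sqrt2$ for $i>j$, $(X_{i,j}-Y_{i,j})/\sqrt2$ for $i<j$, and $0$ for $i=j$. Set $\mathscr A=N(A,G)$, $\mathscr B=N(B,H)$, $\widehat A'=N(A+E,G)$, $\widehat B'=N(B+F,H)$. *Spectral cleaning.* Let $\widehat{\mathscr A}$ be obtained from $\widehat A'$ as follows: while the operator norm of the current matrix is at least $10\sqrt n$, take unit left and right singular vectors $v,u$ for its leading singular value, sample $i\in[n]$ with (conditional, given $A,B,E,F,G,H$ and the indices sampled so far) probability $(v_i^2+u_i^2)/2$, and set the $i$-th row and column to zero. Let $S$ be the set of removed indices. Define $\widehat{\mathscr B}$ and $T$ in the same way from $\widehat B'$. *Spectral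 subroutine.* Let $\beta^{(t)}\in\mathbb R^{K_t/12\times K_{t+1}}$, $\Xi^{(t)}\in\mathbb R^{K_t\times K_t/12}$ be random, independent of $(A,B,E,F,G,H)$. Put $\Phi^{(0)}=\mathbb I$, $\varepsilon_0=\phi(\rho/2)$, $\Psi^{(0)}=\varepsilon_0\mathbb I$ and, with $\beta^{(t)}_i$ the columns of $\beta^{(t)}$ and $D^{(t)}=(\Xi^{(t)})^\top\Psi^{(t)}\Xi^{(t)}$, $$\Phi^{(t+1)}_{i,j}=\phi\big((\beta_i^{(t)})^\top\beta_j^{(t)}\big),\quad \Psi^{(t+1)}_{i,j}=\phi\big(\tfrac\rho2(\beta_i^{(t)})^\top D^{(t)}\beta_j^{(t)}\big),\quad \varepsilon_{t+1}=\phi\big(\tfrac\rho2\cdot\tfrac{12}{K_t}\operatorname{tr}D^{(t)}\big).$$ Assume that, almost surely, the entries of $\beta^{(t)}$ are $\pm\sqrt{12/K_t}$ for all $t<t^*$, and for all $t\le t^*$: there are orthonormal families of $\frac{3K_t}4$ eigenvectors of $\Phi^{(t)}$ with eigenvalues in $(0.9,1.1)$, and of $\Psi^{(t)}$ with eigenvalues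 in $(0.9\varepsilon_t,1.1\varepsilon_t)$, such that the columns of $\Xi^{(t)}$ lie in the span of each of the two families; $(\Xi^{(t)})^\top\Phi^{(t)}\Xi^{(t)}=\mathbb I$; and $D^{(t)}$ is diagonal with diagonal entries in $[0.9\varepsilon_t,1.1\varepsilon_t]$. (The law of $(\beta,\Xi)$ is otherwise arbitrary; a particular case is that the entries of $\beta^{(t)}$ are i.i.d. uniform signs times $\sqrt{12/K_t}$, resampled until the eigenvalue condition holds at time $t+1$.) *Iterations.* A pair of sequences $\mathsf U=(u_1,\dots,u_{K_0})$, $\mathsf V=(v_1,\dots,v_{K_0})$ of distinct elements of $[n]$ is *good* if $\mathsf U\cap(Q\cup S)=\mathsf V\cap(R\cup T)=\emptyset$ and $v_k=\pi_*(u_k)$ for all $k$. Given such a pair, put $\widehat f^{(0)}_{i,k}=f^{(0)}_{i,k}=\varphi(\widehat{\mathscr A}_{i,u_k})$ for $i\in[n]\setminus\mathsf U$ and $\widehat g^{(0)}_{i,k}=g^{(0)}_{i,k}=\varphi(\widehat{\mathscr B}_{i,v_k})$ for $i\in[n]\setminus\mathsf V$, and, applying $\varphi$ entrywise, $$\widehat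 h^{(t)}=\tfrac1{\sqrt n}\widehat{\mathscr A}_{([n]\setminus\mathsf U)\times([n]\setminus\mathsf U)}\widehat f^{(t)}\Xi^{(t)},\quad \widehat\ell^{(t)}=\tfrac1{\sqrt n}\widehat{\mathscr B}_{([n]\setminus\mathsf V)\times([n]\setminus\mathsf V)}\widehat g^{(t)}\Xi^{(t)},\quad \widehat f^{(t+1)}=\varphi\circ(\widehat h^{(t)}\beta^{(t)}),\quad \widehat g^{(t+1)}=\varphi\circ(\widehat\ell^{(t)}\beta^{(t)}).$$ The clean iterates $f^{(t)},g^{(t)},h^{(t)},\ell^{(t)}$ are defined by the same recursion with $\mathscr A,\mathscr B$ in place of $\widehat{\mathscr A},\widehat{\mathscr B}$ (and the same initial values). **Lemma.** Let $\aleph_t=\prod_{s=0}^{t}\big(1000\log(\epsilon^{-1})^2K_s\big)$. With probability $1-o(1)$ as $n\to\infty$, simultaneously for all good pairs $(\mathsf U,\mathsf V)$ and all $0\le t\le t^*$, $$\|\widehat f^{(t)}-f^{(t)}\|_{\mathrm F},\ \|\widehat g^{(t)}-g^{(t)}\|_{\mathrm F}\le\aleph_t\sqrt{\epsilon n},\qquad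 \|\widehat h^{(t)}-h^{(t)}\|_{\mathrm F},\ \|\widehat\ell^{(t)}-\ell^{(t)}\|_{\mathrm F}\le1000\,\aleph_t\sqrt{K_t\log(\epsilon^{-1})}\cdot\sqrt{\epsilon n}.$$ The $o(1)$ depends only on $\varphi,\rho,\Lambda,(K_t)$ and the sequence $(\epsilon_n)$; it is uniform in $\pi_*$, in the adversary $(E,F)$ and in the law of $(\beta,\Xi)$. -/

import Mathlib

open MeasureTheory ProbabilityTheory Filter Topology

/-- The product (entrywise) sigma-algebra on matrices. -/
instance matrixMeasurableSpace {m n : Type*} : MeasurableSpace (Matrix m n ℝ) :=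
  inferInstanceAs (MeasurableSpace (m → n → ℝ))

noncomputable section

namespace RobustMatching

/-! ### Gaussian ingredients and the denoiser -/

/-- The law of a pair of standard normal variables with correlation `u`, for `u ∈ [-1, 1]`. -/
def bivariateNormal (u : ℝ) : Measure (ℝ × ℝ) :=
  ((gaussianReal 0 1).prod (gaussianReal 0 1)).map
    (fun p => (p.1, u * p.1 + Real.sqrt (1 - u ^ 2) * p.2))

/-- The admissible denoiser functions `φ`: finite cosine sums with bounded derivatives,
centred and normalised under the standard normal law.  The derivative bound of order `k` is
imposed for `k ≥ 1`. -/
structure IsDenoiser (φ : ℝ → ℝ) : Prop where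
  cos_sum : ∃ (L : ℕ) (a b : Fin L → ℝ), ∀ x, φ x = ∑ i, a i * Real.cos (b i * x)
  bound_zero : ∀ x, |φ x| ≤ 100
  bound_one : ∀ x, |deriv φ x| ≤ 100
  bound_two : ∀ x, |iteratedDeriv 2 φ x| ≤ 100
  bound_all : ∀ k : ℕ, 1 ≤ k → ∀ x, |iteratedDeriv k φ x| ≤ (100 + |x|) ^ k
  mean_zero : ∫ x, φ x ∂(gaussianReal 0 1) = 0
  second_moment : ∫ x, φ x ^ 2 ∂(gaussianReal 0 1) = 1

/-- `ϕ(u) = E[φ(X) φ(Y)]` for standard normal `X, Y` with correlation `u`. -/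
def gaussCorr (φ : ℝ → ℝ) (u : ℝ) : ℝ :=
  ∫ p, φ p.1 * φ p.2 ∂(bivariateNormal u)

/-- `Λ` bounds the Taylor coefficients `c_k` of `ϕ` at the origin: `|c_k| ≤ Λ 2 ^ k`. -/
def IsTaylorBound (φ : ℝ → ℝ) (Λ : ℝ) : Prop :=
  0 < Λ ∧ ∀ k : ℕ, |iteratedDeriv k (gaussCorr φ) 0 / (k.factorial : ℝ)| ≤ Λ * 2 ^ k

/-- The constant `10⁻²⁰ ρ²⁰ |ϕ''(0)|² Λ⁻²` of the recursion for the dimensions `K_t`. -/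
def growthConst (φ : ℝ → ℝ) (ρ Λ : ℝ) : ℝ :=
  (10 ^ 20)⁻¹ * ρ ^ 20 * |iteratedDeriv 2 (gaussCorr φ) 0| ^ 2 * (Λ ^ 2)⁻¹

/-- The dimensions `K_t`: multiples of `12` with `K_{t+1} = 10⁻²⁰ ρ²⁰ |ϕ''(0)|² Λ⁻² K_t²`, up to
an arbitrary rounding of the right-hand side to a neighbouring multiple of `12`, started from a
sufficiently large `K_0`. -/
structure IsDimensionSeq (φ : ℝ → ℝ) (ρ Λ : ℝ) (K : ℕ → ℕ) : Prop where
  dvd : ∀ t, 12 ∣ K t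
  large : 3 ≤ growthConst φ ρ Λ * K 0
  step : ∀ t, |(K (t + 1) : ℝ) - growthConst φ ρ Λ * (K t : ℝ) ^ 2| < 12

/-- `t* = min {t ≥ 0 : K_t ≥ (log n)^{1.1}}`. -/
def tStar (K : ℕ → ℕ) (n : ℕ) : ℕ :=
  sInf {t : ℕ | Real.log n ^ (1.1 : ℝ) ≤ (K t : ℝ)}

/-! ### Matrix norms -/

/-- The Frobenius norm. -/
def frobNorm {ι κ : Type*} [Fintype ι] [Fintype κ] (M : Matrix ι κ ℝ) : ℝ :=
  Real.sqrt (∑ i, ∑ j, M i j ^ 2)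

/-- The operator norm with respect to the Euclidean norm. -/
def opNorm {n : ℕ} (M : Matrix (Fin n) (Fin n) ℝ) : ℝ :=
  ‖Matrix.toEuclideanCLM (n := Fin n) (𝕜 := ℝ) M‖

/-! ### The correlated Wigner model, the corruption and the preprocessing -/

/-- `(A, B)` is a pair of correlated Gaussian Wigner matrices with correlation `ρ` and latent
permutation `π`: the pairs `(A_{ij}, B_{π(i)π(j)})`, `i < j`, are independent bivariate standard
normal with correlation `ρ`.  Diagonal entries are never used below. -/
structure IsCorrelatedWigner {Ω : Type*} [MeasurableSpace Ω] (P : Measure Ω) {n : ℕ}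
    (ρ : ℝ) (π : Equiv.Perm (Fin n)) (A B : Ω → Matrix (Fin n) (Fin n) ℝ) : Prop where
  measurable_fst : Measurable A
  measurable_snd : Measurable B
  symm_fst : ∀ ω, (A ω).IsSymm
  symm_snd : ∀ ω, (B ω).IsSymm
  law : ∀ i j : Fin n, i < j →
    P.map (fun ω => (A ω i j, B ω (π i) (π j))) = bivariateNormal ρ
  indep : iIndepFun
    (fun (p : {p : Fin n × Fin n // p.1 < p.2}) ω =>
      (A ω p.1.1 p.1.2, B ω (π p.1.1) (π p.1.2))) P

open scoped Classical in
/-- The set of indices of the nonzero rows of `M`; for symmetric `M` this is the smallest `Q` such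
that `M_{ij} = 0` for all `(i, j) ∉ Q × Q`. -/
def supportSet {n : ℕ} (M : Matrix (Fin n) (Fin n) ℝ) : Finset (Fin n) :=
  {i | ∃ j, M i j ≠ 0}

/-- `E` is a random symmetric matrix supported on a principal minor of size at most `ε n`. -/
structure IsCorruption {Ω : Type*} [MeasurableSpace Ω] {n : ℕ} (ε : ℝ)
    (E : Ω → Matrix (Fin n) (Fin n) ℝ) : Prop where
  measurable : Measurable E
  symm : ∀ ω, (E ω).IsSymm
  card_le : ∀ ω, ((supportSet (E ω)).card : ℝ) ≤ ε * n

/-- The matrix with entries `(X_{ij} + Y_{ij}) / √2` below the diagonal and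
`(X_{ij} - Y_{ij}) / √2` above it (and `0` on the diagonal). -/
def noisy {n : ℕ} (X Y : Matrix (Fin n) (Fin n) ℝ) : Matrix (Fin n) (Fin n) ℝ :=
  Matrix.of fun i j =>
    if j < i then (X i j + Y i j) / Real.sqrt 2
    else if i < j then (X i j - Y i j) / Real.sqrt 2
    else 0

/-! ### Spectral cleaning -/

/-- Zero out the rows and columns of `M` with index in `S`. -/
def zeroOut {n : ℕ} (M : Matrix (Fin n) (Fin n) ℝ) (S : Finset (Fin n)) :
    Matrix (Fin n) (Fin n) ℝ :=
  Matrix.of fun i j => if i ∈ S ∨ j ∈ S then 0 else M i j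

/-- The set of indices removed by the first `k` rounds of the while loop, when the index sampled
in round `k` is `I k`: the loop goes on as long as the operator norm is at least `10 √n`. -/
def removedUpTo {n : ℕ} (M : Matrix (Fin n) (Fin n) ℝ) (I : ℕ → Fin n) : ℕ → Finset (Fin n)
  | 0 => ∅
  | k + 1 =>
    if 10 * Real.sqrt n ≤ opNorm (zeroOut M (removedUpTo M I k)) then
      insert (I k) (removedUpTo M I k)
    else removedUpTo M I k

open scoped Classical in
/-- The set of all indices removed by the spectral cleaning. -/
def removedSet {n : ℕ} (M : Matrix (Fin n) (Fin n) ℝ) (I : ℕ → Fin n) : Finset (Fin n) :=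
  {i | ∃ k, i ∈ removedUpTo M I k}

/-- The output of the spectral cleaning. -/
def cleaned {n : ℕ} (M : Matrix (Fin n) (Fin n) ℝ) (I : ℕ → Fin n) :
    Matrix (Fin n) (Fin n) ℝ :=
  zeroOut M (removedSet M I)

/-- `v` and `u` are unit left and right singular vectors for the leading singular value of `M`. -/
def IsLeadingSingularPair {n : ℕ} (M : Matrix (Fin n) (Fin n) ℝ) (v u : Fin n → ℝ) : Prop :=
  ∑ i, v i ^ 2 = 1 ∧ ∑ i, u i ^ 2 = 1 ∧
    M.mulVec u = opNorm M • v ∧ M.transpose.mulVec v = opNorm M • u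

/-- The sampling rule of the spectral cleaning of the random matrix `M`: in each round `k` in
which the loop is still running, the conditional probability that the sampled index is `i`, given
the inputs `X` and the indices sampled earlier, is `(v_i² + u_i²) / 2`, where `v, u` are leading
unit singular vectors of the current matrix. -/
structure IsCleaningRun {Ω D : Type*} [MeasurableSpace Ω] [MeasurableSpace D] (P : Measure Ω)
    {n : ℕ} (X : Ω → D) (M : Ω → Matrix (Fin n) (Fin n) ℝ) (I : ℕ → Ω → Fin n) : Prop where
  measurable : ∀ k, Measurable (I k)
  sampling : ∀ k, ∀ᵐ ω ∂P,
    10 * Real.sqrt n ≤ opNorm (zeroOut (M ω) (removedUpTo (M ω) (fun l => I l ω) k)) →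
    ∃ v u : Fin n → ℝ,
      IsLeadingSingularPair (zeroOut (M ω) (removedUpTo (M ω) (fun l => I l ω) k)) v u ∧
      ∀ i, condExp (MeasurableSpace.comap (fun ω' => (X ω', fun l : Fin k => I l ω')) inferInstance)
          P (Set.indicator {ω' | I k ω' = i} (fun _ => (1 : ℝ))) ω
        = (v i ^ 2 + u i ^ 2) / 2

/-! ### The spectral subroutine -/

/-- The sign matrices `β^{(t)}` of size `K_t / 12 × K_{t+1}`. -/
abbrev BetaSeq (K : ℕ → ℕ) : Type := ∀ t, Matrix (Fin (K t / 12)) (Fin (K (t + 1))) ℝ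

/-- The matrices `Ξ^{(t)}` of size `K_t × K_t / 12`. -/
abbrev XiSeq (K : ℕ → ℕ) : Type := ∀ t, Matrix (Fin (K t)) (Fin (K t / 12)) ℝ

/-- `Φ^{(0)} = I` and `Φ^{(t+1)}_{ij} = ϕ(⟨β_i, β_j⟩)` with `β_i` the columns of `β^{(t)}`. -/
def PhiMat (φ : ℝ → ℝ) {K : ℕ → ℕ} (β : BetaSeq K) : ∀ t, Matrix (Fin (K t)) (Fin (K t)) ℝ
  | 0 => 1
  | t + 1 => Matrix.of fun i j => gaussCorr φ (((β t).transpose * β t) i j)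

/-- `Ψ^{(0)} = ϕ(ρ/2) I` and
`Ψ^{(t+1)}_{ij} = ϕ((ρ/2) β_iᵀ (Ξ^{(t)})ᵀ Ψ^{(t)} Ξ^{(t)} β_j)`. -/
def PsiMat (φ : ℝ → ℝ) (ρ : ℝ) {K : ℕ → ℕ} (β : BetaSeq K) (Ξ : XiSeq K) :
    ∀ t, Matrix (Fin (K t)) (Fin (K t)) ℝ
  | 0 => gaussCorr φ (ρ / 2) • (1 : Matrix (Fin (K 0)) (Fin (K 0)) ℝ)
  | t + 1 => Matrix.of fun i j =>
      gaussCorr φ (ρ / 2 *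
        ((β t).transpose * ((Ξ t).transpose * PsiMat φ ρ β Ξ t * Ξ t) * β t) i j)

/-- `ε_0 = ϕ(ρ/2)` and `ε_{t+1} = ϕ((ρ/2) (12/K_t) tr((Ξ^{(t)})ᵀ Ψ^{(t)} Ξ^{(t)}))`. -/
def epsSeq (φ : ℝ → ℝ) (ρ : ℝ) {K : ℕ → ℕ} (β : BetaSeq K) (Ξ : XiSeq K) : ℕ → ℝ
  | 0 => gaussCorr φ (ρ / 2)
  | t + 1 => gaussCorr φ (ρ / 2 * (12 / (K t : ℝ) *
      ((Ξ t).transpose * PsiMat φ ρ β Ξ t * Ξ t).trace))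

/-- `ν` is an orthonormal family of `m` eigenvectors of `M` with eigenvalues in `W`.  For symmetric
`M` such a family exists iff at least `m` eigenvalues (with multiplicity) lie in `W`. -/
def IsEigenFamily {k m : ℕ} (M : Matrix (Fin k) (Fin k) ℝ) (W : Set ℝ)
    (ν : Fin m → Fin k → ℝ) : Prop :=
  (∀ i j, ν i ⬝ᵥ ν j = if i = j then 1 else 0) ∧
    ∀ i, ∃ c ∈ W, M.mulVec (ν i) = c • ν i

/-- `(β, Ξ)` is an accepted output of the spectral subroutine up to time `T`: the `β^{(t)}` have
entries `±√(12/K_t)`; `Φ^{(t)}` and `Ψ^{(t)}` have `3 K_t / 4` eigenvalues in `(0.9, 1.1)` and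
`(0.9 ε_t, 1.1 ε_t)`; and the columns of `Ξ^{(t)}` lie in the spans of both families of
eigenvectors, are `Φ^{(t)}`-orthonormal, `Ψ^{(t)}`-orthogonal, and have `Ψ^{(t)}`-energies in
`[0.9 ε_t, 1.1 ε_t]`. -/
structure IsSpectralOutput (φ : ℝ → ℝ) (ρ : ℝ) {K : ℕ → ℕ} (T : ℕ)
    (β : BetaSeq K) (Ξ : XiSeq K) : Prop where
  sign : ∀ t < T, ∀ i j,
    β t i j = Real.sqrt (12 / (K t : ℝ)) ∨ β t i j = -Real.sqrt (12 / (K t : ℝ))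
  spectral : ∀ t ≤ T, ∃ ν ζ : Fin (3 * K t / 4) → Fin (K t) → ℝ,
    IsEigenFamily (PhiMat φ β t) (Set.Ioo 0.9 1.1) ν ∧
    IsEigenFamily (PsiMat φ ρ β Ξ t)
      (Set.Ioo (0.9 * epsSeq φ ρ β Ξ t) (1.1 * epsSeq φ ρ β Ξ t)) ζ ∧
    ∀ j, (fun i => Ξ t i j) ∈ Submodule.span ℝ (Set.range ν) ⊓ Submodule.span ℝ (Set.range ζ)
  phi_orthonormal : ∀ t ≤ T, (Ξ t).transpose * PhiMat φ β t * Ξ t = 1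
  psi_orthogonal : ∀ t ≤ T, ((Ξ t).transpose * PsiMat φ ρ β Ξ t * Ξ t).IsDiag
  psi_energy : ∀ t ≤ T, ∀ j, ((Ξ t).transpose * PsiMat φ ρ β Ξ t * Ξ t) j j ∈
    Set.Icc (0.9 * epsSeq φ ρ β Ξ t) (1.1 * epsSeq φ ρ β Ξ t)

/-! ### The message passing iteration -/

/-- The rows kept by the iteration: `[n] \ U` for a sequence `U` of distinct vertices. -/
abbrev Rest {n k : ℕ} (U : Fin k ↪ Fin n) : Type := {i : Fin n // i ∉ Set.range U}

/-- `f^{(0)}_{i,k} = φ(M_{i,u_k})` for `i ∈ [n] \ U`. -/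
def initIter (φ : ℝ → ℝ) {n k : ℕ} (M : Matrix (Fin n) (Fin n) ℝ) (U : Fin k ↪ Fin n) :
    Matrix (Rest U) (Fin k) ℝ :=
  Matrix.of fun i j => φ (M i.1 (U j))

/-- `h = n^{-1/2} M_{([n] \ U) × ([n] \ U)} f Ξ`. -/
def linStep {n k a b : ℕ} (M : Matrix (Fin n) (Fin n) ℝ) (U : Fin k ↪ Fin n)
    (f : Matrix (Rest U) (Fin a) ℝ) (Ξ : Matrix (Fin a) (Fin b) ℝ) :
    Matrix (Rest U) (Fin b) ℝ :=
  (1 / Real.sqrt n) • (M.submatrix (fun i : Rest U => i.1) (fun i : Rest U => i.1) * f * Ξ)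

/-- The iterates `f^{(t)}` driven by the matrix `M`, started from `f0`:
`f^{(t+1)} = φ ∘ (h^{(t)} β^{(t)})`. -/
def fIter (φ : ℝ → ℝ) {n k : ℕ} {K : ℕ → ℕ} (β : BetaSeq K) (Ξ : XiSeq K)
    (M : Matrix (Fin n) (Fin n) ℝ) (U : Fin k ↪ Fin n) (f0 : Matrix (Rest U) (Fin (K 0)) ℝ) :
    ∀ t, Matrix (Rest U) (Fin (K t)) ℝ
  | 0 => f0
  | t + 1 => (linStep M U (fIter φ β Ξ M U f0 t) (Ξ t) * β t).map φ

/-- The iterates `h^{(t)}` driven by the matrix `M`, started from `f0`. -/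
def hIter (φ : ℝ → ℝ) {n k : ℕ} {K : ℕ → ℕ} (β : BetaSeq K) (Ξ : XiSeq K)
    (M : Matrix (Fin n) (Fin n) ℝ) (U : Fin k ↪ Fin n) (f0 : Matrix (Rest U) (Fin (K 0)) ℝ)
    (t : ℕ) : Matrix (Rest U) (Fin (K t / 12)) ℝ :=
  linStep M U (fIter φ β Ξ M U f0 t) (Ξ t)

/-! ### The whole random input -/

/-- All random objects: the Wigner matrices `A, B`, the corruptions `E, F`, the added noises
`G, H`, the indices `I, J` sampled by the two spectral cleanings, and the output `β, Ξ` of the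
spectral subroutine. -/
structure RandomInput (Ω : Type*) (n : ℕ) (K : ℕ → ℕ) where
  A : Ω → Matrix (Fin n) (Fin n) ℝ
  B : Ω → Matrix (Fin n) (Fin n) ℝ
  E : Ω → Matrix (Fin n) (Fin n) ℝ
  F : Ω → Matrix (Fin n) (Fin n) ℝ
  G : Ω → Matrix (Fin n) (Fin n) ℝ
  H : Ω → Matrix (Fin n) (Fin n) ℝ
  I : ℕ → Ω → Fin n
  J : ℕ → Ω → Fin n
  β : Ω → BetaSeq K
  Ξ : Ω → XiSeq K

namespace RandomInput

variable {Ω : Type*} {n : ℕ} {K : ℕ → ℕ}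

/-- The clean matrix `𝒜`. -/
def cleanA (X : RandomInput Ω n K) (ω : Ω) : Matrix (Fin n) (Fin n) ℝ := noisy (X.A ω) (X.G ω)

/-- The clean matrix `ℬ`. -/
def cleanB (X : RandomInput Ω n K) (ω : Ω) : Matrix (Fin n) (Fin n) ℝ := noisy (X.B ω) (X.H ω)

/-- The preprocessed observation built from `A' = A + E`. -/
def obsA (X : RandomInput Ω n K) (ω : Ω) : Matrix (Fin n) (Fin n) ℝ :=
  noisy (X.A ω + X.E ω) (X.G ω)

/-- The preprocessed observation built from `B' = B + F`. -/
def obsB (X : RandomInput Ω n K) (ω : Ω) : Matrix (Fin n) (Fin n) ℝ :=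
  noisy (X.B ω + X.F ω) (X.H ω)

/-- The indices `S` removed by the spectral cleaning of the first observation. -/
def S (X : RandomInput Ω n K) (ω : Ω) : Finset (Fin n) :=
  removedSet (X.obsA ω) (fun k => X.I k ω)

/-- The indices `T` removed by the spectral cleaning of the second observation. -/
def T (X : RandomInput Ω n K) (ω : Ω) : Finset (Fin n) :=
  removedSet (X.obsB ω) (fun k => X.J k ω)

/-- The spectrally cleaned first observation `𝒜̂`. -/
def hatA (X : RandomInput Ω n K) (ω : Ω) : Matrix (Fin n) (Fin n) ℝ :=
  cleaned (X.obsA ω) (fun k => X.I k ω)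

/-- The spectrally cleaned second observation `ℬ̂`. -/
def hatB (X : RandomInput Ω n K) (ω : Ω) : Matrix (Fin n) (Fin n) ℝ :=
  cleaned (X.obsB ω) (fun k => X.J k ω)

/-- All matrix inputs of the two cleanings, including those hidden from the algorithm. -/
def data (X : RandomInput Ω n K) (ω : Ω) := (X.A ω, X.B ω, X.E ω, X.F ω, X.G ω, X.H ω)

/-- The joint law of the random inputs.  `(E, F)` may depend on `(A, B)` in any way.  The noises
`G, H` are symmetric with independent standard normal entries above the diagonal, independent of
`(A, B, E, F)`.  The output of the spectral subroutine is independent of the matrix inputs; any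
law carried by the accepted outputs is allowed, in particular that of uniform independent signs
resampled until accepted. -/
structure IsModel [MeasurableSpace Ω] (X : RandomInput Ω n K) (P : Measure Ω)
    (φ : ℝ → ℝ) (ρ ε : ℝ) (π : Equiv.Perm (Fin n)) : Prop where
  wigner : IsCorrelatedWigner P ρ π X.A X.B
  corruption_fst : IsCorruption ε X.E
  corruption_snd : IsCorruption ε X.F
  noise : IsCorrelatedWigner P 0 1 X.G X.H
  noise_indep :
    IndepFun (fun ω => (X.A ω, X.B ω, X.E ω, X.F ω)) (fun ω => (X.G ω, X.H ω)) P
  cleaning_fst : IsCleaningRun P X.data X.obsA X.I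
  cleaning_snd : IsCleaningRun P X.data X.obsB X.J
  measurable_beta : Measurable X.β
  measurable_Xi : Measurable X.Ξ
  spectral_indep : IndepFun X.data (fun ω => (X.β ω, X.Ξ ω)) P
  spectral : ∀ᵐ ω ∂P, IsSpectralOutput φ ρ (tStar K n) (X.β ω) (X.Ξ ω)

/-- `(U, V)` is a good pair: `U` avoids `Q ∪ S`, `V` avoids `R ∪ T`, and `v_k = π(u_k)`, where
`Q, R` are the supports of `E, F`. -/
def IsGoodPair (X : RandomInput Ω n K) (π : Equiv.Perm (Fin n)) (ω : Ω)
    (U V : Fin (K 0) ↪ Fin n) : Prop :=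
  (∀ k, U k ∉ supportSet (X.E ω) ∪ X.S ω) ∧
  (∀ k, V k ∉ supportSet (X.F ω) ∪ X.T ω) ∧
  ∀ k, V k = π (U k)

variable (X : RandomInput Ω n K) (φ : ℝ → ℝ) (ω : Ω)

/-- The corrupted iterates `f̂^{(t)}`. -/
def fHat (U : Fin (K 0) ↪ Fin n) (t : ℕ) : Matrix (Rest U) (Fin (K t)) ℝ :=
  fIter φ (X.β ω) (X.Ξ ω) (X.hatA ω) U (initIter φ (X.hatA ω) U) t

/-- The corrupted iterates `ĝ^{(t)}`. -/
def gHat (V : Fin (K 0) ↪ Fin n) (t : ℕ) : Matrix (Rest V) (Fin (K t)) ℝ :=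
  fIter φ (X.β ω) (X.Ξ ω) (X.hatB ω) V (initIter φ (X.hatB ω) V) t

/-- The corrupted iterates `ĥ^{(t)}`. -/
def hHat (U : Fin (K 0) ↪ Fin n) (t : ℕ) : Matrix (Rest U) (Fin (K t / 12)) ℝ :=
  hIter φ (X.β ω) (X.Ξ ω) (X.hatA ω) U (initIter φ (X.hatA ω) U) t

/-- The corrupted iterates `ℓ̂^{(t)}`. -/
def lHat (V : Fin (K 0) ↪ Fin n) (t : ℕ) : Matrix (Rest V) (Fin (K t / 12)) ℝ :=
  hIter φ (X.β ω) (X.Ξ ω) (X.hatB ω) V (initIter φ (X.hatB ω) V) t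

/-- The clean iterates `f^{(t)}`; they share the initialisation of the corrupted ones. -/
def fClean (U : Fin (K 0) ↪ Fin n) (t : ℕ) : Matrix (Rest U) (Fin (K t)) ℝ :=
  fIter φ (X.β ω) (X.Ξ ω) (X.cleanA ω) U (initIter φ (X.hatA ω) U) t

/-- The clean iterates `g^{(t)}`. -/
def gClean (V : Fin (K 0) ↪ Fin n) (t : ℕ) : Matrix (Rest V) (Fin (K t)) ℝ :=
  fIter φ (X.β ω) (X.Ξ ω) (X.cleanB ω) V (initIter φ (X.hatB ω) V) t

/-- The clean iterates `h^{(t)}`. -/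
def hClean (U : Fin (K 0) ↪ Fin n) (t : ℕ) : Matrix (Rest U) (Fin (K t / 12)) ℝ :=
  hIter φ (X.β ω) (X.Ξ ω) (X.cleanA ω) U (initIter φ (X.hatA ω) U) t

/-- The clean iterates `ℓ^{(t)}`. -/
def lClean (V : Fin (K 0) ↪ Fin n) (t : ℕ) : Matrix (Rest V) (Fin (K t / 12)) ℝ :=
  hIter φ (X.β ω) (X.Ξ ω) (X.cleanB ω) V (initIter φ (X.hatB ω) V) t

end RandomInput

/-- `ℵ_t = ∏_{s ≤ t} (1000 log(1/ε)² K_s)`. -/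
def alephSeq (K : ℕ → ℕ) (ε : ℝ) (t : ℕ) : ℝ :=
  ∏ s ∈ Finset.range (t + 1), (1000 * Real.log ε⁻¹ ^ 2 * (K s : ℝ))

end RobustMatching

end

/-!
The two observed matrices are treated separately and in the same way; write `C` for the clean
matrix, `O` for the observed one, `Q` for the corrupted indices, `S` for the removed ones, and
`y = ε n`, `L = log ε⁻¹`. By the corruption model, `O` and `C` agree outside of `Q × Q`.

*Few indices are removed.* Since the preprocessing makes the off-diagonal entries of `C`
independent standard normal (`IsWigner.map_noisy`), a net argument gives `‖C‖ ≤ 9 √n` up to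
probability `exp (-n)` (`gaussianMatrix_opNorm_gt_le`). On that event, while the current matrix has
norm at least `10 √n`, its leading singular vectors put mass at least `1/19` on corrupted indices
not removed yet (`singular_mass_ge`). Hence `2 ^ (-|S ∩ Q|)`, killed when the loop stops, shrinks on
average by the factor `37/38` in each round, and the loop stops within `101 y L` rounds with high
probability (`measure_running_le`).

*The iterates do not see the removed rows.* For a fixed set `S`, the iterates driven by
`zeroOut C S` are independent of the rows of `C` in `S`. Hence, conditionally, the product of these
rows with the iterates is Gaussian, and its exponential moment shows that it is much smaller than
the operator norm of `C` would allow (`measure_not_crossBound_le`). The bound is strong enough for a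
union over all `S` of size at most `101 y L`, all starting sequences and all times
(`union_bound_le`), which removes the dependence of the actual `S` on `C`.

*Propagation.* Given these events, both iterations are compared with the one driven by
`zeroOut C S`, from the same initial values, as the starting sequence avoids `Q`. The difference of
`O` and `C` off `S` is supported on the few indices of `Q`, where the iterates are bounded; the
difference of `zeroOut C S` and `C` is controlled by the cross bound and by the size of `S`. Each
step multiplies the error by a factor dominated by `1000 L² K_t`, because `Ξ` has bounded norm, the
columns of `β` are unit vectors and the denoiser is Lipschitz (`iterate_error`, `error_of_typical`).

When `y < 1` nothing is corrupted at all, so that nothing is removed and there is no error.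
-/

namespace RobustMatching

/-! ### Frobenius and operator norms -/

section Norms

variable {ι κ μ : Type*} [Fintype ι] [Fintype κ] [Fintype μ]

theorem frobNorm_nonneg (M : Matrix ι κ ℝ) : 0 ≤ frobNorm M := Real.sqrt_nonneg _

theorem frobNorm_sq (M : Matrix ι κ ℝ) : frobNorm M ^ 2 = ∑ i, ∑ j, M i j ^ 2 :=
  Real.sq_sqrt (Finset.sum_nonneg fun _ _ => Finset.sum_nonneg fun _ _ => sq_nonneg _)

theorem frobNorm_zero : frobNorm (0 : Matrix ι κ ℝ) = 0 := by simp [frobNorm]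

theorem frobNorm_eq_norm (M : Matrix ι κ ℝ) :
    frobNorm M = ‖WithLp.toLp 2 (fun p : ι × κ => M p.1 p.2)‖ := by
  simp [frobNorm, EuclideanSpace.norm_eq, Fintype.sum_prod_type]

theorem frobNorm_add_le (M N : Matrix ι κ ℝ) : frobNorm (M + N) ≤ frobNorm M + frobNorm N := by
  simp only [frobNorm_eq_norm]
  exact norm_add_le (WithLp.toLp 2 (fun p : ι × κ => M p.1 p.2))
    (WithLp.toLp 2 (fun p : ι × κ => N p.1 p.2))

theorem frobNorm_sub_comm (M N : Matrix ι κ ℝ) : frobNorm (M - N) = frobNorm (N - M) := by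
  simp only [frobNorm_eq_norm]
  exact norm_sub_rev (WithLp.toLp 2 (fun p : ι × κ => M p.1 p.2))
    (WithLp.toLp 2 (fun p : ι × κ => N p.1 p.2))

theorem frobNorm_smul (c : ℝ) (M : Matrix ι κ ℝ) : frobNorm (c • M) = |c| * frobNorm M := by
  simp only [frobNorm_eq_norm]
  exact norm_smul c (WithLp.toLp 2 (fun p : ι × κ => M p.1 p.2))

theorem frobNorm_le_of_sq_le {M : Matrix ι κ ℝ} {c : ℝ} (hc : 0 ≤ c)
    (h : ∑ i, ∑ j, M i j ^ 2 ≤ c ^ 2) : frobNorm M ≤ c :=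
  abs_le_of_sq_le_sq' (by rwa [frobNorm_sq]) hc |>.2

theorem frobNorm_mul_le (M : Matrix ι κ ℝ) (N : Matrix κ μ ℝ) :
    frobNorm (M * N) ≤ frobNorm M * frobNorm N := by
  refine frobNorm_le_of_sq_le (mul_nonneg (frobNorm_nonneg _) (frobNorm_nonneg _)) ?_
  rw [mul_pow, frobNorm_sq, frobNorm_sq, Finset.sum_mul]
  refine Finset.sum_le_sum fun i _ => ?_
  rw [Finset.sum_comm (f := fun k j => N k j ^ 2), Finset.mul_sum]
  exact Finset.sum_le_sum fun j _ => by
    rw [Matrix.mul_apply]; exact Finset.sum_mul_sq_le_sq_mul_sq _ _ _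

/-- If `N` has operator norm at most `c` then `‖M N‖_F ≤ c ‖M‖_F`. -/
theorem frobNorm_mul_le_of_mulVec {M : Matrix ι κ ℝ} {N : Matrix κ μ ℝ} {c : ℝ} (hc : 0 ≤ c)
    (h : ∀ z, ∑ i, (N.mulVec z) i ^ 2 ≤ c ^ 2 * ∑ j, z j ^ 2) :
    frobNorm (M * N) ≤ c * frobNorm M := by
  refine frobNorm_le_of_sq_le (mul_nonneg hc (frobNorm_nonneg _)) ?_
  rw [mul_pow, frobNorm_sq, Finset.mul_sum]
  refine Finset.sum_le_sum fun i _ => ?_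
  set z : μ → ℝ := fun j => (M * N) i j with hz
  -- With `z` the `i`-th row of `M N`, `‖z‖² = ⟨M_i, N z⟩`.
  have h1 : ∑ j, z j ^ 2 = ∑ k, M i k * (N.mulVec z) k := by
    simp only [Matrix.mulVec, dotProduct, Finset.mul_sum]
    rw [Finset.sum_comm]
    refine Finset.sum_congr rfl fun j _ => ?_
    rw [sq]; nth_rewrite 1 [hz]
    simp only [Matrix.mul_apply, Finset.sum_mul]
    exact Finset.sum_congr rfl fun k _ => by ring
  have h2 := Finset.sum_mul_sq_le_sq_mul_sq Finset.univ (fun k => M i k) (fun k => N.mulVec z k)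
  rw [← h1] at h2
  have h3 : (∑ j, z j ^ 2) ^ 2 ≤ (c ^ 2 * ∑ k, M i k ^ 2) * ∑ j, z j ^ 2 := by
    refine h2.trans ?_
    calc _ ≤ (∑ k, M i k ^ 2) * (c ^ 2 * ∑ j, z j ^ 2) :=
          mul_le_mul_of_nonneg_left (h z) (Finset.sum_nonneg fun _ _ => sq_nonneg _)
      _ = _ := by ring
  have h4 : 0 ≤ ∑ j, z j ^ 2 := Finset.sum_nonneg fun _ _ => sq_nonneg _
  rcases h4.eq_or_lt with h5 | h5
  · rw [← h5]; positivity
  · rw [sq] at h3; exact le_of_mul_le_mul_right h3 h5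

variable {n : ℕ}

theorem opNorm_nonneg (M : Matrix (Fin n) (Fin n) ℝ) : 0 ≤ opNorm M := norm_nonneg _

theorem opNorm_sub_le (M N : Matrix (Fin n) (Fin n) ℝ) :
    opNorm (M - N) ≤ opNorm M + opNorm N := by
  unfold opNorm; rw [map_sub]; exact norm_sub_le _ _

theorem toEuclideanCLM_toLp (M : Matrix (Fin n) (Fin n) ℝ) (x : Fin n → ℝ) :
    Matrix.toEuclideanCLM (n := Fin n) (𝕜 := ℝ) M (WithLp.toLp 2 x)
      = WithLp.toLp 2 (M.mulVec x) := rfl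

theorem norm_toLp_sq (x : Fin n → ℝ) : ‖WithLp.toLp 2 x‖ ^ 2 = ∑ i, x i ^ 2 := by
  simp [EuclideanSpace.real_norm_sq_eq]

theorem sum_mulVec_sq_le (M : Matrix (Fin n) (Fin n) ℝ) (x : Fin n → ℝ) :
    ∑ i, (M.mulVec x) i ^ 2 ≤ opNorm M ^ 2 * ∑ i, x i ^ 2 := by
  rw [← norm_toLp_sq, ← norm_toLp_sq, ← toEuclideanCLM_toLp, ← mul_pow]
  exact pow_le_pow_left₀ (norm_nonneg _) (ContinuousLinearMap.le_opNorm _ _) 2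

theorem opNorm_le_of_mulVec {M : Matrix (Fin n) (Fin n) ℝ} {c : ℝ} (hc : 0 ≤ c)
    (h : ∀ x : Fin n → ℝ, ∑ i, (M.mulVec x) i ^ 2 ≤ c ^ 2 * ∑ i, x i ^ 2) : opNorm M ≤ c := by
  refine ContinuousLinearMap.opNorm_le_bound _ hc fun x => ?_
  have h1 := h x.ofLp
  rw [← norm_toLp_sq, ← norm_toLp_sq, ← toEuclideanCLM_toLp, ← mul_pow] at h1
  exact abs_le_of_sq_le_sq' h1 (by positivity) |>.2

/-- The bilinear form of `M` is bounded by the operator norm. -/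
theorem abs_bilin_le (M : Matrix (Fin n) (Fin n) ℝ) (x y : Fin n → ℝ) :
    |x ⬝ᵥ M.mulVec y| ≤ opNorm M * (Real.sqrt (∑ i, x i ^ 2) * Real.sqrt (∑ i, y i ^ 2)) := by
  refine abs_le_of_sq_le_sq ?_ (mul_nonneg (opNorm_nonneg _) (by positivity))
  have hx : 0 ≤ ∑ i, x i ^ 2 := Finset.sum_nonneg fun _ _ => sq_nonneg _
  have hy : 0 ≤ ∑ i, y i ^ 2 := Finset.sum_nonneg fun _ _ => sq_nonneg _
  rw [mul_pow, mul_pow, Real.sq_sqrt hx, Real.sq_sqrt hy]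
  calc _ ≤ (∑ i, x i ^ 2) * ∑ i, (M.mulVec y) i ^ 2 := Finset.sum_mul_sq_le_sq_mul_sq _ _ _
    _ ≤ (∑ i, x i ^ 2) * (opNorm M ^ 2 * ∑ i, y i ^ 2) :=
        mul_le_mul_of_nonneg_left (sum_mulVec_sq_le M y) hx
    _ = _ := by ring

/-- Keeping only a block of rows and columns does not increase the operator norm. -/
theorem opNorm_mask_le (M : Matrix (Fin n) (Fin n) ℝ) (p q : Fin n → Prop) [DecidablePred p]
    [DecidablePred q] :
    opNorm (Matrix.of fun i j => if p i ∧ q j then M i j else 0) ≤ opNorm M := by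
  refine opNorm_le_of_mulVec (opNorm_nonneg _) fun x => ?_
  set y : Fin n → ℝ := fun j => if q j then x j else 0 with hy
  have h1 : ∀ i, ((Matrix.of fun i j => if p i ∧ q j then M i j else 0).mulVec x) i ^ 2
      ≤ (M.mulVec y) i ^ 2 := by
    intro i
    by_cases hi : p i
    · refine le_of_eq (congrArg (· ^ 2) ?_)
      simp only [Matrix.mulVec, dotProduct]
      refine Finset.sum_congr rfl fun j _ => ?_
      by_cases hj : q j <;> simp [hi, hj, hy]
    · have : ((Matrix.of fun i j => if p i ∧ q j then M i j else 0).mulVec x) i = 0 := by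
        simp [Matrix.mulVec, dotProduct, hi]
      rw [this, zero_pow two_ne_zero]; exact sq_nonneg _
  calc _ ≤ ∑ i, (M.mulVec y) i ^ 2 := Finset.sum_le_sum fun i _ => h1 i
    _ ≤ opNorm M ^ 2 * ∑ i, y i ^ 2 := sum_mulVec_sq_le M y
    _ ≤ _ := by
        refine mul_le_mul_of_nonneg_left (Finset.sum_le_sum fun j _ => ?_) (sq_nonneg _)
        by_cases hj : q j <;> simp [hj, hy, sq_nonneg]

theorem opNorm_zeroOut_le (M : Matrix (Fin n) (Fin n) ℝ) (S : Finset (Fin n)) :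
    opNorm (zeroOut M S) ≤ opNorm M := by
  have h : zeroOut M S = Matrix.of fun i j => if i ∉ S ∧ j ∉ S then M i j else 0 := by
    ext i j
    by_cases hi : i ∈ S <;> by_cases hj : j ∈ S <;> simp [zeroOut, hi, hj]
  rw [h]
  exact opNorm_mask_le M (· ∉ S) (· ∉ S)

theorem frobNorm_submatrix_mul_le (M : Matrix (Fin n) (Fin n) ℝ) (p : Fin n → Prop)
    [Fintype {i // p i}] (f : Matrix {i // p i} κ ℝ) :
    frobNorm (M.submatrix (fun i : {i // p i} => i.1) (fun i : {i // p i} => i.1) * f)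
      ≤ opNorm M * frobNorm f := by
  classical
  refine frobNorm_le_of_sq_le (mul_nonneg (opNorm_nonneg _) (frobNorm_nonneg _)) ?_
  rw [mul_pow, frobNorm_sq, Finset.sum_comm, Finset.sum_comm (f := fun i j => f i j ^ 2),
    Finset.mul_sum]
  refine Finset.sum_le_sum fun k _ => ?_
  set y : Fin n → ℝ := fun j => if h : p j then f ⟨j, h⟩ k else 0 with hy
  have hsum : ∀ g : Fin n → ℝ, (∑ i : {i // p i}, g i) = ∑ i, if p i then g i else 0 := by
    intro g
    rw [← Finset.sum_filter]
    exact (Finset.sum_subtype _ (by simp) g).symm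
  have hyv : ∀ i : {i // p i}, y i = f i k := fun i => by simp [hy, i.2]
  have h1 : ∑ i : {i // p i}, f i k ^ 2 = ∑ i, y i ^ 2 := by
    simp_rw [← hyv]
    rw [hsum (fun i => y i ^ 2)]
    refine Finset.sum_congr rfl fun i _ => ?_
    by_cases hi : p i <;> simp [hi, hy]
  have h2 : ∀ i : {i // p i}, (M.submatrix (fun i : {i // p i} => i.1)
      (fun i : {i // p i} => i.1) * f) i k = M.mulVec y i := by
    intro i
    simp only [Matrix.mul_apply, Matrix.submatrix_apply, Matrix.mulVec, dotProduct]
    simp_rw [← hyv]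
    rw [hsum (fun j => M i j * y j)]
    refine Finset.sum_congr rfl fun j _ => ?_
    by_cases hj : p j <;> simp [hj, hy]
  rw [h1]
  simp_rw [h2]
  refine le_trans ?_ (sum_mulVec_sq_le M y)
  rw [hsum (fun i => M.mulVec y i ^ 2)]
  refine Finset.sum_le_sum fun i _ => ?_
  split_ifs
  · exact le_rfl
  · exact sq_nonneg _

/-- If the columns of `M` outside `Q` vanish and the entries of `f` are at most `b`, then only
the rows of `f` in `Q` matter. -/
theorem frobNorm_submatrix_mul_le_of_support {k : ℕ} (M : Matrix (Fin n) (Fin n) ℝ)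
    (p : Fin n → Prop) [Fintype {i // p i}] (f : Matrix {i // p i} (Fin k) ℝ)
    (Q : Finset (Fin n)) (hM : ∀ i j, j ∉ Q → M i j = 0) {b : ℝ} (hb : 0 ≤ b)
    (hf : ∀ i j, |f i j| ≤ b) :
    frobNorm (M.submatrix (fun i : {i // p i} => i.1) (fun i : {i // p i} => i.1) * f)
      ≤ opNorm M * (b * Real.sqrt (Q.card * k)) := by
  classical
  set g : Matrix {i // p i} (Fin k) ℝ := Matrix.of fun i j => if i.1 ∈ Q then f i j else 0 with hg
  have h1 : M.submatrix (fun i : {i // p i} => i.1) (fun i : {i // p i} => i.1) * f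
      = M.submatrix (fun i : {i // p i} => i.1) (fun i : {i // p i} => i.1) * g := by
    ext i j
    simp only [Matrix.mul_apply, Matrix.submatrix_apply]
    refine Finset.sum_congr rfl fun l _ => ?_
    by_cases hl : l.1 ∈ Q
    · simp [hg, hl]
    · simp [hM _ _ hl]
  rw [h1]
  refine (frobNorm_submatrix_mul_le M p g).trans
    (mul_le_mul_of_nonneg_left ?_ (opNorm_nonneg _))
  refine frobNorm_le_of_sq_le (by positivity) ?_
  rw [mul_pow, Real.sq_sqrt (by positivity)]
  calc ∑ i, ∑ j, g i j ^ 2 ≤ ∑ i : {i // p i}, if i.1 ∈ Q then (k : ℝ) * b ^ 2 else 0 := by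
        refine Finset.sum_le_sum fun i _ => ?_
        by_cases hi : i.1 ∈ Q
        · simp only [hg, Matrix.of_apply, hi, if_true]
          calc ∑ j, f i j ^ 2 ≤ ∑ _j : Fin k, b ^ 2 :=
                Finset.sum_le_sum fun j _ => sq_le_sq.2 (by rw [abs_of_nonneg hb]; exact hf i j)
            _ = _ := by simp
        · simp [hg, hi]
    _ ≤ ∑ i : Fin n, if i ∈ Q then (k : ℝ) * b ^ 2 else 0 := by
        rw [← Finset.sum_subtype (Finset.univ.filter p) (by simp)
          (fun i => if i ∈ Q then (k : ℝ) * b ^ 2 else 0)]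
        exact Finset.sum_le_sum_of_subset_of_nonneg (Finset.subset_univ _) fun i _ _ => by
          split_ifs <;> positivity
    _ = b ^ 2 * (Q.card * k) := by simp; ring

end Norms

/-! ### The output of the spectral subroutine -/

/-- On the span of an orthonormal family of eigenvectors with eigenvalues at least `a`, the
quadratic form of `M` is at least `a` times the squared norm. -/
theorem IsEigenFamily.quadratic_ge {k m : ℕ} {M : Matrix (Fin k) (Fin k) ℝ} {a : ℝ} {W : Set ℝ}
    {ν : Fin m → Fin k → ℝ} (h : IsEigenFamily M W ν) (hW : ∀ c ∈ W, a ≤ c)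
    {y : Fin k → ℝ} (hy : y ∈ Submodule.span ℝ (Set.range ν)) :
    a * ∑ i, y i ^ 2 ≤ y ⬝ᵥ M.mulVec y := by
  obtain ⟨c, rfl⟩ := (Submodule.mem_span_range_iff_exists_fun ℝ).1 hy
  obtain ⟨ho, he⟩ := h
  choose e heW hev using he
  have h1 : ∑ i, (∑ j, c j • ν j) i ^ 2 = (∑ j, c j • ν j) ⬝ᵥ (∑ j, c j • ν j) := by
    simp [dotProduct, sq]
  have h2 : (∑ j, c j • ν j) ⬝ᵥ (∑ j, c j • ν j) = ∑ j, c j ^ 2 := by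
    simp [sum_dotProduct, dotProduct_sum, ho, sq]
  have h3 : (∑ j, c j • ν j) ⬝ᵥ M.mulVec (∑ j, c j • ν j) = ∑ j, e j * c j ^ 2 := by
    simp only [Matrix.mulVec_sum, Matrix.mulVec_smul, hev, sum_dotProduct, dotProduct_sum,
      dotProduct_smul, smul_dotProduct, ho, smul_eq_mul]
    refine Finset.sum_congr rfl fun j _ => ?_
    simp; ring
  rw [h1, h2, h3, Finset.mul_sum]
  exact Finset.sum_le_sum fun j _ => mul_le_mul_of_nonneg_right (hW _ (heW j)) (sq_nonneg _)

theorem IsSpectralOutput.mulVec_Xi_le {φ : ℝ → ℝ} {ρ : ℝ} {K : ℕ → ℕ} {T : ℕ} {β : BetaSeq K}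
    {Ξ : XiSeq K} (h : IsSpectralOutput φ ρ T β Ξ) {t : ℕ} (ht : t ≤ T) (z : Fin (K t / 12) → ℝ) :
    ∑ i, ((Ξ t).mulVec z) i ^ 2 ≤ 2 ^ 2 * ∑ j, z j ^ 2 := by
  obtain ⟨ν, ζ, h1, -, h3⟩ := h.spectral t ht
  have hy : (Ξ t).mulVec z ∈ Submodule.span ℝ (Set.range ν) := by
    have : (Ξ t).mulVec z = ∑ j, z j • (fun i => Ξ t i j) := by
      ext i; simp [Matrix.mulVec, dotProduct, mul_comm]
    rw [this]
    exact Submodule.sum_mem _ fun j _ => Submodule.smul_mem _ _ (h3 j).1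
  have h4 := h1.quadratic_ge (a := 0.9) (fun c hc => hc.1.le) hy
  have h5 : (Ξ t).mulVec z ⬝ᵥ (PhiMat φ β t).mulVec ((Ξ t).mulVec z) = ∑ j, z j ^ 2 := by
    have h6 := h.phi_orthonormal t ht
    rw [← Matrix.vecMul_transpose (Ξ t) z, ← Matrix.dotProduct_mulVec,
      Matrix.vecMul_transpose, Matrix.mulVec_mulVec,
      Matrix.mulVec_mulVec, h6, Matrix.one_mulVec]
    simp [dotProduct, sq]
  rw [h5] at h4
  have h7 : 0 ≤ ∑ i, ((Ξ t).mulVec z) i ^ 2 := Finset.sum_nonneg fun _ _ => sq_nonneg _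
  norm_num at h4 ⊢
  linarith

theorem IsSpectralOutput.frobNorm_beta_le {φ : ℝ → ℝ} {ρ : ℝ} {K : ℕ → ℕ} {T : ℕ} {β : BetaSeq K}
    {Ξ : XiSeq K} (h : IsSpectralOutput φ ρ T β Ξ) {t : ℕ} (ht : t < T) (hK : 12 ∣ K t) :
    frobNorm (β t) ≤ Real.sqrt (K (t + 1)) := by
  refine Real.sqrt_le_sqrt ?_
  have h1 : ∀ i j, β t i j ^ 2 = 12 / (K t : ℝ) := by
    intro i j
    rcases h.sign t ht i j with h | h
    · rw [h, Real.sq_sqrt (by positivity)]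
    · rw [h, neg_sq, Real.sq_sqrt (by positivity)]
  simp_rw [h1]
  simp only [Finset.sum_const, Finset.card_univ, Fintype.card_fin, nsmul_eq_mul]
  obtain ⟨a, ha⟩ := hK
  rw [ha]
  rcases Nat.eq_zero_or_pos a with rfl | hpos
  · simp
  · have : (12 * a / 12 : ℕ) = a := by omega
    rw [this]; push_cast
    have : (a : ℝ) ≠ 0 := by positivity
    exact le_of_eq (by field_simp)

/-! ### The denoiser is Lipschitz -/

theorem IsDenoiser.contDiff {φ : ℝ → ℝ} (h : IsDenoiser φ) : ContDiff ℝ 1 φ := by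
  obtain ⟨L, a, b, hab⟩ := h.cos_sum
  rw [funext hab]
  fun_prop

theorem IsDenoiser.abs_sub_le {φ : ℝ → ℝ} (h : IsDenoiser φ) (x y : ℝ) :
    |φ x - φ y| ≤ 100 * |x - y| := by
  simpa using Convex.norm_image_sub_le_of_norm_deriv_le (s := Set.univ) (f := φ) (C := 100)
    (fun z _ => (h.contDiff.differentiable one_ne_zero) z) (fun z _ => h.bound_one z) convex_univ
    (Set.mem_univ y) (Set.mem_univ x)

theorem IsDenoiser.frobNorm_map_sub_le {φ : ℝ → ℝ} (h : IsDenoiser φ) {ι κ : Type*} [Fintype ι]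
    [Fintype κ] (M N : Matrix ι κ ℝ) :
    frobNorm (M.map φ - N.map φ) ≤ 100 * frobNorm (M - N) := by
  refine frobNorm_le_of_sq_le (mul_nonneg (by norm_num) (frobNorm_nonneg _)) ?_
  rw [mul_pow, frobNorm_sq]
  simp_rw [Finset.mul_sum]
  refine Finset.sum_le_sum fun i _ => Finset.sum_le_sum fun j _ => ?_
  rw [← mul_pow]
  refine sq_le_sq.2 ?_
  rw [abs_mul, abs_of_pos (by norm_num : (0 : ℝ) < 100)]
  exact h.abs_sub_le _ _

/-! ### Stability of the iteration -/

theorem alephSeq_nonneg (K : ℕ → ℕ) (ε : ℝ) (t : ℕ) : 0 ≤ alephSeq K ε t :=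
  Finset.prod_nonneg fun _ _ => by positivity

theorem alephSeq_succ (K : ℕ → ℕ) (ε : ℝ) (t : ℕ) :
    alephSeq K ε (t + 1) = alephSeq K ε t * (1000 * Real.log ε⁻¹ ^ 2 * (K (t + 1) : ℝ)) :=
  Finset.prod_range_succ _ _

theorem le_alephSeq {K : ℕ → ℕ} (hK : ∀ t, 1 ≤ K t) {ε : ℝ} (hε : 1 ≤ Real.log ε⁻¹) (t : ℕ) :
    1000 * Real.log ε⁻¹ ^ 2 ≤ alephSeq K ε t := by
  have hfac : ∀ s, 1000 * Real.log ε⁻¹ ^ 2 ≤ 1000 * Real.log ε⁻¹ ^ 2 * (K s : ℝ) := fun s =>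
    le_mul_of_one_le_right (by positivity) (by exact_mod_cast hK s)
  have hone : 1 ≤ 1000 * Real.log ε⁻¹ ^ 2 := by nlinarith
  induction t with
  | zero => simpa [alephSeq] using hfac 0
  | succ t ih =>
    rw [alephSeq_succ]
    exact ih.trans (le_mul_of_one_le_right (alephSeq_nonneg _ _ _) (hone.trans (hfac _)))

section Deterministic

variable {φ : ℝ → ℝ} {ρ : ℝ} {K : ℕ → ℕ} {n k : ℕ}

theorem linStep_sub (M M₀ : Matrix (Fin n) (Fin n) ℝ) (U : Fin k ↪ Fin n) {a b : ℕ}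
    (f f₀ : Matrix (Rest U) (Fin a) ℝ) (Ξ : Matrix (Fin a) (Fin b) ℝ) :
    linStep M U f Ξ - linStep M₀ U f₀ Ξ = linStep M U (f - f₀) Ξ + linStep (M - M₀) U f₀ Ξ := by
  simp only [linStep, Matrix.submatrix_sub, Matrix.mul_sub, Matrix.sub_mul, smul_sub, Pi.sub_apply]
  abel

theorem linStep_add (M M' : Matrix (Fin n) (Fin n) ℝ) (U : Fin k ↪ Fin n) {a b : ℕ}
    (f : Matrix (Rest U) (Fin a) ℝ) (Ξ : Matrix (Fin a) (Fin b) ℝ) :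
    linStep (M + M') U f Ξ = linStep M U f Ξ + linStep M' U f Ξ := by
  simp only [linStep, Matrix.submatrix_add, Matrix.add_mul, smul_add, Pi.add_apply]

theorem frobNorm_linStep_le (hn : 0 < n) {M : Matrix (Fin n) (Fin n) ℝ} {c : ℝ}
    (hM : opNorm M ≤ c * Real.sqrt n) (U : Fin k ↪ Fin n) {a b : ℕ}
    (f : Matrix (Rest U) (Fin a) ℝ) {Ξ : Matrix (Fin a) (Fin b) ℝ}
    (hΞ : ∀ z, ∑ i, (Ξ.mulVec z) i ^ 2 ≤ 2 ^ 2 * ∑ j, z j ^ 2) :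
    frobNorm (linStep M U f Ξ) ≤ 2 * c * frobNorm f := by
  have hs : 0 < Real.sqrt n := Real.sqrt_pos.2 (by exact_mod_cast hn)
  rw [linStep, frobNorm_smul, abs_of_pos (by positivity), div_mul_eq_mul_div, one_mul,
    div_le_iff₀ hs]
  calc _ ≤ 2 * frobNorm (M.submatrix (fun i : Rest U => i.1) (fun i : Rest U => i.1) * f) :=
        frobNorm_mul_le_of_mulVec (by norm_num) hΞ
    _ ≤ 2 * (c * Real.sqrt n * frobNorm f) := by
        gcongr
        exact (frobNorm_submatrix_mul_le M _ f).trans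
          (mul_le_mul_of_nonneg_right hM (frobNorm_nonneg _))
    _ = _ := by ring

theorem frobNorm_linStep_le_of_support (hn : 0 < n) {M : Matrix (Fin n) (Fin n) ℝ} {c : ℝ}
    (hM : opNorm M ≤ c * Real.sqrt n) (U : Fin k ↪ Fin n) {a b : ℕ}
    {f : Matrix (Rest U) (Fin a) ℝ} {Ξ : Matrix (Fin a) (Fin b) ℝ}
    (hΞ : ∀ z, ∑ i, (Ξ.mulVec z) i ^ 2 ≤ 2 ^ 2 * ∑ j, z j ^ 2)
    (Q : Finset (Fin n)) (hQ : ∀ i j, j ∉ Q → M i j = 0) (hf : ∀ i j, |f i j| ≤ 100) :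
    frobNorm (linStep M U f Ξ) ≤ 200 * c * Real.sqrt (Q.card * a) := by
  have hs : 0 < Real.sqrt n := Real.sqrt_pos.2 (by exact_mod_cast hn)
  rw [linStep, frobNorm_smul, abs_of_pos (by positivity), div_mul_eq_mul_div, one_mul,
    div_le_iff₀ hs]
  calc _ ≤ 2 * frobNorm (M.submatrix (fun i : Rest U => i.1) (fun i : Rest U => i.1) * f) :=
        frobNorm_mul_le_of_mulVec (by norm_num) hΞ
    _ ≤ 2 * (c * Real.sqrt n * (100 * Real.sqrt (Q.card * a))) := by
        gcongr
        exact (frobNorm_submatrix_mul_le_of_support M _ f Q hQ (by norm_num) hf).trans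
          (mul_le_mul_of_nonneg_right hM (by positivity))
    _ = _ := by ring

/-- One step of the iteration amplifies the error by a factor absorbed in `ℵ_{t+1} / ℵ_t`, as long
as exchanging the driving matrix `M₀` for `M` costs at most `30000 log(1/ε) √K_t s` in each
linear step taken at the iterates of `M₀`. -/
theorem iterate_error (hφ : IsDenoiser φ) {T : ℕ} {β : BetaSeq K} {Ξ : XiSeq K}
    (hβΞ : IsSpectralOutput φ ρ T β Ξ) (hK12 : ∀ t, 12 ∣ K t) (hK1 : ∀ t, 1 ≤ K t)
    (hKmono : ∀ t, K t ≤ K (t + 1)) {ε : ℝ} (hε : 100 ≤ Real.log ε⁻¹) {s : ℝ} (hs : 0 ≤ s)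
    (hn : 0 < n) {M M₀ : Matrix (Fin n) (Fin n) ℝ} (hM : opNorm M ≤ 10 * Real.sqrt n)
    (U : Fin k ↪ Fin n) (f0 : Matrix (Rest U) (Fin (K 0)) ℝ)
    (hdiff : ∀ t ≤ T, frobNorm (linStep (M - M₀) U (fIter φ β Ξ M₀ U f0 t) (Ξ t))
      ≤ 30000 * Real.log ε⁻¹ * Real.sqrt (K t) * s) :
    ∀ t ≤ T, frobNorm (fIter φ β Ξ M U f0 t - fIter φ β Ξ M₀ U f0 t)
        ≤ 1 / 2 * alephSeq K ε t * s ∧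
      frobNorm (hIter φ β Ξ M U f0 t - hIter φ β Ξ M₀ U f0 t)
        ≤ 500 * alephSeq K ε t * Real.sqrt (K t * Real.log ε⁻¹) * s := by
  set ℓ := Real.log ε⁻¹ with hℓ
  have hℓ1 : 1 ≤ Real.sqrt ℓ := Real.one_le_sqrt.2 (by linarith)
  have hℓ10 : 10 ≤ Real.sqrt ℓ := Real.le_sqrt_of_sq_le (by linarith)
  have hℓsq : Real.sqrt ℓ ^ 2 = ℓ := Real.sq_sqrt (by linarith)
  have hh : ∀ t ≤ T, frobNorm (fIter φ β Ξ M U f0 t - fIter φ β Ξ M₀ U f0 t)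
        ≤ 1 / 2 * alephSeq K ε t * s →
      frobNorm (hIter φ β Ξ M U f0 t - hIter φ β Ξ M₀ U f0 t)
        ≤ 500 * alephSeq K ε t * Real.sqrt (K t * ℓ) * s := by
    intro t ht hf
    have hKt : 1 ≤ Real.sqrt (K t) := Real.one_le_sqrt.2 (by exact_mod_cast hK1 t)
    have hal : 1000 * ℓ ^ 2 ≤ alephSeq K ε t := le_alephSeq hK1 (by linarith) t
    have hsum : frobNorm (hIter φ β Ξ M U f0 t - hIter φ β Ξ M₀ U f0 t)
        ≤ 2 * 10 * (1 / 2 * alephSeq K ε t * s) + 30000 * ℓ * Real.sqrt (K t) * s := by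
      rw [hIter, hIter, linStep_sub]
      refine (frobNorm_add_le _ _).trans (add_le_add ?_ (hdiff t ht))
      exact (frobNorm_linStep_le hn hM U _ (hβΞ.mulVec_Xi_le ht)).trans
        (mul_le_mul_of_nonneg_left hf (by norm_num))
    refine hsum.trans ?_
    rw [Real.sqrt_mul (by positivity)]
    have hx : 1 ≤ Real.sqrt (K t) * Real.sqrt ℓ := by nlinarith
    have h1 : alephSeq K ε t ≤ alephSeq K ε t * (Real.sqrt (K t) * Real.sqrt ℓ) :=
      le_mul_of_one_le_right (alephSeq_nonneg _ _ _) hx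
    have h2 : ℓ * Real.sqrt (K t) ≤ alephSeq K ε t * (Real.sqrt (K t) * Real.sqrt ℓ) / 1000 := by
      have : ℓ ≤ alephSeq K ε t / 1000 := by nlinarith
      have h3 : ℓ * Real.sqrt (K t) ≤ alephSeq K ε t / 1000 * Real.sqrt (K t) :=
        mul_le_mul_of_nonneg_right this (by positivity)
      have h4 : alephSeq K ε t / 1000 * Real.sqrt (K t)
          ≤ alephSeq K ε t / 1000 * Real.sqrt (K t) * Real.sqrt ℓ :=
        le_mul_of_one_le_right (mul_nonneg (by have := alephSeq_nonneg K ε t; positivity)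
          (by positivity)) hℓ1
      calc _ ≤ _ := h3.trans h4
        _ = _ := by ring
    have h5 : 2 * 10 * (1 / 2 * alephSeq K ε t) + 30000 * (ℓ * Real.sqrt (K t))
        ≤ 500 * (alephSeq K ε t * (Real.sqrt (K t) * Real.sqrt ℓ)) := by
      nlinarith [alephSeq_nonneg K ε t]
    calc _ = (2 * 10 * (1 / 2 * alephSeq K ε t) + 30000 * (ℓ * Real.sqrt (K t))) * s := by ring
      _ ≤ 500 * (alephSeq K ε t * (Real.sqrt (K t) * Real.sqrt ℓ)) * s :=
          mul_le_mul_of_nonneg_right h5 hs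
      _ = _ := by ring
  have hf : ∀ t ≤ T, frobNorm (fIter φ β Ξ M U f0 t - fIter φ β Ξ M₀ U f0 t)
        ≤ 1 / 2 * alephSeq K ε t * s := by
    intro t
    induction t with
    | zero =>
      intro _
      simp only [fIter, sub_self, frobNorm_zero]
      have := alephSeq_nonneg K ε 0
      positivity
    | succ t ih =>
      intro ht
      have hht := hh t (by omega) (ih (by omega))
      have hKm : Real.sqrt (K t) ≤ Real.sqrt (K (t + 1)) :=
        Real.sqrt_le_sqrt (by exact_mod_cast hKmono t)
      have hb := hβΞ.frobNorm_beta_le (show t < T by omega) (hK12 t)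
      have hstep : frobNorm (fIter φ β Ξ M U f0 (t + 1) - fIter φ β Ξ M₀ U f0 (t + 1))
          ≤ 100 * ((500 * alephSeq K ε t * Real.sqrt (K t * ℓ) * s)
            * Real.sqrt (K (t + 1))) := by
        simp only [fIter]
        refine (hφ.frobNorm_map_sub_le _ _).trans (mul_le_mul_of_nonneg_left ?_ (by norm_num))
        rw [← Matrix.sub_mul]
        exact (frobNorm_mul_le _ _).trans (mul_le_mul hht hb (frobNorm_nonneg _)
          ((frobNorm_nonneg _).trans hht))
      refine hstep.trans ?_
      rw [alephSeq_succ, Real.sqrt_mul (by positivity)]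
      have hKsq : Real.sqrt (K (t + 1)) ^ 2 = K (t + 1) := Real.sq_sqrt (by positivity)
      rw [← hℓ]
      have h1 : 100 * Real.sqrt ℓ ≤ ℓ ^ 2 := by
        have : 100 ≤ Real.sqrt ℓ ^ 3 := by
          calc (100 : ℝ) ≤ 10 ^ 3 := by norm_num
            _ ≤ _ := pow_le_pow_left₀ (by norm_num) hℓ10 3
        nlinarith [mul_le_mul_of_nonneg_right this (Real.sqrt_nonneg ℓ)]
      have h2 : Real.sqrt (K t) * (100 * Real.sqrt ℓ) ≤ Real.sqrt (K (t + 1)) * ℓ ^ 2 :=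
        mul_le_mul hKm h1 (by positivity) (by positivity)
      have h3 : 0 ≤ 500 * alephSeq K ε t * s * Real.sqrt (K (t + 1)) := by
        have := alephSeq_nonneg K ε t
        positivity
      calc _ = (Real.sqrt (K t) * (100 * Real.sqrt ℓ))
            * (500 * alephSeq K ε t * s * Real.sqrt (K (t + 1))) := by ring
        _ ≤ (Real.sqrt (K (t + 1)) * ℓ ^ 2)
            * (500 * alephSeq K ε t * s * Real.sqrt (K (t + 1))) :=
          mul_le_mul_of_nonneg_right h2 h3
        _ = 1 / 2 * (alephSeq K ε t * (1000 * ℓ ^ 2 * Real.sqrt (K (t + 1)) ^ 2)) * s := by ring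
        _ = _ := by rw [hKsq]
  exact fun t ht => ⟨hf t ht, hh t ht (hf t ht)⟩

theorem abs_fIter_initIter_le (hφ : IsDenoiser φ) (β : BetaSeq K) (Ξ : XiSeq K)
    (M N : Matrix (Fin n) (Fin n) ℝ) (U : Fin (K 0) ↪ Fin n) (t : ℕ) (i : Rest U)
    (j : Fin (K t)) : |fIter φ β Ξ M U (initIter φ N U) t i j| ≤ 100 := by
  cases t with
  | zero => exact hφ.bound_zero _
  | succ t => exact hφ.bound_zero _

/-- The block of `M` with row index in `S` and column index outside `S`. -/
noncomputable def crossBlock (M : Matrix (Fin n) (Fin n) ℝ) (S : Finset (Fin n)) :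
    Matrix (Fin n) (Fin n) ℝ :=
  Matrix.of fun i j => if i ∈ S ∧ j ∉ S then M i j else 0

/-- The matrix `f^{(t)} Ξ^{(t)}` for the iteration driven and initialised by `M` with the rows and
columns in `S` set to zero.  It does not depend on the rows of `M` in `S`. -/
noncomputable def leaveOut (φ : ℝ → ℝ) (β : BetaSeq K) (Ξ : XiSeq K) (M : Matrix (Fin n) (Fin n) ℝ)
    (S : Finset (Fin n)) (U : Fin (K 0) ↪ Fin n) (t : ℕ) : Matrix (Rest U) (Fin (K t / 12)) ℝ :=
  fIter φ β Ξ (zeroOut M S) U (initIter φ (zeroOut M S) U) t * Ξ t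

/-- The rows of `M` in `S` are not aligned with the iterates that ignore them: compared with the
size of `leaveOut`, the product with `crossBlock` is at most `2 √x` in Frobenius norm. -/
def CrossBound (φ : ℝ → ℝ) (β : BetaSeq K) (Ξ : XiSeq K) (M : Matrix (Fin n) (Fin n) ℝ)
    (S : Finset (Fin n)) (U : Fin (K 0) ↪ Fin n) (t : ℕ) (x : ℝ) : Prop :=
  frobNorm ((crossBlock M S).submatrix (fun i : Rest U => i.1) (fun i : Rest U => i.1)
      * leaveOut φ β Ξ M S U t) ^ 2 ≤ 4 * x * frobNorm (leaveOut φ β Ξ M S U t) ^ 2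

/-- The comparison of the corrupted and the clean iterates for a good sequence `U`, given the
typical behaviour of the clean matrix `C` and of the removed set `S`.  Both are compared with the
iterates driven by `zeroOut C S`. -/
theorem error_of_typical (hφ : IsDenoiser φ) {T : ℕ} {β : BetaSeq K} {Ξ : XiSeq K}
    (hβΞ : IsSpectralOutput φ ρ T β Ξ) (hK12 : ∀ t, 12 ∣ K t) (hK1 : ∀ t, 1 ≤ K t)
    (hKmono : ∀ t, K t ≤ K (t + 1)) {ε : ℝ} (hε : 100 ≤ Real.log ε⁻¹) {y : ℝ} (hy : 0 ≤ y)
    (hn : 0 < n) {C O : Matrix (Fin n) (Fin n) ℝ} {Q S : Finset (Fin n)}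
    (hCO : ∀ i j, i ∉ Q ∨ j ∉ Q → O i j = C i j)
    (hC : opNorm C ≤ 9 * Real.sqrt n) (hO : opNorm (zeroOut O S) ≤ 10 * Real.sqrt n)
    (hQ : (Q.card : ℝ) ≤ y) (hS : (S.card : ℝ) ≤ 101 * y * Real.log ε⁻¹)
    (U : Fin (K 0) ↪ Fin n) (hU : ∀ k, U k ∉ Q)
    (hcross : ∀ t ≤ T, CrossBound φ β Ξ C S U t (300 * y * Real.log ε⁻¹ ^ 2)) :
    ∀ t ≤ T,
      frobNorm (fIter φ β Ξ (zeroOut O S) U (initIter φ (zeroOut O S) U) t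
          - fIter φ β Ξ C U (initIter φ (zeroOut O S) U) t)
        ≤ alephSeq K ε t * Real.sqrt y ∧
      frobNorm (hIter φ β Ξ (zeroOut O S) U (initIter φ (zeroOut O S) U) t
          - hIter φ β Ξ C U (initIter φ (zeroOut O S) U) t)
        ≤ 1000 * alephSeq K ε t * Real.sqrt (K t * Real.log ε⁻¹) * Real.sqrt y := by
  have hs : 0 < Real.sqrt n := Real.sqrt_pos.2 (by exact_mod_cast hn)
  have hinit : initIter φ (zeroOut O S) U = initIter φ (zeroOut C S) U := by
    ext i j
    simp only [initIter, zeroOut, Matrix.of_apply, hCO i.1 (U j) (Or.inr (hU j))]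
  rw [hinit]
  set f0 := initIter φ (zeroOut C S) U with hf0
  set ℓ := Real.log ε⁻¹ with hℓ
  have hsqrtℓ : Real.sqrt ℓ ≤ ℓ := Real.sqrt_le_iff.2 ⟨by linarith, by nlinarith⟩
  -- Exchanging `zeroOut C S` for the corrupted matrix only involves the columns in `Q`.
  have hcorr : ∀ t ≤ T, frobNorm (linStep (zeroOut O S - zeroOut C S) U
      (fIter φ β Ξ (zeroOut C S) U f0 t) (Ξ t)) ≤ 30000 * ℓ * Real.sqrt (K t) * Real.sqrt y := by
    intro t ht
    have h1 : opNorm (zeroOut O S - zeroOut C S) ≤ 19 * Real.sqrt n := by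
      have := opNorm_sub_le (zeroOut O S) (zeroOut C S)
      have := opNorm_zeroOut_le C S
      linarith
    refine (frobNorm_linStep_le_of_support hn h1 U (hβΞ.mulVec_Xi_le ht) Q ?_
      (abs_fIter_initIter_le hφ β Ξ _ _ U t)).trans ?_
    · intro i j hj
      simp [zeroOut, hCO i j (Or.inr hj)]
    · have h2 : Real.sqrt (Q.card * K t) ≤ Real.sqrt y * Real.sqrt (K t) := by
        rw [← Real.sqrt_mul hy]
        exact Real.sqrt_le_sqrt (mul_le_mul_of_nonneg_right hQ (by positivity))
      have h3 : 0 ≤ Real.sqrt y * Real.sqrt (K t) := by positivity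
      nlinarith [mul_le_mul_of_nonneg_right hε h3]
  -- Exchanging `zeroOut C S` for the clean matrix involves the columns in `S` and the cross block.
  have hclean : ∀ t ≤ T, frobNorm (linStep (C - zeroOut C S) U
      (fIter φ β Ξ (zeroOut C S) U f0 t) (Ξ t)) ≤ 30000 * ℓ * Real.sqrt (K t) * Real.sqrt y := by
    intro t ht
    set D : Matrix (Fin n) (Fin n) ℝ := Matrix.of fun i j => if j ∈ S then C i j else 0 with hD
    have hsplit : C - zeroOut C S = D + crossBlock C S := by
      ext i j
      by_cases hi : i ∈ S <;> by_cases hj : j ∈ S <;> simp [zeroOut, crossBlock, hD, hi, hj]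
    have hDop : opNorm D ≤ 9 * Real.sqrt n := by
      have h0 : D = Matrix.of fun i j => if True ∧ j ∈ S then C i j else 0 := by
        refine Matrix.ext fun i j => ?_
        by_cases hj : j ∈ S <;> simp [hD, hj]
      rw [h0]
      exact (opNorm_mask_le C (fun _ => True) (· ∈ S)).trans hC
    have h1 : frobNorm (linStep D U (fIter φ β Ξ (zeroOut C S) U f0 t) (Ξ t))
        ≤ 19800 * ℓ * (Real.sqrt (K t) * Real.sqrt y) := by
      refine (frobNorm_linStep_le_of_support hn hDop U (hβΞ.mulVec_Xi_le ht) S ?_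
        (abs_fIter_initIter_le hφ β Ξ _ _ U t)).trans ?_
      · intro i j hj
        simp [hD, hj]
      · have h2 : Real.sqrt (S.card * K t) ≤ 11 * ℓ * (Real.sqrt (K t) * Real.sqrt y) := by
          rw [← Real.sqrt_mul (by positivity)]
          refine Real.sqrt_le_iff.2 ⟨by positivity, ?_⟩
          rw [mul_pow, Real.sq_sqrt (by positivity)]
          have h3 : 101 * y * ℓ ≤ (11 * ℓ) ^ 2 * y := by
            have h0 : 0 ≤ y * ℓ := mul_nonneg hy (by linarith)
            nlinarith [mul_le_mul_of_nonneg_left hε h0]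
          calc (S.card : ℝ) * K t ≤ (11 * ℓ) ^ 2 * y * K t :=
                mul_le_mul_of_nonneg_right (hS.trans h3) (by positivity)
            _ = _ := by ring
        calc _ ≤ 200 * 9 * (11 * ℓ * (Real.sqrt (K t) * Real.sqrt y)) :=
              mul_le_mul_of_nonneg_left h2 (by norm_num)
          _ = _ := by ring
    have h4 : frobNorm (linStep (crossBlock C S) U (fIter φ β Ξ (zeroOut C S) U f0 t) (Ξ t))
        ≤ 7000 * ℓ * (Real.sqrt (K t) * Real.sqrt y) := by
      rw [linStep, frobNorm_smul, abs_of_pos (by positivity), div_mul_eq_mul_div, one_mul,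
        div_le_iff₀ hs, Matrix.mul_assoc]
      have hW : frobNorm (leaveOut φ β Ξ C S U t) ≤ 200 * Real.sqrt (n * K t) := by
        have h5 : frobNorm (fIter φ β Ξ (zeroOut C S) U f0 t) ≤ 100 * Real.sqrt (n * K t) := by
          refine frobNorm_le_of_sq_le (by positivity) ?_
          rw [mul_pow, Real.sq_sqrt (by positivity)]
          calc _ ≤ ∑ _i : Rest U, ∑ _j : Fin (K t), (100 : ℝ) ^ 2 :=
                Finset.sum_le_sum fun i _ => Finset.sum_le_sum fun j _ => sq_le_sq.2 (by
                  rw [abs_of_pos (by norm_num : (0:ℝ) < 100)]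
                  exact abs_fIter_initIter_le hφ β Ξ _ _ U t i j)
            _ = (Fintype.card (Rest U) : ℝ) * (K t * 100 ^ 2) := by simp
            _ ≤ n * (K t * 100 ^ 2) := by
                gcongr
                exact (Fintype.card_subtype_le (fun i : Fin n => i ∉ Set.range U)).trans_eq
                  (by simp)
            _ = _ := by ring
        have h6 := frobNorm_mul_le_of_mulVec (M := fIter φ β Ξ (zeroOut C S) U f0 t)
          (by norm_num) (hβΞ.mulVec_Xi_le ht)
        unfold leaveOut
        linarith
      have hc := hcross t ht
      unfold CrossBound at hc
      refine abs_le_of_sq_le_sq' (hc.trans ?_) (by positivity) |>.2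
      have h7 : frobNorm (leaveOut φ β Ξ C S U t) ^ 2 ≤ (200 * Real.sqrt (n * K t)) ^ 2 :=
        pow_le_pow_left₀ (frobNorm_nonneg _) hW 2
      calc _ ≤ 4 * (300 * y * ℓ ^ 2) * (200 * Real.sqrt (n * K t)) ^ 2 :=
            mul_le_mul_of_nonneg_left h7 (by positivity)
        _ = 48000000 * (y * ℓ ^ 2 * n * K t) := by
            rw [mul_pow, Real.sq_sqrt (by positivity)]; ring
        _ ≤ 49000000 * (y * ℓ ^ 2 * n * K t) := by
            gcongr; norm_num
        _ = (7000 * ℓ) ^ 2 * (Real.sqrt (K t) ^ 2 * Real.sqrt y ^ 2) * Real.sqrt n ^ 2 := by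
            rw [Real.sq_sqrt (by positivity), Real.sq_sqrt hy, Real.sq_sqrt (by positivity)]; ring
        _ = _ := by ring
    rw [hsplit, linStep_add]
    refine (frobNorm_add_le _ _).trans ((add_le_add h1 h4).trans ?_)
    have h8 : 0 ≤ ℓ * (Real.sqrt (K t) * Real.sqrt y) := by positivity
    nlinarith
  have hC10 : opNorm C ≤ 10 * Real.sqrt n := by linarith
  intro t ht
  obtain ⟨a1, a2⟩ := iterate_error hφ hβΞ hK12 hK1 hKmono hε (Real.sqrt_nonneg y) hn hO U f0 hcorr
    t ht
  obtain ⟨b1, b2⟩ := iterate_error hφ hβΞ hK12 hK1 hKmono hε (Real.sqrt_nonneg y) hn hC10 U f0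
    hclean t ht
  have htri : ∀ {ι κ : Type} [Fintype ι] [Fintype κ] (X Y Z : Matrix ι κ ℝ),
      frobNorm (X - Y) ≤ frobNorm (X - Z) + frobNorm (Y - Z) := by
    intro ι κ _ _ X Y Z
    rw [frobNorm_sub_comm Y Z, ← sub_add_sub_cancel X Z Y]
    exact frobNorm_add_le _ _
  constructor
  · refine (htri _ _ (fIter φ β Ξ (zeroOut C S) U f0 t)).trans ?_
    linarith
  · refine (htri _ _ (hIter φ β Ξ (zeroOut C S) U f0 t)).trans ?_
    linarith

end Deterministic

/-! ### Linear functionals of Gaussian vectors -/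

section GaussianVector

variable {ι : Type*} [Fintype ι]

/-- A linear functional of a standard Gaussian vector is centred normal, with variance the squared
norm of the functional. -/
theorem map_pi_gaussianReal_sum (w : ι → ℝ) :
    (Measure.pi fun _ : ι => gaussianReal 0 1).map (fun r => ∑ j, w j * r j)
      = gaussianReal 0 (∑ j, w j ^ 2).toNNReal := by
  set L : StrongDual ℝ (EuclideanSpace ℝ ι) := innerSL ℝ (WithLp.toLp 2 w) with hL
  have h1 : (fun r : ι → ℝ => ∑ j, w j * r j) = L ∘ (WithLp.toLp 2) := by
    ext r
    simp [hL, PiLp.inner_apply, mul_comm]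
  rw [h1, ← Measure.map_map (by fun_prop) (by fun_prop), map_pi_eq_stdGaussian,
    IsGaussian.map_eq_gaussianReal, integral_strongDual_stdGaussian, variance_dual_stdGaussian]
  congr 2
  rw [hL, innerSL_apply_norm, EuclideanSpace.real_norm_sq_eq]

theorem measure_pi_gaussianReal_sum_ge_le (w : ι → ℝ) (hw : ∑ j, w j ^ 2 ≤ 1) {a : ℝ}
    (ha : 0 ≤ a) :
    (Measure.pi fun _ : ι => gaussianReal 0 1) {r | a ≤ ∑ j, w j * r j}
      ≤ ENNReal.ofReal (Real.exp (-a ^ 2 / 2)) := by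
  have hX := map_pi_gaussianReal_sum w
  have hm : Measurable (fun r : ι → ℝ => ∑ j, w j * r j) := by fun_prop
  have h0 : 0 ≤ ∑ j, w j ^ 2 := Finset.sum_nonneg fun _ _ => sq_nonneg _
  have h1 : Integrable (fun r : ι → ℝ => Real.exp (a * ∑ j, w j * r j))
      (Measure.pi fun _ : ι => gaussianReal 0 1) := by
    have h2 := integrable_exp_mul_gaussianReal (μ := 0) (v := (∑ j, w j ^ 2).toNNReal) a
    rw [← hX] at h2
    exact h2.comp_measurable hm
  have h3 := measure_ge_le_exp_mul_mgf a ha h1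
  rw [mgf_gaussianReal hX, ← Real.exp_add, Real.coe_toNNReal _ h0] at h3
  rw [← ofReal_measureReal]
  refine ENNReal.ofReal_le_ofReal (h3.trans (Real.exp_le_exp.2 ?_))
  nlinarith [sq_nonneg a]

end GaussianVector

/-! ### The operator norm of a Gaussian matrix -/

section Net

variable {E : Type*} [NormedAddCommGroup E] [NormedSpace ℝ E] [FiniteDimensional ℝ E]

open Module Metric in
/-- Volume bound for a `1/4`-separated subset of the unit ball. -/
theorem card_le_of_quarter_separated (s : Finset E) (hs : ∀ c ∈ s, ‖c‖ ≤ 1)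
    (h : ∀ c ∈ s, ∀ d ∈ s, c ≠ d → 1 / 4 ≤ ‖c - d‖) : s.card ≤ 9 ^ finrank ℝ E := by
  borelize E
  let μ : Measure E := Measure.addHaar
  have D : Set.Pairwise (s : Set E) (Function.onFun Disjoint fun c => ball (c : E) (1 / 8)) := by
    rintro c hc d hd hcd
    apply ball_disjoint_ball
    rw [dist_eq_norm]
    linarith [h c hc d hd hcd]
  have A_subset : (⋃ c ∈ s, ball (c : E) (1 / 8)) ⊆ ball (0 : E) (9 / 8) := by
    refine Set.iUnion₂_subset fun x hx => ball_subset_ball' ?_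
    rw [dist_zero_right]
    linarith [hs x hx]
  have I : (s.card : ENNReal) * ENNReal.ofReal ((1 / 8 : ℝ) ^ finrank ℝ E) * μ (ball 0 1) ≤
      ENNReal.ofReal ((9 / 8 : ℝ) ^ finrank ℝ E) * μ (ball 0 1) :=
    calc
      _ = μ (⋃ c ∈ s, ball (c : E) (1 / 8)) := by
        rw [measure_biUnion_finset D fun c _ => measurableSet_ball]
        simp only [μ.addHaar_ball_of_pos _ (show (0 : ℝ) < 1 / 8 by norm_num)]
        simp only [Finset.sum_const, nsmul_eq_mul, mul_assoc]
      _ ≤ μ (ball (0 : E) (9 / 8)) := measure_mono A_subset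
      _ = _ := by simp only [μ.addHaar_ball_of_pos _ (show (0 : ℝ) < 9 / 8 by norm_num)]
  have J := (ENNReal.mul_le_mul_iff_left (measure_ball_pos μ (0 : E) zero_lt_one).ne'
    measure_ball_lt_top.ne).1 I
  have K := ENNReal.toReal_le_of_le_ofReal (by positivity) J
  rw [ENNReal.toReal_mul, ENNReal.toReal_ofReal (by positivity), ENNReal.toReal_natCast,
    div_pow, div_pow, one_pow, mul_one_div, div_le_div_iff_of_pos_right (by positivity)] at K
  exact_mod_cast K

theorem exists_quarter_net : ∃ N : Finset E, N.card ≤ 9 ^ Module.finrank ℝ E ∧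
    (∀ c ∈ N, ‖c‖ ≤ 1) ∧ ∀ x : E, ‖x‖ ≤ 1 → ∃ c ∈ N, ‖x - c‖ ≤ 1 / 4 := by
  classical
  by_contra! hne
  -- Without a net, separated sets could be enlarged indefinitely.
  have hgrow : ∀ k : ℕ, ∃ s : Finset E, s.card = k ∧ (∀ c ∈ s, ‖c‖ ≤ 1) ∧
      ∀ c ∈ s, ∀ d ∈ s, c ≠ d → 1 / 4 ≤ ‖c - d‖ := by
    intro k
    induction k with
    | zero => exact ⟨∅, by simp⟩
    | succ k ih =>
      obtain ⟨s, hk, h1, h2⟩ := ih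
      obtain ⟨x, hx, hxs⟩ := hne s (card_le_of_quarter_separated s h1 h2) h1
      have hx' : x ∉ s := fun hmem => by
        have := hxs x hmem
        norm_num at this
      refine ⟨insert x s, by rw [Finset.card_insert_of_notMem hx', hk], ?_, ?_⟩
      · simp only [Finset.mem_insert, forall_eq_or_imp]
        exact ⟨hx, h1⟩
      · intro c hc d hd hcd
        rcases Finset.mem_insert.1 hc with rfl | hc' <;>
          rcases Finset.mem_insert.1 hd with rfl | hd'
        · exact absurd rfl hcd
        · exact (hxs d hd').le
        · rw [norm_sub_rev]; exact (hxs c hc').le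
        · exact h2 c hc' d hd' hcd
  obtain ⟨s, hk, h1, h2⟩ := hgrow (9 ^ Module.finrank ℝ E + 1)
  have := card_le_of_quarter_separated s h1 h2
  omega

end Net

theorem norm_le_of_quarter_net {E : Type*} [NormedAddCommGroup E] [InnerProductSpace ℝ E]
    {N : Finset E} (hN1 : ∀ c ∈ N, ‖c‖ ≤ 1) (hN : ∀ x : E, ‖x‖ ≤ 1 → ∃ c ∈ N, ‖x - c‖ ≤ 1 / 4)
    (T : E →L[ℝ] E) {a : ℝ} (hT : ∀ c ∈ N, ∀ d ∈ N, inner ℝ c (T d) ≤ a) : ‖T‖ ≤ 2 * a := by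
  have hb : ∀ x y : E, ‖x‖ ≤ 1 → ‖y‖ ≤ 1 → inner ℝ x (T y) ≤ a + ‖T‖ / 2 := by
    intro x y hx hy
    obtain ⟨c, hc, hxc⟩ := hN x hx
    obtain ⟨d, hd, hyd⟩ := hN y hy
    have h1 : inner ℝ x (T y) = inner ℝ c (T d) + inner ℝ (x - c) (T y)
        + inner ℝ c (T (y - d)) := by
      simp only [map_sub, inner_sub_left, inner_sub_right]; ring
    have h2 : inner ℝ (x - c) (T y) ≤ 1 / 4 * ‖T‖ := by
      refine (real_inner_le_norm _ _).trans ?_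
      have : ‖T y‖ ≤ ‖T‖ := by
        refine (T.le_opNorm y).trans (mul_le_of_le_one_right (norm_nonneg _) hy)
      exact mul_le_mul hxc this (norm_nonneg _) (by norm_num)
    have h3 : inner ℝ c (T (y - d)) ≤ 1 / 4 * ‖T‖ := by
      refine (real_inner_le_norm _ _).trans ?_
      have : ‖T (y - d)‖ ≤ 1 / 4 * ‖T‖ := by
        refine (T.le_opNorm _).trans ?_
        rw [mul_comm]
        exact mul_le_mul_of_nonneg_right hyd (norm_nonneg _)
      calc _ ≤ 1 * (1 / 4 * ‖T‖) := mul_le_mul (hN1 c hc) this (norm_nonneg _) (by norm_num)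
        _ = _ := one_mul _
    rw [h1]
    linarith [hT c hc d hd]
  have h0 : 0 ≤ a + ‖T‖ / 2 := by simpa using hb 0 0 (by simp) (by simp)
  have h1 : ‖T‖ ≤ a + ‖T‖ / 2 := by
    refine ContinuousLinearMap.opNorm_le_of_unit_norm h0 fun y hy => ?_
    rcases eq_or_ne (T y) 0 with h | h
    · rw [h, norm_zero]; exact h0
    · have h2 := hb (‖T y‖⁻¹ • T y) y (norm_smul_inv_norm (𝕜 := ℝ) h).le hy.le
      rw [real_inner_smul_left, real_inner_self_eq_norm_sq, sq,
        inv_mul_cancel_left₀ (norm_ne_zero_iff.2 h)] at h2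
      exact h2
  linarith

/-- The law of an `n × n` matrix with independent standard normal entries. -/
noncomputable def gaussianMatrix (n : ℕ) : Measure (Fin n → Fin n → ℝ) :=
  Measure.pi fun _ => Measure.pi fun _ => gaussianReal 0 1

instance (n : ℕ) : IsProbabilityMeasure (gaussianMatrix n) := by
  unfold gaussianMatrix; infer_instance

/-- The matrix obtained by replacing the diagonal by zero. -/
def offDiag {n : ℕ} (g : Fin n → Fin n → ℝ) : Matrix (Fin n) (Fin n) ℝ :=
  Matrix.of fun i j => if i = j then 0 else g i j

theorem measurable_matrix_of {α m n : Type*} [MeasurableSpace α] {f : α → Matrix m n ℝ}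
    (h : ∀ i j, Measurable fun a => f a i j) : Measurable f :=
  measurable_pi_iff.2 fun i => measurable_pi_iff.2 fun j => h i j

theorem measurable_matrix_apply {α m n : Type*} [MeasurableSpace α] {f : α → Matrix m n ℝ}
    (h : Measurable f) (i : m) (j : n) : Measurable fun a => f a i j :=
  (measurable_pi_apply j).comp ((measurable_pi_apply i).comp h)

theorem measurable_offDiag {n : ℕ} : Measurable (offDiag (n := n)) := by
  refine measurable_matrix_of fun i j => ?_
  by_cases h : i = j
  · simp [offDiag, h]
  · simp only [offDiag, Matrix.of_apply, h, if_false]; fun_prop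

theorem gaussianMatrix_eq_map (n : ℕ) :
    gaussianMatrix n = (Measure.pi fun _ : Fin n × Fin n => gaussianReal 0 1).map
      (MeasurableEquiv.curry (Fin n) (Fin n) ℝ) := by
  have h := Measure.infinitePi_map_curry (fun _ _ : Fin n => gaussianReal 0 1)
  simp only [Measure.infinitePi_eq_pi] at h
  exact h.symm

theorem gaussianMatrix_bilin_ge_le {n : ℕ} (x y : Fin n → ℝ) (hx : ∑ i, x i ^ 2 ≤ 1)
    (hy : ∑ i, y i ^ 2 ≤ 1) {a : ℝ} (ha : 0 ≤ a) :
    gaussianMatrix n {g | a ≤ x ⬝ᵥ (offDiag g).mulVec y}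
      ≤ ENNReal.ofReal (Real.exp (-a ^ 2 / 2)) := by
  set w : Fin n × Fin n → ℝ := fun p => if p.1 = p.2 then 0 else x p.1 * y p.2 with hw
  have hx0 : 0 ≤ ∑ i, x i ^ 2 := Finset.sum_nonneg fun _ _ => sq_nonneg _
  have hw1 : ∑ p, w p ^ 2 ≤ 1 := by
    calc ∑ p, w p ^ 2 ≤ ∑ p : Fin n × Fin n, x p.1 ^ 2 * y p.2 ^ 2 := by
          refine Finset.sum_le_sum fun p _ => ?_
          by_cases h : p.1 = p.2
          · simp only [hw, h, if_true, zero_pow two_ne_zero]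
            exact mul_nonneg (sq_nonneg _) (sq_nonneg _)
          · simp only [hw, h, if_false, mul_pow]; exact le_rfl
      _ = (∑ i, x i ^ 2) * ∑ j, y j ^ 2 := by
          rw [Fintype.sum_prod_type, Finset.sum_mul_sum]
      _ ≤ 1 := mul_le_one₀ hx (Finset.sum_nonneg fun _ _ => sq_nonneg _) hy
  rw [gaussianMatrix_eq_map, MeasurableEquiv.map_apply]
  convert measure_pi_gaussianReal_sum_ge_le w hw1 ha using 2
  ext r
  simp only [Set.mem_preimage, Set.mem_ofPred_eq]
  have : x ⬝ᵥ (offDiag (MeasurableEquiv.curry (Fin n) (Fin n) ℝ r)).mulVec y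
      = ∑ p, w p * r p := by
    rw [Fintype.sum_prod_type]
    simp only [dotProduct, Matrix.mulVec, Finset.mul_sum]
    refine Finset.sum_congr rfl fun i _ => Finset.sum_congr rfl fun j _ => ?_
    by_cases h : i = j
    · simp [hw, offDiag, h]
    · simp only [hw, offDiag, Matrix.of_apply, h, if_false]
      change x i * (r (i, j) * y j) = _
      ring
  rw [this]

theorem gaussianMatrix_opNorm_gt_le {n : ℕ} (hn : 0 < n) :
    gaussianMatrix n {g | 9 * Real.sqrt n < opNorm (offDiag g)}
      ≤ ENNReal.ofReal (Real.exp (-n)) := by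
  obtain ⟨N, hcard, hN1, hN⟩ := exists_quarter_net (E := EuclideanSpace ℝ (Fin n))
  rw [finrank_euclideanSpace, Fintype.card_fin] at hcard
  have hsub : {g | 9 * Real.sqrt n < opNorm (offDiag g)}
      ⊆ ⋃ p ∈ N ×ˢ N, {g : Fin n → Fin n → ℝ |
          9 / 2 * Real.sqrt n ≤ p.1.ofLp ⬝ᵥ (offDiag g).mulVec p.2.ofLp} := by
    intro g hg
    simp only [Set.mem_ofPred_eq] at hg
    by_contra hcon
    simp only [Finset.mem_product, Set.mem_iUnion, Set.mem_ofPred_eq, exists_prop, not_exists,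
      not_and, not_le, Prod.forall, and_imp] at hcon
    have h1 : opNorm (offDiag g) ≤ 2 * (9 / 2 * Real.sqrt n) := by
      refine norm_le_of_quarter_net hN1 hN _ fun c hc d hd => ?_
      refine le_trans (le_of_eq ?_) (hcon c d hc hd).le
      have : Matrix.toEuclideanCLM (n := Fin n) (𝕜 := ℝ) (offDiag g) d
          = WithLp.toLp 2 ((offDiag g).mulVec d.ofLp) := rfl
      rw [this]
      simp [PiLp.inner_apply, dotProduct, mul_comm]
    linarith
  refine (measure_mono hsub).trans ((measure_biUnion_finset_le _ _).trans ?_)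
  have hs : 0 ≤ 9 / 2 * Real.sqrt n := by positivity
  have hu : ∀ c ∈ N, ∑ i, c.ofLp i ^ 2 ≤ 1 := fun c hc => by
    rw [← EuclideanSpace.real_norm_sq_eq]
    exact pow_le_one₀ (norm_nonneg _) (hN1 c hc)
  calc _ ≤ ∑ _p ∈ N ×ˢ N, ENNReal.ofReal (Real.exp (-(9 / 2 * Real.sqrt n) ^ 2 / 2)) :=
        Finset.sum_le_sum fun p hp => by
          rw [Finset.mem_product] at hp
          exact gaussianMatrix_bilin_ge_le _ _ (hu _ hp.1) (hu _ hp.2) hs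
    _ = ENNReal.ofReal ((N.card * N.card : ℝ) * Real.exp (-(9 / 2 * Real.sqrt n) ^ 2 / 2)) := by
        rw [Finset.sum_const, Finset.card_product, nsmul_eq_mul, ENNReal.ofReal_mul (by positivity)]
        congr 1
        rw [← Nat.cast_mul, ENNReal.ofReal_natCast]
    _ ≤ ENNReal.ofReal (Real.exp (-n)) := by
        refine ENNReal.ofReal_le_ofReal ?_
        -- `81 ≤ e ^ 9` beats the Gaussian tail `e ^ (-81 n / 8)` at level `9 √n / 2`.
        have h9 : (81 : ℝ) ≤ Real.exp 9 := by
          have h2 : (2 : ℝ) ≤ Real.exp 1 := by linarith [Real.exp_one_gt_d9]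
          calc (81 : ℝ) ≤ 2 ^ 9 := by norm_num
            _ ≤ Real.exp 1 ^ 9 := pow_le_pow_left₀ (by norm_num) h2 9
            _ = _ := by rw [← Real.exp_nat_mul]; norm_num
        have hc : (N.card * N.card : ℝ) ≤ Real.exp (9 * n) := by
          have h3 : (N.card : ℝ) ≤ 9 ^ n := by exact_mod_cast hcard
          calc (N.card * N.card : ℝ) ≤ 9 ^ n * 9 ^ n :=
                mul_le_mul h3 h3 (by positivity) (by positivity)
            _ = 81 ^ n := by rw [← mul_pow]; norm_num
            _ ≤ Real.exp 9 ^ n := pow_le_pow_left₀ (by norm_num) h9 n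
            _ = _ := by rw [← Real.exp_nat_mul]; ring_nf
        refine (mul_le_mul_of_nonneg_right hc (Real.exp_nonneg _)).trans ?_
        rw [← Real.exp_add]
        refine Real.exp_le_exp.2 ?_
        rw [mul_pow, Real.sq_sqrt (by positivity)]
        have : (0 : ℝ) ≤ n := by positivity
        linarith

/-! ### The law of the clean matrices -/

/-- The set of pairs of indices above the diagonal. -/
abbrev UpperPair (n : ℕ) : Type := {p : Fin n × Fin n // p.1 < p.2}

/-- A symmetric random matrix with independent standard normal entries above the diagonal. -/
structure IsWigner {Ω : Type*} [MeasurableSpace Ω] (P : Measure Ω) {n : ℕ}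
    (A : Ω → Matrix (Fin n) (Fin n) ℝ) : Prop where
  measurable : Measurable A
  symm : ∀ ω, (A ω).IsSymm
  law : ∀ p : UpperPair n, P.map (fun ω => A ω p.1.1 p.1.2) = gaussianReal 0 1
  indep : iIndepFun (fun (p : UpperPair n) ω => A ω p.1.1 p.1.2) P

theorem map_fst_bivariateNormal (u : ℝ) :
    (bivariateNormal u).map Prod.fst = gaussianReal 0 1 := by
  rw [bivariateNormal, Measure.map_map (by fun_prop) (by fun_prop)]
  exact measurePreserving_fst.map_eq

theorem map_snd_bivariateNormal {u : ℝ} (hu : u ^ 2 ≤ 1) :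
    (bivariateNormal u).map Prod.snd = gaussianReal 0 1 := by
  rw [bivariateNormal, Measure.map_map (by fun_prop) (by fun_prop)]
  set μ := (gaussianReal 0 1).prod (gaussianReal 0 1) with hμ
  have h1 : μ.map (fun p : ℝ × ℝ => u * p.1)
      = gaussianReal 0 (NNReal.mk (u ^ 2) (sq_nonneg _)) := by
    have := gaussianReal_map_const_mul (μ := 0) (v := 1) u
    rw [mul_zero, mul_one] at this
    rw [← this, ← (measurePreserving_fst (μ := gaussianReal 0 1) (ν := gaussianReal 0 1)).map_eq,
      Measure.map_map (by fun_prop) (by fun_prop)]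
    rfl
  have h2 : μ.map (fun p : ℝ × ℝ => √(1 - u ^ 2) * p.2)
      = gaussianReal 0 (NNReal.mk (√(1 - u ^ 2) ^ 2) (sq_nonneg _)) := by
    have := gaussianReal_map_const_mul (μ := 0) (v := 1) (√(1 - u ^ 2))
    rw [mul_zero, mul_one] at this
    rw [← this, ← (measurePreserving_snd (μ := gaussianReal 0 1) (ν := gaussianReal 0 1)).map_eq,
      Measure.map_map (by fun_prop) (by fun_prop)]
    rfl
  have h3 : IndepFun (fun p : ℝ × ℝ => u * p.1) (fun p : ℝ × ℝ => √(1 - u ^ 2) * p.2) μ :=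
    indepFun_prod (by fun_prop) (by fun_prop)
  have h4 := gaussianReal_add_gaussianReal_of_indepFun h3 h1 h2
  have h5 : NNReal.mk (u ^ 2) (sq_nonneg _) + NNReal.mk (√(1 - u ^ 2) ^ 2) (sq_nonneg _) = 1 := by
    ext
    rw [NNReal.coe_add]
    change u ^ 2 + √(1 - u ^ 2) ^ 2 = (1 : ℝ)
    rw [Real.sq_sqrt (by linarith)]
    ring
  rw [add_zero, h5] at h4
  exact h4

section Law

variable {Ω : Type*} [MeasurableSpace Ω] {P : Measure Ω} {n : ℕ} {ρ : ℝ} {π : Equiv.Perm (Fin n)}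
  {A B : Ω → Matrix (Fin n) (Fin n) ℝ}

theorem IsCorrelatedWigner.isWigner_fst (h : IsCorrelatedWigner P ρ π A B) : IsWigner P A where
  measurable := h.measurable_fst
  symm := h.symm_fst
  law p := by
    have hm := (measurable_matrix_apply h.measurable_fst p.1.1 p.1.2).prodMk
      (measurable_matrix_apply h.measurable_snd (π p.1.1) (π p.1.2))
    rw [← map_fst_bivariateNormal ρ, ← h.law _ _ p.2, Measure.map_map _root_.measurable_fst hm]
    rfl
  indep := h.indep.comp (fun _ => Prod.fst) fun _ => _root_.measurable_fst

/-- The pair of indices above the diagonal that `π` maps to a given pair, up to order. -/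
def pullbackPair (π : Equiv.Perm (Fin n)) (p : UpperPair n) : UpperPair n :=
  if h : π.symm p.1.1 < π.symm p.1.2 then ⟨(π.symm p.1.1, π.symm p.1.2), h⟩
  else ⟨(π.symm p.1.2, π.symm p.1.1),
    lt_of_le_of_ne (not_lt.1 h) fun h' => p.2.ne (π.symm.injective h').symm⟩

theorem pullbackPair_injective (π : Equiv.Perm (Fin n)) :
    Function.Injective (pullbackPair π) := by
  rintro ⟨⟨a, b⟩, hab⟩ ⟨⟨c, d⟩, hcd⟩ h
  simp only [pullbackPair] at h
  simp only at hab hcd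
  split_ifs at h <;> simp only [Subtype.mk.injEq, Prod.mk.injEq, EmbeddingLike.apply_eq_iff_eq] at h
    <;> obtain ⟨h1, h2⟩ := h <;> subst h1 <;> subst h2
  · rfl
  · exact absurd hab (lt_asymm hcd)
  · exact absurd hab (lt_asymm hcd)
  · rfl

theorem apply_pullbackPair {M : Matrix (Fin n) (Fin n) ℝ} (hM : M.IsSymm)
    (π : Equiv.Perm (Fin n)) (p : UpperPair n) :
    M (π (pullbackPair π p).1.1) (π (pullbackPair π p).1.2) = M p.1.1 p.1.2 := by
  unfold pullbackPair
  split_ifs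
  · simp
  · simpa using hM.apply p.1.1 p.1.2

theorem IsCorrelatedWigner.isWigner_snd (h : IsCorrelatedWigner P ρ π A B) (hρ : ρ ^ 2 ≤ 1) :
    IsWigner P B where
  measurable := h.measurable_snd
  symm := h.symm_snd
  law p := by
    set q := pullbackPair π p with hq
    have hm := (measurable_matrix_apply h.measurable_fst q.1.1 q.1.2).prodMk
      (measurable_matrix_apply h.measurable_snd (π q.1.1) (π q.1.2))
    rw [← map_snd_bivariateNormal hρ, ← h.law _ _ q.2, Measure.map_map _root_.measurable_snd hm]
    congr 1
    ext ω
    exact (apply_pullbackPair (h.symm_snd ω) π p).symm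
  indep := by
    have h1 := (h.indep.comp (fun _ => Prod.snd) fun _ => _root_.measurable_snd).precomp
      (pullbackPair_injective π)
    convert h1 using 2 with p
    ext ω
    exact (apply_pullbackPair (h.symm_snd ω) π p).symm

theorem IsWigner.map_upper (h : IsWigner P A) :
    P.map (fun ω (p : UpperPair n) => A ω p.1.1 p.1.2)
      = Measure.pi fun _ => gaussianReal 0 1 := by
  rw [h.indep.map_fun_eq_pi_map fun p => (measurable_matrix_apply h.measurable _ _).aemeasurable]
  simp only [h.law]

/-- The matrix with given entries above and below the diagonal, and zero diagonal. -/
def fromTriangles {n : ℕ} (x : (UpperPair n → ℝ) × (UpperPair n → ℝ)) :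
    Matrix (Fin n) (Fin n) ℝ :=
  Matrix.of fun i j => if h : j < i then x.2 ⟨(j, i), h⟩ else
    if h : i < j then x.1 ⟨(i, j), h⟩ else 0

theorem measurable_fromTriangles : Measurable (fromTriangles (n := n)) := by
  refine measurable_matrix_of fun i j => ?_
  simp only [fromTriangles, Matrix.of_apply]
  split_ifs <;> fun_prop

theorem gaussianMatrix_map_triangles (n : ℕ) :
    (gaussianMatrix n).map (fun g => ((fun p : UpperPair n => g p.1.1 p.1.2),
        (fun p : UpperPair n => g p.1.2 p.1.1)))
      = (Measure.pi fun _ => gaussianReal 0 1).prod (Measure.pi fun _ => gaussianReal 0 1) := by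
  let e : UpperPair n ⊕ UpperPair n → Fin n × Fin n :=
    Sum.elim (fun p => p.1) (fun p => (p.1.2, p.1.1))
  have he : Function.Injective e := by
    rintro (⟨⟨a, b⟩, hab⟩ | ⟨⟨a, b⟩, hab⟩) (⟨⟨c, d⟩, hcd⟩ | ⟨⟨c, d⟩, hcd⟩) h <;>
      simp only [e, Sum.elim_inl, Sum.elim_inr, Prod.mk.injEq] at h hab hcd <;>
      obtain ⟨h1, h2⟩ := h <;> subst h1 <;> subst h2
    · rfl
    · exact absurd hab (lt_asymm hcd)
    · exact absurd hab (lt_asymm hcd)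
    · rfl
  have h0 : iIndepFun (fun (q : Fin n × Fin n) (r : Fin n × Fin n → ℝ) => r q)
      (Measure.pi fun _ => gaussianReal 0 1) :=
    iIndepFun_pi (X := fun _ => id) fun _ => aemeasurable_id
  have h1 := (h0.precomp he).map_fun_eq_pi_map
    fun q => (measurable_pi_apply (e q)).aemeasurable
  have h2 : ∀ q, (Measure.pi fun _ : Fin n × Fin n => gaussianReal 0 1).map
      (fun r : Fin n × Fin n → ℝ => r q) = gaussianReal 0 1 := fun q =>
    (measurePreserving_eval (fun _ : Fin n × Fin n => gaussianReal 0 1) q).map_eq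
  simp only [h2] at h1
  have h3 := (measurePreserving_sumPiEquivProdPi
    (fun _ : UpperPair n ⊕ UpperPair n => gaussianReal 0 1)).map_eq
  rw [← h3, ← h1, gaussianMatrix_eq_map, Measure.map_map (by fun_prop) (by fun_prop),
    Measure.map_map (by fun_prop) (by fun_prop)]
  rfl

theorem gaussianMatrix_map_offDiag (n : ℕ) : (gaussianMatrix n).map offDiag
    = ((Measure.pi fun _ => gaussianReal 0 1).prod
        (Measure.pi fun _ => gaussianReal 0 1)).map fromTriangles := by
  rw [← gaussianMatrix_map_triangles, Measure.map_map measurable_fromTriangles (by fun_prop)]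
  congr 1
  ext g i j
  simp only [offDiag, fromTriangles, Matrix.of_apply, Function.comp_apply]
  rcases lt_trichotomy i j with h | h | h
  · simp [h, h.ne, lt_asymm h]
  · simp [h]
  · simp [h, h.ne']

/-- The rotation of the plane by `-π/4`. -/
noncomputable def diagRotation (z : ℝ × ℝ) : ℝ × ℝ :=
  ((z.1 - z.2) / √2, (z.1 + z.2) / √2)

theorem map_diagRotation : ((gaussianReal 0 1).prod (gaussianReal 0 1)).map diagRotation
    = (gaussianReal 0 1).prod (gaussianReal 0 1) := by
  have h1 := IsGaussian.map_rotation_eq_self (μ := gaussianReal 0 1) (by simp) (-(Real.pi / 4))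
  convert h1 using 2
  have h2 : (√2)⁻¹ = √2 * (1 / 2) := by
    have := Real.mul_self_sqrt (show (0 : ℝ) ≤ 2 by norm_num)
    field_simp
    linarith
  ext z
  · simp only [diagRotation, ContinuousLinearMap.rotation_apply, Real.cos_neg, Real.sin_neg,
      Real.cos_pi_div_four, Real.sin_pi_div_four, smul_eq_mul, div_eq_mul_inv _ (√2), h2]
    ring
  · simp only [diagRotation, ContinuousLinearMap.rotation_apply, Real.cos_neg, Real.sin_neg,
      Real.cos_pi_div_four, Real.sin_pi_div_four, smul_eq_mul, div_eq_mul_inv _ (√2), h2]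
    ring

/-- Adding and subtracting an independent Wigner matrix turns a symmetric Wigner matrix into a
matrix whose off-diagonal entries are all independent standard normal. -/
theorem IsWigner.map_noisy [IsProbabilityMeasure P] (hA : IsWigner P A) (hB : IsWigner P B)
    (hAB : IndepFun A B P) :
    P.map (fun ω => noisy (A ω) (B ω)) = (gaussianMatrix n).map offDiag := by
  have hm : Measurable fun (M : Matrix (Fin n) (Fin n) ℝ) (p : UpperPair n) => M p.1.1 p.1.2 :=
    measurable_pi_iff.2 fun p => measurable_matrix_apply measurable_id _ _
  have h1 := (indepFun_iff_map_prod_eq_prod_map_map (hm.comp hA.measurable).aemeasurable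
    (hm.comp hB.measurable).aemeasurable).1 (hAB.comp hm hm)
  have h2 : P.map ((fun (M : Matrix (Fin n) (Fin n) ℝ) (p : UpperPair n) => M p.1.1 p.1.2) ∘ A)
      = Measure.pi fun _ => gaussianReal 0 1 := hA.map_upper
  have h3 : P.map ((fun (M : Matrix (Fin n) (Fin n) ℝ) (p : UpperPair n) => M p.1.1 p.1.2) ∘ B)
      = Measure.pi fun _ => gaussianReal 0 1 := hB.map_upper
  rw [h2, h3] at h1
  -- Rotate each pair of corresponding entries.
  have h4 := measurePreserving_arrowProdEquivProdArrow ℝ ℝ (UpperPair n)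
    (fun _ => gaussianReal 0 1) (fun _ => gaussianReal 0 1)
  have hmt : Measurable diagRotation := by unfold diagRotation; fun_prop
  have hsf : SigmaFinite (((gaussianReal 0 1).prod (gaussianReal 0 1)).map diagRotation) := by
    rw [map_diagRotation]; infer_instance
  have h5 : MeasurePreserving (fun (x : UpperPair n → ℝ × ℝ) p => diagRotation (x p))
      (Measure.pi fun _ => (gaussianReal 0 1).prod (gaussianReal 0 1))
      (Measure.pi fun _ => (gaussianReal 0 1).prod (gaussianReal 0 1)) := by
    refine ⟨by fun_prop, ?_⟩
    have := Measure.pi_map_pi (ι := UpperPair n)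
      (μ := fun _ => (gaussianReal 0 1).prod (gaussianReal 0 1)) (f := fun _ => diagRotation)
      (fun _ => hmt.aemeasurable)
    rw [map_diagRotation] at this
    exact this
  have h6 := (h4.comp (h5.comp h4.symm)).map_eq
  rw [gaussianMatrix_map_offDiag]
  nth_rewrite 1 [← h6]
  rw [← h1, Measure.map_map (by fun_prop) ((hm.comp hA.measurable).prodMk (hm.comp hB.measurable)),
    Measure.map_map measurable_fromTriangles]
  · congr 1
    ext ω i j
    have hsA := (hA.symm ω).apply j i
    have hsB := (hB.symm ω).apply j i
    simp only [noisy, fromTriangles, Matrix.of_apply, Function.comp_apply, diagRotation]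
    split_ifs
    · rw [hsA, hsB]; rfl
    · rfl
    · rfl
  · exact (h4.comp (h5.comp h4.symm)).measurable.comp
      ((hm.comp hA.measurable).prodMk (hm.comp hB.measurable))

end Law

/-! ### Exponential moments of Gaussian quadratic forms -/

theorem lintegral_exp_sq_gaussianReal_le {v : NNReal} (hv : v ≠ 0) :
    ∫⁻ z, ENNReal.ofReal (Real.exp (z ^ 2 / (4 * v))) ∂(gaussianReal 0 v) ≤ 2 := by
  have hv0 : (0 : ℝ) < v := by positivity
  have hm : Measurable fun z : ℝ => ENNReal.ofReal (Real.exp (z ^ 2 / (4 * v))) := by fun_prop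
  rw [gaussianReal_of_var_ne_zero _ hv,
    lintegral_withDensity_eq_lintegral_mul _ (measurable_gaussianPDF _ _) hm]
  have h1 : ∀ z : ℝ, (gaussianPDF 0 v * fun z : ℝ => ENNReal.ofReal (Real.exp (z ^ 2 / (4 * v)))) z
      = ENNReal.ofReal ((√(2 * Real.pi * v))⁻¹ * Real.exp (-(1 / (4 * v)) * z ^ 2)) := by
    intro z
    rw [Pi.mul_apply, gaussianPDF, gaussianPDFReal, ← ENNReal.ofReal_mul (by positivity), mul_assoc,
      ← Real.exp_add]
    congr 3
    field_simp
    ring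
  simp_rw [h1]
  have hb : (0 : ℝ) < 1 / (4 * v) := by positivity
  rw [← ofReal_integral_eq_lintegral_ofReal
    ((integrable_exp_neg_mul_sq hb).const_mul _) (Eventually.of_forall fun z => by positivity),
    integral_const_mul, integral_gaussian]
  rw [← ENNReal.ofReal_ofNat]
  refine ENNReal.ofReal_le_ofReal ?_
  rw [inv_mul_le_iff₀ (by positivity)]
  have hpi := Real.pi_pos
  calc √(Real.pi / (1 / (4 * v))) ≤ √(2 * Real.pi * v * 2 ^ 2) := by
        refine Real.sqrt_le_sqrt ?_
        rw [div_div_eq_mul_div, div_one]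
        have : 0 < Real.pi * v := by positivity
        linarith
    _ = √(2 * Real.pi * v) * 2 := by
        rw [Real.sqrt_mul (by positivity), Real.sqrt_sq (by norm_num)]

theorem lintegral_exp_sq_pi_le {ι : Type*} [Fintype ι] (w : ι → ℝ) :
    ∫⁻ r, ENNReal.ofReal (Real.exp ((∑ j, w j * r j) ^ 2 / (4 * ∑ j, w j ^ 2)))
      ∂(Measure.pi fun _ : ι => gaussianReal 0 1) ≤ 2 := by
  have h0 : 0 ≤ ∑ j, w j ^ 2 := Finset.sum_nonneg fun _ _ => sq_nonneg _
  rcases h0.eq_or_lt with h | h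
  · rw [← h]; simp
  · have h1 := lintegral_exp_sq_gaussianReal_le (v := (∑ j, w j ^ 2).toNNReal)
      (by simpa using h)
    rw [← map_pi_gaussianReal_sum, lintegral_map (by fun_prop) (by fun_prop),
      Real.coe_toNNReal _ h0] at h1
    exact h1

/-- Jensen's inequality reduces the exponential moment of `‖r w‖²` to that of one coordinate. -/
theorem lintegral_exp_sum_sq_pi_le {ι κ : Type*} [Fintype ι] [Fintype κ] (w : ι → κ → ℝ) :
    ∫⁻ r, ENNReal.ofReal (Real.exp ((∑ k, (∑ j, w j k * r j) ^ 2) / (4 * ∑ k, ∑ j, w j k ^ 2)))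
      ∂(Measure.pi fun _ : ι => gaussianReal 0 1) ≤ 2 := by
  set v : κ → ℝ := fun k => ∑ j, w j k ^ 2 with hv
  have hv0 : ∀ k, 0 ≤ v k := fun k => Finset.sum_nonneg fun _ _ => sq_nonneg _
  have hs0 : 0 ≤ ∑ k, v k := Finset.sum_nonneg fun k _ => hv0 k
  rcases hs0.eq_or_lt with h | h
  · rw [← h]; simp
  have hp1 : ∑ k, v k / ∑ k, v k = 1 := by rw [← Finset.sum_div, div_self h.ne']
  have hpt : ∀ r : ι → ℝ,
      ENNReal.ofReal (Real.exp ((∑ k, (∑ j, w j k * r j) ^ 2) / (4 * ∑ k, v k)))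
        ≤ ∑ k, ENNReal.ofReal (v k / ∑ k, v k)
            * ENNReal.ofReal (Real.exp ((∑ j, w j k * r j) ^ 2 / (4 * v k))) := by
    intro r
    have h1 : (∑ k, (∑ j, w j k * r j) ^ 2) / (4 * ∑ k, v k)
        = ∑ k, (v k / ∑ k, v k) • ((∑ j, w j k * r j) ^ 2 / (4 * v k)) := by
      rw [Finset.sum_div]
      refine Finset.sum_congr rfl fun k _ => ?_
      rcases (hv0 k).eq_or_lt with hk | hk
      · have hw : ∀ j, w j k = 0 := fun j => by
          have := (Finset.sum_eq_zero_iff_of_nonneg fun j _ => sq_nonneg (w j k)).1 hk.symm j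
            (Finset.mem_univ j)
          exact pow_eq_zero_iff two_ne_zero |>.1 this
        simp [hw]
      · rw [smul_eq_mul]
        field_simp
    have h2 := convexOn_exp.map_sum_le (t := Finset.univ) (w := fun k => v k / ∑ k, v k)
      (p := fun k => (∑ j, w j k * r j) ^ 2 / (4 * v k))
      (fun k _ => div_nonneg (hv0 k) hs0) hp1 (fun k _ => Set.mem_univ _)
    rw [h1]
    refine (ENNReal.ofReal_le_ofReal h2).trans (le_of_eq ?_)
    rw [ENNReal.ofReal_sum_of_nonneg]
    · refine Finset.sum_congr rfl fun k _ => ?_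
      rw [smul_eq_mul, ENNReal.ofReal_mul (div_nonneg (hv0 k) hs0)]
    · intro k _
      exact mul_nonneg (div_nonneg (hv0 k) hs0) (Real.exp_nonneg _)
  refine (lintegral_mono hpt).trans ?_
  rw [lintegral_finsetSum _ fun k _ => by fun_prop]
  calc _ ≤ ∑ k, ENNReal.ofReal (v k / ∑ k, v k) * 2 := by
        refine Finset.sum_le_sum fun k _ => ?_
        rw [lintegral_const_mul _ (by fun_prop)]
        gcongr
        exact lintegral_exp_sq_pi_le fun j => w j k
    _ = 2 := by
        rw [← Finset.sum_mul, ← ENNReal.ofReal_sum_of_nonneg fun k _ => div_nonneg (hv0 k) hs0, hp1]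
        simp

/-- Conditionally on the rows outside `S`, the rows in `S` are independent. -/
theorem lintegral_prod_rows_le {n : ℕ} (S : Finset (Fin n))
    {h : (Fin n → ℝ) → (Fin n → Fin n → ℝ) → ENNReal} (hm : Measurable (Function.uncurry h))
    (hdep : ∀ r g g', (∀ i ∉ S, g i = g' i) → h r g = h r g') {c : ENNReal}
    (hc : ∀ g, ∫⁻ r, h r g ∂(Measure.pi fun _ => gaussianReal 0 1) ≤ c) :
    ∫⁻ g, ∏ i ∈ S, h (g i) g ∂(gaussianMatrix n) ≤ c ^ S.card := by
  set ν : Measure (Fin n → ℝ) := Measure.pi fun _ => gaussianReal 0 1 with hν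
  set e := MeasurableEquiv.piEquivPiSubtypeProd (fun _ : Fin n => Fin n → ℝ) (· ∈ S) with he
  have hmp : MeasurePreserving e (gaussianMatrix n) _ :=
    measurePreserving_piEquivPiSubtypeProd (fun _ : Fin n => ν) (· ∈ S)
  have hF : Measurable fun g : Fin n → Fin n → ℝ => ∏ i ∈ S, h (g i) g :=
    Finset.measurable_prod _ fun i _ =>
      hm.comp (f := fun g : Fin n → Fin n → ℝ => (g i, g))
        ((measurable_pi_apply i).prodMk measurable_id)
  rw [← hmp.symm.lintegral_comp hF, lintegral_prod_symm _ (by fun_prop)]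
  have hrow : ∀ (y : ∀ i : {i // i ∉ S}, Fin n → ℝ),
      ∫⁻ x, ∏ i ∈ S, h (e.symm (x, y) i) (e.symm (x, y))
        ∂(Measure.pi fun _ : {i // i ∈ S} => ν) ≤ c ^ S.card := by
    intro y
    have h1 : ∀ x : {i // i ∈ S} → Fin n → ℝ,
        ∏ i ∈ S, h (e.symm (x, y) i) (e.symm (x, y))
          = ∏ i : {i // i ∈ S}, h (x i) (e.symm (0, y)) := by
      intro x
      rw [← Finset.prod_coe_sort]
      refine Finset.prod_congr rfl fun i _ => ?_
      have h2 : e.symm (x, y) i = x i := by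
        change (if h : (i : Fin n) ∈ S then x ⟨i, h⟩ else y ⟨i, h⟩) = x i
        rw [dif_pos i.2]
      rw [h2]
      refine hdep _ _ _ fun j hj => ?_
      change (if h : j ∈ S then x ⟨j, h⟩ else y ⟨j, h⟩)
        = (if h : j ∈ S then (0 : {i // i ∈ S} → Fin n → ℝ) ⟨j, h⟩ else y ⟨j, h⟩)
      rw [dif_neg hj, dif_neg hj]
    simp_rw [h1]
    have hmy : Measurable fun r => h r (e.symm (0, y)) :=
      hm.comp (measurable_id.prodMk measurable_const)
    rw [lintegral_prod_eq_prod_lintegral_of_indepFun (μ := Measure.pi fun _ : {i // i ∈ S} => ν)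
      Finset.univ (fun i x => h (x i) (e.symm (0, y)))
      (iIndepFun_pi (X := fun _ r => h r (e.symm (0, y))) fun _ => hmy.aemeasurable)
      fun i => hmy.comp (measurable_pi_apply i)]
    calc _ ≤ ∏ _i : {i // i ∈ S}, c := Finset.prod_le_prod' fun i _ => by
          rw [(measurePreserving_eval (fun _ : {i // i ∈ S} => ν) i).lintegral_comp hmy]
          exact hc _
      _ = c ^ S.card := by simp
  refine (lintegral_mono (g := fun _ => c ^ S.card) fun y => ?_).trans (by simp)
  convert hrow y

/-! ### The cross block -/

section CrossBlock

variable {φ : ℝ → ℝ} {K : ℕ → ℕ} {n : ℕ}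

theorem measurable_fIter (hφ : IsDenoiser φ) {α : Type*} [MeasurableSpace α] {β : α → BetaSeq K}
    (hβ : Measurable β) {Ξ : α → XiSeq K} (hΞ : Measurable Ξ)
    {M : α → Matrix (Fin n) (Fin n) ℝ} (hM : Measurable M) (U : Fin (K 0) ↪ Fin n) (t : ℕ) :
    Measurable fun a => fIter φ (β a) (Ξ a) (M a) U (initIter φ (M a) U) t := by
  have hφm : Measurable φ := hφ.contDiff.continuous.measurable
  induction t with
  | zero =>
    exact measurable_matrix_of fun i j => hφm.comp (measurable_matrix_apply hM _ _)
  | succ t ih =>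
    refine measurable_matrix_of fun i j => hφm.comp ?_
    simp only [linStep, Matrix.mul_apply, Matrix.smul_apply, Matrix.submatrix_apply, smul_eq_mul]
    have h1 : ∀ i j, Measurable fun a => β a t i j := fun i j =>
      measurable_matrix_apply ((measurable_pi_apply t).comp hβ) i j
    have h2 : ∀ i j, Measurable fun a => Ξ a t i j := fun i j =>
      measurable_matrix_apply ((measurable_pi_apply t).comp hΞ) i j
    have h3 := measurable_matrix_apply hM
    have h4 := measurable_matrix_apply ih
    fun_prop

theorem measurable_leaveOut (hφ : IsDenoiser φ) {α : Type*} [MeasurableSpace α]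
    {β : α → BetaSeq K} (hβ : Measurable β) {Ξ : α → XiSeq K} (hΞ : Measurable Ξ)
    {M : α → Matrix (Fin n) (Fin n) ℝ} (hM : Measurable M) (S : Finset (Fin n))
    (U : Fin (K 0) ↪ Fin n) (t : ℕ) :
    Measurable fun a => leaveOut φ (β a) (Ξ a) (M a) S U t := by
  have hz : Measurable fun a => zeroOut (M a) S := measurable_matrix_of fun i j => by
    simp only [zeroOut, Matrix.of_apply]
    split_ifs
    · fun_prop
    · exact measurable_matrix_apply hM i j
  have h1 := measurable_matrix_apply (measurable_fIter hφ hβ hΞ hz U t)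
  have h2 : ∀ i j, Measurable fun a => Ξ a t i j := fun i j =>
    measurable_matrix_apply ((measurable_pi_apply t).comp hΞ) i j
  refine measurable_matrix_of fun i j => ?_
  simp only [leaveOut, Matrix.mul_apply]
  fun_prop

theorem measurable_frobNorm_sq {α ι κ : Type*} [MeasurableSpace α] [Fintype ι] [Fintype κ]
    {M : α → Matrix ι κ ℝ} (hM : Measurable M) : Measurable fun a => frobNorm (M a) ^ 2 := by
  have h := measurable_matrix_apply hM
  simp only [frobNorm_sq]
  fun_prop

theorem measurableSet_crossBound (hφ : IsDenoiser φ) {α : Type*} [MeasurableSpace α]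
    {β : α → BetaSeq K} (hβ : Measurable β) {Ξ : α → XiSeq K} (hΞ : Measurable Ξ)
    {M : α → Matrix (Fin n) (Fin n) ℝ} (hM : Measurable M) (S : Finset (Fin n))
    (U : Fin (K 0) ↪ Fin n) (t : ℕ) (x : ℝ) :
    MeasurableSet {a | CrossBound φ (β a) (Ξ a) (M a) S U t x} := by
  have hW := measurable_leaveOut hφ hβ hΞ hM S U t
  have hc : ∀ i j, Measurable fun a => crossBlock (M a) S i j := fun i j => by
    simp only [crossBlock, Matrix.of_apply]
    split_ifs
    · exact measurable_matrix_apply hM i j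
    · fun_prop
  refine measurableSet_le (measurable_frobNorm_sq (measurable_matrix_of fun i k => ?_))
    ((measurable_frobNorm_sq hW).const_mul _)
  have h1 := measurable_matrix_apply hW
  simp only [Matrix.mul_apply, Matrix.submatrix_apply]
  fun_prop

/-- The matrix `W`, extended by zero to all row indices and set to zero in the rows in `S`. -/
noncomputable def extendRest {k b : ℕ} {U : Fin k ↪ Fin n} (S : Finset (Fin n))
    (W : Matrix (Rest U) (Fin b) ℝ) : Matrix (Fin n) (Fin b) ℝ :=
  open scoped Classical in
  Matrix.of fun j l => if hj : j ∉ Set.range U ∧ j ∉ S then W ⟨j, hj.1⟩ l else 0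

section Extend

variable {k b : ℕ} {U : Fin k ↪ Fin n} (S : Finset (Fin n)) (W : Matrix (Rest U) (Fin b) ℝ)

theorem sum_rest {M : Type*} [AddCommMonoid M] (g : Fin n → M)
    (hg : ∀ j, j ∈ Set.range U → g j = 0) : ∑ j, g j = ∑ j : Rest U, g j := by
  classical
  rw [← Finset.sum_subtype (Finset.univ.filter fun j => j ∉ Set.range U) (by simp) g,
    Finset.sum_filter]
  refine Finset.sum_congr rfl fun j _ => ?_
  split_ifs with hj
  · exact hg j hj
  · rfl

theorem extendRest_of_mem {j : Fin n} (hj : j ∈ S) (l : Fin b) : extendRest S W j l = 0 := by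
  simp [extendRest, hj]

theorem extendRest_of_mem_range {j : Fin n} (hj : j ∈ Set.range U) (l : Fin b) :
    extendRest S W j l = 0 := by
  rw [extendRest, Matrix.of_apply, dif_neg fun h => h.1 hj]

theorem extendRest_of_notMem {j : Rest U} (hj : j.1 ∉ S) (l : Fin b) :
    extendRest S W j.1 l = W j l := by
  rw [extendRest, Matrix.of_apply, dif_pos ⟨j.2, hj⟩]

theorem sum_extendRest_sq_le :
    ∑ l, ∑ j, extendRest S W j l ^ 2 ≤ frobNorm W ^ 2 := by
  rw [frobNorm_sq, Finset.sum_comm (f := fun i j => W i j ^ 2)]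
  refine Finset.sum_le_sum fun l _ => ?_
  rw [sum_rest (U := U) _ fun j hj => by rw [extendRest_of_mem_range S W hj]; norm_num]
  refine Finset.sum_le_sum fun j _ => ?_
  by_cases hj : j.1 ∈ S
  · rw [extendRest_of_mem S W hj, zero_pow two_ne_zero]; exact sq_nonneg _
  · rw [extendRest_of_notMem S W hj]

theorem frobNorm_crossBlock_mul_sq_le (g : Fin n → Fin n → ℝ) :
    frobNorm ((crossBlock (offDiag g) S).submatrix (fun i : Rest U => i.1)
        (fun i : Rest U => i.1) * W) ^ 2
      ≤ ∑ i ∈ S, ∑ l, (∑ j, extendRest S W j l * g i j) ^ 2 := by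
  classical
  have h1 : ∀ (i : Rest U) l, ((crossBlock (offDiag g) S).submatrix (fun i : Rest U => i.1)
      (fun i : Rest U => i.1) * W) i l
      = if i.1 ∈ S then ∑ j, extendRest S W j l * g i.1 j else 0 := by
    intro i l
    simp only [Matrix.mul_apply, Matrix.submatrix_apply]
    by_cases hi : i.1 ∈ S
    · rw [if_pos hi, sum_rest (U := U) _ fun j hj => by
        rw [extendRest_of_mem_range S W hj]; ring]
      refine Finset.sum_congr rfl fun j _ => ?_
      by_cases hj : j.1 ∈ S
      · simp [crossBlock, hj, extendRest_of_mem S W hj]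
      · have hij : i.1 ≠ j.1 := fun h => hj (h ▸ hi)
        rw [extendRest_of_notMem S W hj, mul_comm]
        simp [crossBlock, offDiag, hi, hj, hij]
    · simp [crossBlock, hi]
  rw [frobNorm_sq]
  simp_rw [h1]
  calc _ = ∑ i : Rest U, if i.1 ∈ S then ∑ l, (∑ j, extendRest S W j l * g i.1 j) ^ 2 else 0 := by
        refine Finset.sum_congr rfl fun i _ => ?_
        split_ifs
        · rfl
        · simp
    _ = ∑ i ∈ Finset.univ.filter (fun j => j ∉ Set.range U),
          if i ∈ S then ∑ l, (∑ j, extendRest S W j l * g i j) ^ 2 else 0 := by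
        rw [Finset.sum_subtype (p := fun j => j ∉ Set.range U) _ (by simp)]
    _ ≤ ∑ i, if i ∈ S then ∑ l, (∑ j, extendRest S W j l * g i j) ^ 2 else 0 :=
        Finset.sum_le_sum_of_subset_of_nonneg (Finset.subset_univ _) fun i _ _ => by
          split_ifs
          · exact Finset.sum_nonneg fun _ _ => sq_nonneg _
          · exact le_rfl
    _ = _ := by simp

/-- A violation of the bound on the cross block makes the exponential moment of the rows in `S`
large. -/
theorem le_prod_exp_of_crossBlock {g : Fin n → Fin n → ℝ} {x : ℝ} (hx : 0 ≤ x)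
    (h : 4 * x * frobNorm W ^ 2 < frobNorm ((crossBlock (offDiag g) S).submatrix
      (fun i : Rest U => i.1) (fun i : Rest U => i.1) * W) ^ 2) :
    ENNReal.ofReal (Real.exp x) ≤ ∏ i ∈ S, ENNReal.ofReal (Real.exp
      ((∑ l, (∑ j, extendRest S W j l * g i j) ^ 2) / (4 * ∑ l, ∑ j, extendRest S W j l ^ 2))) := by
  set σ := ∑ l, ∑ j, extendRest S W j l ^ 2 with hσ
  have hσ0 : 0 ≤ σ := Finset.sum_nonneg fun _ _ => Finset.sum_nonneg fun _ _ => sq_nonneg _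
  have hlt : 4 * x * σ < ∑ i ∈ S, ∑ l, (∑ j, extendRest S W j l * g i j) ^ 2 :=
    (mul_le_mul_of_nonneg_left (sum_extendRest_sq_le S W) (by positivity)).trans_lt
      (h.trans_le (frobNorm_crossBlock_mul_sq_le S W g))
  rw [← ENNReal.ofReal_prod_of_nonneg fun _ _ => Real.exp_nonneg _, ← Real.exp_sum,
    ← Finset.sum_div]
  refine ENNReal.ofReal_le_ofReal (Real.exp_le_exp.2 ?_)
  rcases hσ0.eq_or_lt with hz | hpos
  · -- If `σ = 0`, the quadratic form vanishes as well.
    exfalso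
    have hw0 : ∀ j l, extendRest S W j l = 0 := fun j l => by
      have h1 := (Finset.sum_eq_zero_iff_of_nonneg fun l _ =>
        Finset.sum_nonneg fun j _ => sq_nonneg (extendRest S W j l)).1 hz.symm l
          (Finset.mem_univ l)
      have h2 := (Finset.sum_eq_zero_iff_of_nonneg
        fun j _ => sq_nonneg (extendRest S W j l)).1 h1 j (Finset.mem_univ j)
      exact pow_eq_zero_iff two_ne_zero |>.1 h2
    rw [← hz] at hlt
    simp [hw0] at hlt
  · rw [le_div_iff₀ (by positivity)]
    linarith

end Extend

/-- For a Gaussian matrix and a fixed set `S`, the cross block satisfies `CrossBound` up to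
probability `2 ^ |S| e ^ (-x)`: the rows in `S` are independent of the matrix they multiply. -/
theorem gaussianMatrix_not_crossBound_le (hφ : IsDenoiser φ) (β : BetaSeq K) (Ξ : XiSeq K)
    (S : Finset (Fin n)) (U : Fin (K 0) ↪ Fin n) (t : ℕ) {x : ℝ} (hx : 0 ≤ x) :
    gaussianMatrix n {g | ¬ CrossBound φ β Ξ (offDiag g) S U t x}
      ≤ ENNReal.ofReal (2 ^ S.card * Real.exp (-x)) := by
  set w : (Fin n → Fin n → ℝ) → Matrix (Fin n) (Fin (K t / 12)) ℝ := fun g =>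
    extendRest S (leaveOut φ β Ξ (offDiag g) S U t) with hw
  have hwm : ∀ j k, Measurable fun g => w g j k := by
    intro j k
    simp only [hw, extendRest, Matrix.of_apply]
    by_cases hj : j ∉ Set.range U ∧ j ∉ S
    · simp only [hj, not_false_eq_true, and_self, dite_true]
      exact measurable_matrix_apply (measurable_leaveOut hφ measurable_const measurable_const
        measurable_offDiag S U t) _ _
    · simp only [dif_neg hj]
      exact measurable_const
  set h : (Fin n → ℝ) → (Fin n → Fin n → ℝ) → ENNReal := fun r g => ENNReal.ofReal (Real.exp
    ((∑ k, (∑ j, w g j k * r j) ^ 2) / (4 * ∑ k, ∑ j, w g j k ^ 2))) with hh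
  have hhm : Measurable (Function.uncurry h) := by
    have h1 : ∀ j k, Measurable fun p : (Fin n → ℝ) × (Fin n → Fin n → ℝ) => w p.2 j k :=
      fun j k => (hwm j k).comp measurable_snd
    simp only [hh, Function.uncurry_def]
    fun_prop
  have hdep : ∀ r g g', (∀ i ∉ S, g i = g' i) → h r g = h r g' := by
    intro r g g' hg
    have h1 : zeroOut (offDiag g) S = zeroOut (offDiag g') S := by
      ext i j
      by_cases hi : i ∈ S
      · simp [zeroOut, hi]
      · simp [zeroOut, offDiag, hg i hi]
    have h2 : w g = w g' := by simp only [hw, leaveOut, h1]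
    simp only [hh, h2]
  have hint := lintegral_prod_rows_le S hhm hdep (c := 2)
    fun g => lintegral_exp_sum_sq_pi_le (w g)
  have hprodm : Measurable fun g : Fin n → Fin n → ℝ => ∏ i ∈ S, h (g i) g :=
    Finset.measurable_prod _ fun i _ => hhm.comp (f := fun g : Fin n → Fin n → ℝ => (g i, g))
      ((measurable_pi_apply i).prodMk measurable_id)
  have hsub : {g | ¬ CrossBound φ β Ξ (offDiag g) S U t x}
      ⊆ {g | ENNReal.ofReal (Real.exp x) ≤ ∏ i ∈ S, h (g i) g} := fun g hg =>
    le_prod_exp_of_crossBlock S _ hx (not_le.1 hg)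
  refine (measure_mono hsub).trans ?_
  have hexp : ENNReal.ofReal (Real.exp x) ≠ 0 := by
    simpa using Real.exp_pos x
  refine (meas_ge_le_lintegral_div hprodm.aemeasurable hexp ENNReal.ofReal_ne_top).trans ?_
  refine (ENNReal.div_le_div_right hint _).trans (le_of_eq ?_)
  rw [ENNReal.ofReal_mul (by positivity), Real.exp_neg, ENNReal.ofReal_inv_of_pos (Real.exp_pos _),
    ENNReal.ofReal_pow (by norm_num), ENNReal.ofReal_ofNat, ENNReal.div_eq_inv_mul, mul_comm]

/-- `CrossBound` for a random clean matrix that is independent of `(β, Ξ)`. -/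
theorem measure_not_crossBound_le (hφ : IsDenoiser φ) {Ω : Type*} [MeasurableSpace Ω]
    {P : Measure Ω} [IsProbabilityMeasure P] {C : Ω → Matrix (Fin n) (Fin n) ℝ}
    (hC : Measurable C) (hlaw : P.map C = (gaussianMatrix n).map offDiag)
    {β : Ω → BetaSeq K} (hβ : Measurable β) {Ξ : Ω → XiSeq K} (hΞ : Measurable Ξ)
    (hind : IndepFun C (fun ω => (β ω, Ξ ω)) P)
    (S : Finset (Fin n)) (U : Fin (K 0) ↪ Fin n) (t : ℕ) {x : ℝ} (hx : 0 ≤ x) :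
    P {ω | ¬ CrossBound φ (β ω) (Ξ ω) (C ω) S U t x}
      ≤ ENNReal.ofReal (2 ^ S.card * Real.exp (-x)) := by
  have hb : Measurable fun ω => (β ω, Ξ ω) := hβ.prodMk hΞ
  have hms : MeasurableSet {p : Matrix (Fin n) (Fin n) ℝ × (BetaSeq K × XiSeq K) |
      ¬ CrossBound φ p.2.1 p.2.2 p.1 S U t x} :=
    (measurableSet_crossBound hφ (measurable_fst.comp measurable_snd)
      (measurable_snd.comp measurable_snd) measurable_fst S U t x).compl
  have h1 := (indepFun_iff_map_prod_eq_prod_map_map hC.aemeasurable hb.aemeasurable).1 hind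
  have h2 : P {ω | ¬ CrossBound φ (β ω) (Ξ ω) (C ω) S U t x}
      = P.map (fun ω => (C ω, (β ω, Ξ ω))) {p | ¬ CrossBound φ p.2.1 p.2.2 p.1 S U t x} := by
    rw [Measure.map_apply (hC.prodMk hb) hms]; rfl
  have hpb : IsProbabilityMeasure (P.map fun ω => (β ω, Ξ ω)) :=
    Measure.isProbabilityMeasure_map hb.aemeasurable
  have hpc : IsProbabilityMeasure (P.map C) := Measure.isProbabilityMeasure_map hC.aemeasurable
  rw [h2, h1, Measure.prod_apply_symm hms]
  calc _ ≤ ∫⁻ _b, ENNReal.ofReal (2 ^ S.card * Real.exp (-x)) ∂(P.map fun ω => (β ω, Ξ ω)) := by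
        refine lintegral_mono fun b => ?_
        rw [hlaw, Measure.map_apply measurable_offDiag (hms.preimage (by fun_prop))]
        exact gaussianMatrix_not_crossBound_le hφ b.1 b.2 S U t hx
    _ = _ := by simp

end CrossBlock

/-! ### Spectral cleaning -/

section Cleaning

variable {n : ℕ}

/-- If the clean matrix has norm at most `9 √n` and the current matrix has norm at least `10 √n`,
then a definite part of the mass of its leading singular vectors sits on the corrupted indices
that are not yet removed. -/
theorem singular_mass_ge (hn : 0 < n) {C O : Matrix (Fin n) (Fin n) ℝ} {Q : Finset (Fin n)}
    (hCO : ∀ i j, i ∉ Q ∨ j ∉ Q → O i j = C i j) (hC : opNorm C ≤ 9 * √n)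
    (R : Finset (Fin n)) (hR : 10 * √n ≤ opNorm (zeroOut O R)) {v u : Fin n → ℝ}
    (hvu : IsLeadingSingularPair (zeroOut O R) v u) :
    1 / 19 ≤ ∑ i ∈ Q \ R, (v i ^ 2 + u i ^ 2) / 2 := by
  obtain ⟨hv, hu, h1, -⟩ := hvu
  have hs : 0 < √(n : ℝ) := Real.sqrt_pos.2 (by exact_mod_cast hn)
  set N := zeroOut O R with hN
  set σ := opNorm N with hσ
  set D := N - zeroOut C R with hD
  set v' : Fin n → ℝ := fun i => if i ∈ Q \ R then v i else 0 with hv'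
  set u' : Fin n → ℝ := fun i => if i ∈ Q \ R then u i else 0 with hu'
  have hDsupp : ∀ i j, i ∉ Q \ R ∨ j ∉ Q \ R → D i j = 0 := by
    intro i j hij
    simp only [hD, hN, Matrix.sub_apply, zeroOut, Matrix.of_apply]
    split_ifs with h
    · simp
    · push Not at h
      rw [hCO i j, sub_self]
      simpa [h.1, h.2] using hij
  have h2 : v ⬝ᵥ N.mulVec u = σ := by
    rw [h1, dotProduct_smul, smul_eq_mul]
    have : v ⬝ᵥ v = 1 := by rw [← hv]; simp [dotProduct, sq]
    rw [this, mul_one]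
  have h3 : v ⬝ᵥ D.mulVec u = v' ⬝ᵥ D.mulVec u' := by
    simp only [dotProduct, Matrix.mulVec, Finset.mul_sum]
    refine Finset.sum_congr rfl fun i _ => Finset.sum_congr rfl fun j _ => ?_
    by_cases hi : i ∈ Q \ R
    · by_cases hj : j ∈ Q \ R
      · simp only [hv', hu', hi, hj, if_true]
      · rw [hDsupp i j (Or.inr hj)]; ring
    · rw [hDsupp i j (Or.inl hi)]; ring
  have h4 : v ⬝ᵥ N.mulVec u = v ⬝ᵥ (zeroOut C R).mulVec u + v' ⬝ᵥ D.mulVec u' := by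
    rw [← h3, hD, Matrix.sub_mulVec, dotProduct_sub]; ring
  have h5 : v ⬝ᵥ (zeroOut C R).mulVec u ≤ 9 * √n := by
    have := (le_abs_self _).trans (abs_bilin_le (zeroOut C R) v u)
    rw [hv, hu, Real.sqrt_one, one_mul, mul_one] at this
    exact this.trans ((opNorm_zeroOut_le C R).trans hC)
  have h6 : v' ⬝ᵥ D.mulVec u' ≤ (σ + 9 * √n) * ∑ i ∈ Q \ R, (v i ^ 2 + u i ^ 2) / 2 := by
    have hsv : ∀ w : Fin n → ℝ, ∑ i, (if i ∈ Q \ R then w i else 0) ^ 2 = ∑ i ∈ Q \ R, w i ^ 2 := by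
      intro w
      simp only [ite_pow, zero_pow two_ne_zero, Finset.sum_ite_mem, Finset.univ_inter]
    have h7 := (le_abs_self _).trans (abs_bilin_le D v' u')
    have h8 : opNorm D ≤ σ + 9 * √n := (opNorm_sub_le _ _).trans
      (add_le_add le_rfl ((opNorm_zeroOut_le C R).trans hC))
    refine h7.trans (mul_le_mul h8 ?_ (by positivity) ((opNorm_nonneg _).trans h8))
    rw [hv', hu', hsv, hsv, ← Finset.sum_div, Finset.sum_add_distrib]
    have ha := Real.sq_sqrt (show 0 ≤ ∑ i ∈ Q \ R, v i ^ 2 from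
      Finset.sum_nonneg fun _ _ => sq_nonneg _)
    have hb := Real.sq_sqrt (show 0 ≤ ∑ i ∈ Q \ R, u i ^ 2 from
      Finset.sum_nonneg fun _ _ => sq_nonneg _)
    nlinarith [sq_nonneg (√(∑ i ∈ Q \ R, v i ^ 2) - √(∑ i ∈ Q \ R, u i ^ 2))]
  set m := ∑ i ∈ Q \ R, (v i ^ 2 + u i ^ 2) / 2 with hm
  by_contra hcon
  push Not at hcon
  have h9 : (σ + 9 * √n) * m < (σ + 9 * √n) * (1 / 19) :=
    mul_lt_mul_of_pos_left hcon (by linarith)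
  linarith

/-- The discrete sigma-algebra on finite index sets. -/
instance finsetMeasurableSpace : MeasurableSpace (Finset (Fin n)) := ⊤

instance : MeasurableSingletonClass (Finset (Fin n)) := ⟨fun _ => trivial⟩

theorem measurable_opNorm : Measurable (opNorm (n := n)) := by
  have h : Continuous (fun M : Matrix (Fin n) (Fin n) ℝ =>
      Matrix.toEuclideanCLM (n := Fin n) (𝕜 := ℝ) M) :=
    LinearMap.continuous_of_finiteDimensional
      ((Matrix.toEuclideanCLM (n := Fin n) (𝕜 := ℝ)).toAlgEquiv.toLinearMap)
  have hb : BorelSpace (Matrix (Fin n) (Fin n) ℝ) :=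
    inferInstanceAs (BorelSpace (Fin n → Fin n → ℝ))
  exact h.norm.measurable

theorem measurable_opNorm_zeroOut {α : Type*} [MeasurableSpace α]
    {M : α → Matrix (Fin n) (Fin n) ℝ} (hM : Measurable M) {R : α → Finset (Fin n)}
    (hR : Measurable R) : Measurable fun a => opNorm (zeroOut (M a) (R a)) := by
  have h1 : ∀ S : Finset (Fin n), Measurable fun a => opNorm (zeroOut (M a) S) := by
    intro S
    have h2 : Measurable fun a => zeroOut (M a) S := by
      refine measurable_matrix_of fun i j => ?_
      by_cases h : i ∈ S ∨ j ∈ S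
      · simp only [zeroOut, Matrix.of_apply, h, if_true]
        exact measurable_const
      · simp only [zeroOut, Matrix.of_apply, h, if_false]
        exact measurable_matrix_apply hM i j
    exact measurable_opNorm.comp h2
  have h3 : (fun a => opNorm (zeroOut (M a) (R a)))
      = fun a => ∑ S : Finset (Fin n),
        (R ⁻¹' {S}).indicator (fun a => opNorm (zeroOut (M a) S)) a := by
    funext a
    rw [Finset.sum_eq_single (R a)]
    · simp
    · intro S _ hS
      exact Set.indicator_of_notMem (s := R ⁻¹' {S})
        (fun h => hS (Set.mem_singleton_iff.1 h).symm) _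
    · simp
  rw [h3]
  exact Finset.measurable_fun_sum _ fun S _ => (h1 S).indicator (hR (measurableSet_singleton S))

theorem measurable_removedUpTo {α : Type*} [MeasurableSpace α]
    {M : α → Matrix (Fin n) (Fin n) ℝ} (hM : Measurable M) {I : ℕ → α → Fin n} (k : ℕ)
    (hI : ∀ l < k, Measurable (I l)) :
    Measurable fun a => removedUpTo (M a) (fun l => I l a) k := by
  induction k with
  | zero => exact measurable_const
  | succ k ih =>
    have hR := ih fun l hl => hI l (by omega)
    simp only [removedUpTo]
    refine Measurable.ite
      (measurableSet_le measurable_const (measurable_opNorm_zeroOut hM hR)) ?_ hR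
    exact (measurable_of_finite fun p : Fin n × Finset (Fin n) => insert p.1 p.2).comp
      ((hI k (by omega)).prodMk hR)

theorem measurable_supportSet : Measurable (supportSet (n := n)) := by
  classical
  have h : Measurable fun (E : Matrix (Fin n) (Fin n) ℝ) (i : Fin n) =>
      (∃ j, E i j ≠ 0 : Prop) := by
    refine measurable_pi_iff.2 fun i => ?_
    refine measurableSet_setOfPred.1 ?_
    have : {E : Matrix (Fin n) (Fin n) ℝ | ∃ j, E i j ≠ 0} = ⋃ j, {E | E i j = 0}ᶜ := by
      ext E; simp
    rw [this]
    exact MeasurableSet.iUnion fun j =>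
      (measurableSet_eq_fun (measurable_matrix_apply measurable_id i j) measurable_const).compl
  have h2 : supportSet (n := n)
      = (fun p : Fin n → Prop => Finset.univ.filter fun i => p i) ∘ fun E i => ∃ j, E i j ≠ 0 := by
    funext E
    ext i
    simp [supportSet]
  rw [h2]
  exact (measurable_of_finite _).comp h

variable {Ω D : Type*} [mΩ : MeasurableSpace Ω] [MeasurableSpace D] {P : Measure Ω}
  {X : Ω → D} {M : Ω → Matrix (Fin n) (Fin n) ℝ} {I : ℕ → Ω → Fin n}

/-- The while loop of the cleaning is still running after `k` rounds. -/
def Running (M : Matrix (Fin n) (Fin n) ℝ) (I : ℕ → Fin n) (k : ℕ) : Prop :=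
  10 * √n ≤ opNorm (zeroOut M (removedUpTo M I k))

theorem Running.of_succ {M : Matrix (Fin n) (Fin n) ℝ} {I : ℕ → Fin n} {k : ℕ}
    (h : Running M I (k + 1)) : Running M I k := by
  by_contra hk
  have h1 : removedUpTo M I (k + 1) = removedUpTo M I k := by
    rw [removedUpTo, if_neg (show ¬ 10 * √(n : ℝ) ≤ opNorm (zeroOut M (removedUpTo M I k)) from hk)]
  unfold Running at h hk
  rw [h1] at h
  exact hk h

theorem card_removedUpTo_le (M : Matrix (Fin n) (Fin n) ℝ) (I : ℕ → Fin n) (k : ℕ) :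
    (removedUpTo M I k).card ≤ k := by
  induction k with
  | zero => simp [removedUpTo]
  | succ k ih =>
    rw [removedUpTo]
    split_ifs
    · exact (Finset.card_insert_le _ _).trans (by omega)
    · omega

theorem removedSet_eq_of_not_running {M : Matrix (Fin n) (Fin n) ℝ} {I : ℕ → Fin n} {k : ℕ}
    (h : ¬ Running M I k) : removedSet M I = removedUpTo M I k := by
  have hconst : ∀ l, removedUpTo M I (k + l) = removedUpTo M I k := by
    intro l
    induction l with
    | zero => rfl
    | succ l ih =>
      rw [← add_assoc, removedUpTo, ih,
        if_neg (show ¬ 10 * √(n : ℝ) ≤ opNorm (zeroOut M (removedUpTo M I k)) from h)]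
  have hmono : ∀ l, removedUpTo M I l ⊆ removedUpTo M I (l + 1) := by
    intro l
    rw [removedUpTo]
    split_ifs
    · exact Finset.subset_insert _ _
    · exact subset_rfl
  ext i
  simp only [removedSet, Finset.mem_filter, Finset.mem_univ, true_and]
  refine ⟨fun ⟨l, hl⟩ => ?_, fun hi => ⟨k, hi⟩⟩
  have h1 := monotone_nat_of_le_succ (f := removedUpTo M I) hmono (show l ≤ k + l by omega) hl
  rwa [hconst] at h1

/-- Averaging over the sampled index, a corrupted index is hit with probability at least `1/19`,
which gains a factor `37/38`. -/
theorem sum_weight_le {Q R : Finset (Fin n)} {q : Fin n → ℝ}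
    (hq1 : ∑ i, q i = 1) (hq : 1 / 19 ≤ ∑ i ∈ Q \ R, q i) :
    ∑ i, (1 / 2 : ℝ) ^ (insert i R ∩ Q).card * q i ≤ 37 / 38 * (1 / 2) ^ (R ∩ Q).card := by
  have h1 : ∀ i, (1 / 2 : ℝ) ^ (insert i R ∩ Q).card * q i
      = (1 / 2) ^ (R ∩ Q).card * (q i - if i ∈ Q \ R then q i / 2 else 0) := by
    intro i
    by_cases hi : i ∈ Q \ R
    · obtain ⟨hiQ, hiR⟩ := Finset.mem_sdiff.1 hi
      have : insert i R ∩ Q = insert i (R ∩ Q) := by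
        rw [Finset.insert_inter_of_mem hiQ]
      rw [if_pos hi, this, Finset.card_insert_of_notMem (by simp [hiR]), pow_succ]
      ring
    · have : insert i R ∩ Q = R ∩ Q := by
        ext j
        simp only [Finset.mem_inter, Finset.mem_insert, Finset.mem_sdiff] at hi ⊢
        constructor
        · rintro ⟨rfl | hj, hQ⟩
          · exact ⟨by tauto, hQ⟩
          · exact ⟨hj, hQ⟩
        · rintro ⟨hj, hQ⟩; exact ⟨Or.inr hj, hQ⟩
      rw [if_neg hi, this]; ring
  simp_rw [h1]
  rw [← Finset.mul_sum, Finset.sum_sub_distrib, hq1, Finset.sum_ite_mem, Finset.univ_inter,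
    ← Finset.sum_div, mul_comm]
  refine mul_le_mul_of_nonneg_right ?_ (by positivity)
  linarith

/-- The cleaning loop outlives round `k` with small probability: on the event `G` each round
removes a new corrupted index with conditional probability at least `1/19`, and there are at most
`y` of them. -/
theorem measure_running_le [IsProbabilityMeasure P] (hrun : IsCleaningRun P X M I)
    (hX : Measurable X) (hM : Measurable[MeasurableSpace.comap X inferInstance] M)
    {Q : Ω → Finset (Fin n)} (hQ : Measurable[MeasurableSpace.comap X inferInstance] Q)
    {G : Set Ω} (hG : MeasurableSet[MeasurableSpace.comap X inferInstance] G)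
    (hit : ∀ ω ∈ G, ∀ R : Finset (Fin n), 10 * √n ≤ opNorm (zeroOut (M ω) R) →
      ∀ v u, IsLeadingSingularPair (zeroOut (M ω) R) v u →
        1 / 19 ≤ ∑ i ∈ Q ω \ R, (v i ^ 2 + u i ^ 2) / 2)
    {y : ℕ} (hy : ∀ ω, (Q ω).card ≤ y) (k : ℕ) :
    P (G ∩ {ω | Running (M ω) (fun l => I l ω) k})
      ≤ ENNReal.ofReal ((37 / 38) ^ k * 2 ^ y) := by
  classical
  set R : ℕ → Ω → Finset (Fin n) := fun k ω => removedUpTo (M ω) (fun l => I l ω) k with hR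
  set F : ℕ → MeasurableSpace Ω := fun k =>
    MeasurableSpace.comap (fun ω' => (X ω', fun l : Fin k => I l ω')) inferInstance with hF
  have hFle : ∀ k, F k ≤ mΩ := by
    intro k
    have h1 : Measurable fun ω' => (X ω', fun l : Fin k => I l ω') :=
      hX.prodMk (measurable_pi_iff.2 fun l => hrun.measurable l)
    exact h1.comap_le
  have hXF : ∀ k, MeasurableSpace.comap X inferInstance ≤ F k := by
    intro k
    have h1 : Measurable[F k] fun ω' => (X ω', fun l : Fin k => I l ω') := comap_measurable _
    exact (measurable_fst.comp h1).comap_le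
  have hIF : ∀ k, ∀ l < k, Measurable[F k] (I l) := by
    intro k l hl
    have h1 : Measurable[F k] fun ω' => (X ω', fun l : Fin k => I l ω') := comap_measurable _
    exact (measurable_pi_apply (⟨l, hl⟩ : Fin k)).comp (measurable_snd.comp h1)
  have hMF : ∀ k, Measurable[F k] M := fun k => hM.mono (hXF k) le_rfl
  have hQF : ∀ k, Measurable[F k] Q := fun k => hQ.mono (hXF k) le_rfl
  have hRF : ∀ k, Measurable[F k] (R k) := fun k =>
    @measurable_removedUpTo n Ω (F k) M (hMF k) I k (hIF k)
  have hrunF : ∀ k, MeasurableSet[F k] {ω | 10 * √n ≤ opNorm (zeroOut (M ω) (R k ω))} := fun k =>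
    (@measurable_opNorm_zeroOut n Ω (F k) M (hMF k) (R k) (hRF k)) measurableSet_Ici
  have hGF : ∀ k, MeasurableSet[F k] G := fun k => hXF k _ hG
  -- The supermartingale and its value after sampling `i` in round `k`.
  set A : ℕ → Set Ω := fun k => G ∩ {ω | 10 * √n ≤ opNorm (zeroOut (M ω) (R k ω))} with hA
  have hAF : ∀ k, MeasurableSet[F k] (A k) := fun k =>
    @MeasurableSet.inter _ (F k) _ _ (hGF k) (hrunF k)
  set Z : ℕ → Ω → ℝ := fun k => (A k).indicator fun ω => (1 / 2) ^ (R k ω ∩ Q ω).card with hZ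
  set Y : ℕ → Fin n → Ω → ℝ := fun k i =>
    (A k).indicator fun ω => (1 / 2) ^ (insert i (R k ω) ∩ Q ω).card with hY
  have hdisc : ∀ k (f : Finset (Fin n) × Finset (Fin n) → ℝ),
      Measurable[F k] fun ω => f (R k ω, Q ω) := fun k f =>
    (measurable_of_finite f).comp (Measurable.prodMk (hRF k) (hQF k))
  have hZm : ∀ k, Measurable[F k] (Z k) := fun k =>
    (hdisc k fun p => (1 / 2) ^ (p.1 ∩ p.2).card).indicator (hAF k)
  have hYm : ∀ k i, Measurable[F k] (Y k i) := fun k i =>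
    (hdisc k fun p => (1 / 2) ^ (insert i p.1 ∩ p.2).card).indicator (hAF k)
  have hpow : ∀ m : ℕ, (1 / 2 : ℝ) ^ m ∈ Set.Icc (0 : ℝ) 1 := fun m =>
    ⟨by positivity, pow_le_one₀ (by norm_num) (by norm_num)⟩
  have hZ01 : ∀ k ω, Z k ω ∈ Set.Icc (0 : ℝ) 1 := fun k ω => by
    simp only [hZ, Set.indicator]
    split_ifs
    · exact hpow _
    · simp
  have hY01 : ∀ k i ω, Y k i ω ∈ Set.Icc (0 : ℝ) 1 := fun k i ω => by
    simp only [hY, Set.indicator]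
    split_ifs
    · exact hpow _
    · simp
  have hint : ∀ {f : Ω → ℝ}, Measurable f → (∀ ω, f ω ∈ Set.Icc (0 : ℝ) 1) → Integrable f P := by
    intro f hf h01
    refine Integrable.of_bound hf.aestronglyMeasurable 1 (Eventually.of_forall fun ω => ?_)
    rw [Real.norm_of_nonneg (h01 ω).1]
    exact (h01 ω).2
  have hZint : ∀ k, Integrable (Z k) P := fun k => hint ((hZm k).mono (hFle k) le_rfl) (hZ01 k)
  set J : ℕ → Fin n → Ω → ℝ := fun k i => Set.indicator {ω' | I k ω' = i} fun _ => (1 : ℝ) with hJ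
  have hJm : ∀ k i, Measurable (J k i) := fun k i =>
    measurable_const.indicator (hrun.measurable k (measurableSet_singleton i))
  have hJ01 : ∀ k i ω, J k i ω ∈ Set.Icc (0 : ℝ) 1 := fun k i ω => by
    simp only [hJ, Set.indicator]
    split_ifs <;> simp
  have hJint : ∀ k i, Integrable (J k i) P := fun k i => hint (hJm k i) (hJ01 k i)
  have hYJint : ∀ k i, Integrable (Y k i * J k i) P := fun k i =>
    hint (((hYm k i).mono (hFle k) le_rfl).mul (hJm k i)) fun ω =>
      ⟨mul_nonneg (hY01 k i ω).1 (hJ01 k i ω).1, mul_le_one₀ (hY01 k i ω).2 (hJ01 k i ω).1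
        (hJ01 k i ω).2⟩
  have hstep : ∀ k, ∫ ω, Z (k + 1) ω ∂P ≤ 37 / 38 * ∫ ω, Z k ω ∂P := by
    intro k
    have h1 : ∀ ω, Z (k + 1) ω ≤ ∑ i, (Y k i * J k i) ω := by
      intro ω
      have hsum : ∑ i, (Y k i * J k i) ω = Y k (I k ω) ω := by
        simp only [Pi.mul_apply, hJ, Set.indicator, Set.mem_ofPred_eq]
        simp
      rw [hsum]
      by_cases hω : ω ∈ A (k + 1)
      · have hω' : ω ∈ A k := ⟨hω.1, Running.of_succ hω.2⟩
        have hRk : R (k + 1) ω = insert (I k ω) (R k ω) := by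
          simp only [hR, removedUpTo]
          exact if_pos hω'.2
        simp only [hZ, hY, Set.indicator_of_mem hω, Set.indicator_of_mem hω', hRk, le_refl]
      · simp only [hZ, Set.indicator_of_notMem hω]
        exact (hY01 k _ ω).1
    have h2 : ∀ i, ∫ ω, (Y k i * J k i) ω ∂P = ∫ ω, Y k i ω * (P[J k i | F k]) ω ∂P := by
      intro i
      rw [← integral_condExp (hFle k)]
      exact integral_congr_ae (condExp_mul_of_stronglyMeasurable_left
        (hYm k i).stronglyMeasurable (hYJint k i) (hJint k i))
    have h3 : ∀ i, Integrable (fun ω => Y k i ω * (P[J k i | F k]) ω) P := by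
      intro i
      exact (integrable_condExp (m := F k)).congr (condExp_mul_of_stronglyMeasurable_left
        (hYm k i).stronglyMeasurable (hYJint k i) (hJint k i))
    calc ∫ ω, Z (k + 1) ω ∂P ≤ ∫ ω, ∑ i, (Y k i * J k i) ω ∂P :=
          integral_mono (hZint _) (integrable_finsetSum _ fun i _ => hYJint k i) h1
      _ = ∫ ω, ∑ i, Y k i ω * (P[J k i | F k]) ω ∂P := by
          rw [integral_finsetSum _ fun i _ => hYJint k i, integral_finsetSum _ fun i _ => h3 i]
          exact Finset.sum_congr rfl fun i _ => h2 i
      _ ≤ ∫ ω, 37 / 38 * Z k ω ∂P := by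
          refine integral_mono_ae (integrable_finsetSum _ fun i _ => h3 i)
            ((hZint k).const_mul _) ?_
          filter_upwards [hrun.sampling k] with ω hω
          by_cases hA' : ω ∈ A k
          · obtain ⟨v, u, hvu, hp⟩ := hω hA'.2
            have hp' : ∀ i, (P[J k i | F k]) ω = (v i ^ 2 + u i ^ 2) / 2 := hp
            simp only [hY, hZ, Set.indicator_of_mem hA', hp']
            refine sum_weight_le ?_ (hit ω hA'.1 _ hA'.2 v u hvu)
            rw [← Finset.sum_div, Finset.sum_add_distrib, hvu.1, hvu.2.1]
            norm_num
          · simp only [hY, hZ, Set.indicator_of_notMem hA']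
            simp
      _ = _ := integral_const_mul _ _
  have hZk : ∫ ω, Z k ω ∂P ≤ (37 / 38) ^ k := by
    induction k with
    | zero =>
      calc ∫ ω, Z 0 ω ∂P ≤ ∫ _ω, (1 : ℝ) ∂P :=
            integral_mono (hZint 0) (integrable_const _) fun ω => (hZ01 0 ω).2
        _ = _ := by simp
    | succ k ih =>
      refine (hstep k).trans ?_
      rw [pow_succ, mul_comm]
      exact mul_le_mul_of_nonneg_right ih (by norm_num)
  have hAm : MeasurableSet (A k) := hFle k _ (hAF k)
  have hlow : (1 / 2 : ℝ) ^ y * P.real (A k) ≤ ∫ ω, Z k ω ∂P := by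
    rw [← integral_indicator_one hAm, ← integral_const_mul]
    refine integral_mono (((integrable_const (1 : ℝ)).indicator hAm).const_mul _) (hZint k)
      fun ω => ?_
    by_cases hω : ω ∈ A k
    · simp only [hZ, Set.indicator_of_mem hω, Pi.one_apply, mul_one]
      exact pow_le_pow_of_le_one (by norm_num) (by norm_num)
        ((Finset.card_le_card Finset.inter_subset_right).trans (hy ω))
    · simp [hZ, Set.indicator_of_notMem hω]
  change P (A k) ≤ _
  rw [← ofReal_measureReal]
  refine ENNReal.ofReal_le_ofReal ?_
  have h2 : (1 / 2 : ℝ) ^ y * 2 ^ y = 1 := by rw [← mul_pow]; norm_num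
  calc P.real (A k) = ((1 / 2 : ℝ) ^ y * P.real (A k)) * 2 ^ y := by
        rw [mul_right_comm, h2, one_mul]
    _ ≤ (37 / 38) ^ k * 2 ^ y := mul_le_mul_of_nonneg_right (hlow.trans hZk) (by positivity)

end Cleaning

/-! ### Growth of the dimensions -/

section Dimensions

variable {φ : ℝ → ℝ} {ρ Λ : ℝ} {K : ℕ → ℕ}

theorem IsDimensionSeq.growth (h : IsDimensionSeq φ ρ Λ K) (t : ℕ) :
    12 ≤ K t ∧ 3 ≤ growthConst φ ρ Λ * K t ∧ 2 * K t ≤ K (t + 1) := by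
  have hc0 : 0 ≤ growthConst φ ρ Λ := by
    rw [growthConst]; positivity
  have key : ∀ t, 12 ≤ K t → 3 ≤ growthConst φ ρ Λ * K t → 2 * K t ≤ K (t + 1) := by
    intro t h1 h2
    have h3 := (abs_lt.1 (h.step t)).1
    have h1' : (12 : ℝ) ≤ K t := by exact_mod_cast h1
    have h4 : 3 * (K t : ℝ) ≤ growthConst φ ρ Λ * (K t : ℝ) ^ 2 := by
      rw [sq, ← mul_assoc]
      exact mul_le_mul_of_nonneg_right h2 (by positivity)
    have h5 : 2 * (K t : ℝ) ≤ K (t + 1) := by linarith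
    exact_mod_cast h5
  induction t with
  | zero =>
    have h0 : K 0 ≠ 0 := fun h0 => by
      have := h.large
      rw [h0] at this
      norm_num at this
    have h1 : 12 ≤ K 0 := Nat.le_of_dvd (Nat.pos_of_ne_zero h0) (h.dvd 0)
    exact ⟨h1, h.large, key 0 h1 h.large⟩
  | succ t ih =>
    obtain ⟨h1, h2, h3⟩ := ih
    have h4 : 12 ≤ K (t + 1) := by omega
    have h5 : (K t : ℝ) ≤ K (t + 1) := by exact_mod_cast (by omega : K t ≤ K (t + 1))
    have h6 : 3 ≤ growthConst φ ρ Λ * K (t + 1) :=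
      h2.trans (mul_le_mul_of_nonneg_left h5 hc0)
    exact ⟨h4, h6, key _ h4 h6⟩

theorem IsDimensionSeq.two_pow_le (h : IsDimensionSeq φ ρ Λ K) (t : ℕ) : 12 * 2 ^ t ≤ K t := by
  induction t with
  | zero => simpa using (h.growth 0).1
  | succ t ih =>
    have := (h.growth t).2.2
    rw [pow_succ]
    omega

/-- The number of iterations is at most `n`; a crude bound, enough for a union bound. -/
theorem IsDimensionSeq.tStar_le (h : IsDimensionSeq φ ρ Λ K) (n : ℕ) : tStar K n ≤ n := by
  refine Nat.sInf_le ?_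
  change Real.log n ^ (1.1 : ℝ) ≤ (K n : ℝ)
  have hl0 : 0 ≤ Real.log n := Real.log_natCast_nonneg n
  have h1 : ((12 * 2 ^ n : ℕ) : ℝ) ≤ K n := by exact_mod_cast h.two_pow_le n
  push_cast at h1
  have h2 : (n : ℝ) ≤ 2 ^ n := by exact_mod_cast Nat.lt_two_pow_self.le
  have h3 : (1 : ℝ) ≤ 2 ^ n := one_le_pow₀ (by norm_num)
  rcases le_total (Real.log n) 1 with hl | hl
  · have := Real.rpow_le_one hl0 hl (show (0 : ℝ) ≤ 1.1 by norm_num)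
    linarith
  · have h4 : Real.log n ^ (1.1 : ℝ) ≤ Real.log n ^ (2 : ℝ) :=
      Real.rpow_le_rpow_of_exponent_le hl (by norm_num)
    rw [Real.rpow_two] at h4
    have h5 : Real.log n ≤ 2 * √n := by
      have h6 : Real.log n = 2 * Real.log (√n) := by
        rw [Real.log_sqrt (by positivity)]; ring
      have h7 := Real.log_le_self (Real.sqrt_nonneg (n : ℝ))
      linarith
    have h8 : Real.log n ^ 2 ≤ (2 * √n) ^ 2 := pow_le_pow_left₀ hl0 h5 2
    rw [mul_pow, Real.sq_sqrt (by positivity)] at h8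
    linarith

end Dimensions

/-! ### Numerical estimates for the union bound -/

/-- The number of sets of size at most `m`, weighted by `2 ^ |S|`. -/
theorem sum_two_pow_card_le (n m : ℕ) {a : ℝ} (ha : 0 < a) (ha1 : a ≤ 1) :
    ∑ S : Finset (Fin n) with S.card ≤ m, (2 : ℝ) ^ S.card
      ≤ Real.exp (m * Real.log a⁻¹ + 2 * (a * n)) := by
  have h1 : ∀ S ∈ Finset.univ.filter (fun S : Finset (Fin n) => S.card ≤ m),
      (2 : ℝ) ^ S.card ≤ a⁻¹ ^ m * ((2 * a) ^ S.card * 1 ^ (n - S.card)) := by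
    intro S hS
    have hS' : S.card ≤ m := (Finset.mem_filter.1 hS).2
    have h2 : a ^ m ≤ a ^ S.card := pow_le_pow_of_le_one ha.le ha1 hS'
    have h3 : a⁻¹ ^ m * a ^ m = 1 := by rw [← mul_pow, inv_mul_cancel₀ ha.ne', one_pow]
    rw [one_pow, mul_one, mul_pow]
    calc (2 : ℝ) ^ S.card = 2 ^ S.card * (a⁻¹ ^ m * a ^ m) := by rw [h3, mul_one]
      _ ≤ 2 ^ S.card * (a⁻¹ ^ m * a ^ S.card) := by gcongr
      _ = _ := by ring
  calc _ ≤ ∑ S : Finset (Fin n) with S.card ≤ m,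
          a⁻¹ ^ m * ((2 * a) ^ S.card * 1 ^ (n - S.card)) := Finset.sum_le_sum h1
    _ ≤ ∑ S : Finset (Fin n), a⁻¹ ^ m * ((2 * a) ^ S.card * 1 ^ (n - S.card)) :=
        Finset.sum_le_sum_of_subset_of_nonneg (Finset.filter_subset _ _)
          fun _ _ _ => by positivity
    _ = a⁻¹ ^ m * (2 * a + 1) ^ n := by
        rw [← Finset.mul_sum, Fin.sum_pow_mul_eq_add_pow]
    _ ≤ Real.exp (m * Real.log a⁻¹) * Real.exp (2 * a) ^ n := by
        rw [Real.exp_nat_mul, Real.exp_log (inv_pos.2 ha)]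
        gcongr
        exact Real.add_one_le_exp _
    _ = _ := by
        rw [← Real.exp_nat_mul, ← Real.exp_add]
        congr 1; ring

theorem card_embedding_le_exp (k n : ℕ) (hn : 0 < n) :
    (Fintype.card (Fin k ↪ Fin n) : ℝ) ≤ Real.exp (k * Real.log n) := by
  rw [Fintype.card_embedding_eq, Fintype.card_fin, Fintype.card_fin, Real.exp_nat_mul,
    Real.exp_log (by exact_mod_cast hn)]
  exact_mod_cast Nat.descFactorial_le_pow n k

section Estimates

variable {a : ℝ} {n : ℕ}

/-- If at least one index may be corrupted, then `log n ≤ a n log a⁻¹`. -/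
theorem log_le_mul_log_inv (ha : 0 < a) (hL : 1 ≤ Real.log a⁻¹) (hy : 1 ≤ a * n) :
    Real.log n ≤ a * n * Real.log a⁻¹ := by
  have hn : (n : ℝ) ≠ 0 := by
    rintro h
    rw [h, mul_zero] at hy
    linarith
  have h1 : Real.log n = Real.log (a * n) + Real.log a⁻¹ := by
    rw [Real.log_mul ha.ne' hn, Real.log_inv]; ring
  have h2 := Real.log_le_sub_one_of_pos (show 0 < a * n by linarith)
  nlinarith

/-- The number of rounds after which the cleaning has stopped with high probability. -/
noncomputable def maxRounds (a : ℝ) (n : ℕ) : ℕ := ⌈100 * (a * n) * Real.log a⁻¹⌉₊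

theorem maxRounds_le (hL : 100 ≤ Real.log a⁻¹) (hy : 1 ≤ a * n) :
    (maxRounds a n : ℝ) ≤ 101 * (a * n) * Real.log a⁻¹ := by
  have h1 := (Nat.ceil_lt_add_one (show 0 ≤ 100 * (a * n) * Real.log a⁻¹ by positivity)).le
  rw [maxRounds]
  nlinarith

theorem pow_maxRounds_le (ha : 0 < a) (hL : 100 ≤ Real.log a⁻¹) (hy : 1 ≤ a * n) :
    (37 / 38 : ℝ) ^ maxRounds a n * 2 ^ ⌊a * n⌋₊ ≤ a := by
  have h1 : (37 / 38 : ℝ) ≤ Real.exp (-(1 / 38)) := by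
    have := Real.add_one_le_exp (-(1 / 38) : ℝ)
    linarith
  have h2 : (2 : ℝ) ≤ Real.exp 1 := by
    have := Real.add_one_le_exp (1 : ℝ)
    linarith
  have h3 : 100 * (a * n) * Real.log a⁻¹ ≤ maxRounds a n := Nat.le_ceil _
  have h4 : (⌊a * n⌋₊ : ℝ) ≤ a * n := Nat.floor_le (by linarith)
  calc (37 / 38 : ℝ) ^ maxRounds a n * 2 ^ ⌊a * n⌋₊
      ≤ Real.exp (-(1 / 38)) ^ maxRounds a n * Real.exp 1 ^ ⌊a * n⌋₊ := by gcongr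
    _ = Real.exp (maxRounds a n * -(1 / 38) + ⌊a * n⌋₊ * 1) := by
        rw [← Real.exp_nat_mul, ← Real.exp_nat_mul, ← Real.exp_add]
    _ ≤ Real.exp (-Real.log a⁻¹) := by
        refine Real.exp_le_exp.2 ?_
        nlinarith
    _ = a := by rw [Real.log_inv, neg_neg, Real.exp_log ha]

/-- The total failure probability of the cross bounds. -/
theorem union_bound_le {k : ℕ} (ha : 0 < a) (hL : 100 ≤ Real.log a⁻¹) (hk : k ≤ Real.log a⁻¹)
    (hy : 1 ≤ a * n) :
    (∑ S : Finset (Fin n) with S.card ≤ maxRounds a n, (2 : ℝ) ^ S.card)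
      * Fintype.card (Fin k ↪ Fin n) * (n + 1) * Real.exp (-(300 * (a * n) * Real.log a⁻¹ ^ 2))
      ≤ a := by
  have hn : 0 < n := by
    rcases Nat.eq_zero_or_pos n with h | h
    · subst h
      norm_num at hy
    · exact h
  have ha1 : a ≤ 1 := by
    by_contra h
    push Not at h
    have := Real.log_nonpos (inv_nonneg.2 ha.le) (inv_le_one_of_one_le₀ h.le)
    linarith
  set L := Real.log a⁻¹ with hLdef
  set y := a * n with hydef
  have h1 := sum_two_pow_card_le n (maxRounds a n) ha ha1
  have h2 := card_embedding_le_exp k n hn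
  have hlog := log_le_mul_log_inv ha (by linarith) hy
  have h3 : (n : ℝ) + 1 ≤ Real.exp (1 + Real.log n) := by
    rw [Real.exp_add, Real.exp_log (by exact_mod_cast hn)]
    have h5 := Real.add_one_le_exp (1 : ℝ)
    have h6 : (1 : ℝ) ≤ n := by exact_mod_cast hn
    nlinarith
  have h4 := maxRounds_le hL hy
  calc _ ≤ Real.exp (maxRounds a n * L + 2 * y) * Real.exp (k * Real.log n)
          * Real.exp (1 + Real.log n) * Real.exp (-(300 * y * L ^ 2)) := by gcongr
    _ = Real.exp (maxRounds a n * L + 2 * y + k * Real.log n + (1 + Real.log n)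
          + -(300 * y * L ^ 2)) := by simp only [Real.exp_add]
    _ ≤ Real.exp (-L) := by
        refine Real.exp_le_exp.2 ?_
        have h5 : maxRounds a n * L ≤ 101 * y * L * L :=
          mul_le_mul_of_nonneg_right h4 (by linarith)
        have h6 : k * Real.log n ≤ L * (y * L) :=
          mul_le_mul hk hlog (Real.log_natCast_nonneg n) (by linarith)
        have h7 : y * L ≤ y * L * L := le_mul_of_one_le_right (by positivity) (by linarith)
        have h8 : y ≤ y * L := le_mul_of_one_le_right (by linarith) (by linarith)
        have h9 : L ≤ y * L := le_mul_of_one_le_left (by linarith) hy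
        nlinarith
    _ = a := by rw [hLdef, Real.log_inv, neg_neg, Real.exp_log ha]

end Estimates

/-! ### One observed matrix -/

section OneSided

variable {n : ℕ} {Ω D : Type*} [MeasurableSpace Ω] [MeasurableSpace D] {P : Measure Ω}
  {φ : ℝ → ℝ} {ρ a : ℝ} {K : ℕ → ℕ}

/-- The corrupted and the clean iterates of one observed matrix are close, for every starting
sequence outside of the corrupted indices, up to an event of small probability. -/
theorem measure_iterates_far_le [IsProbabilityMeasure P] (hφ : IsDenoiser φ)
    (hK12 : ∀ t, 12 ∣ K t) (hK1 : ∀ t, 1 ≤ K t) (hKmono : ∀ t, K t ≤ K (t + 1))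
    (ha : 0 < a) (hL : 100 ≤ Real.log a⁻¹) (hK0 : K 0 ≤ Real.log a⁻¹) (hn : 0 < n)
    {T : ℕ} (hT : T ≤ n) {X : Ω → D} {C O : Ω → Matrix (Fin n) (Fin n) ℝ} {Q : Ω → Finset (Fin n)}
    {I : ℕ → Ω → Fin n} {β : Ω → BetaSeq K} {Ξ : Ω → XiSeq K} (hX : Measurable X)
    (hC : Measurable[MeasurableSpace.comap X inferInstance] C)
    (hO : Measurable[MeasurableSpace.comap X inferInstance] O)
    (hQ : Measurable[MeasurableSpace.comap X inferInstance] Q)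
    (hCO : ∀ ω i j, i ∉ Q ω ∨ j ∉ Q ω → O ω i j = C ω i j)
    (hcard : ∀ ω, ((Q ω).card : ℝ) ≤ a * n)
    (hlaw : P.map C = (gaussianMatrix n).map offDiag) (hrun : IsCleaningRun P X O I)
    (hβ : Measurable β) (hΞ : Measurable Ξ) (hind : IndepFun X (fun ω => (β ω, Ξ ω)) P)
    (hspec : ∀ᵐ ω ∂P, IsSpectralOutput φ ρ T (β ω) (Ξ ω)) :
    P {ω | ¬ ∀ U : Fin (K 0) ↪ Fin n, (∀ k, U k ∉ Q ω) → ∀ t ≤ T,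
      frobNorm (fIter φ (β ω) (Ξ ω) (cleaned (O ω) fun k => I k ω) U
          (initIter φ (cleaned (O ω) fun k => I k ω) U) t
        - fIter φ (β ω) (Ξ ω) (C ω) U (initIter φ (cleaned (O ω) fun k => I k ω) U) t)
        ≤ alephSeq K a t * √(a * n) ∧
      frobNorm (hIter φ (β ω) (Ξ ω) (cleaned (O ω) fun k => I k ω) U
          (initIter φ (cleaned (O ω) fun k => I k ω) U) t
        - hIter φ (β ω) (Ξ ω) (C ω) U (initIter φ (cleaned (O ω) fun k => I k ω) U) t)
        ≤ 1000 * alephSeq K a t * √(K t * Real.log a⁻¹) * √(a * n)}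
      ≤ ENNReal.ofReal (Real.exp (-n) + 2 * a) := by
  have hCm : Measurable C := hC.mono hX.comap_le le_rfl
  have hindC : IndepFun C (fun ω => (β ω, Ξ ω)) P :=
    (IndepFun_iff_Indep _ _ _).2 (indep_of_indep_of_le_left ((IndepFun_iff_Indep _ _ _).1 hind)
      hC.comap_le)
  have hs : 0 < √(n : ℝ) := Real.sqrt_pos.2 (by exact_mod_cast hn)
  set bad : Set Ω := {ω | ¬ ∀ U : Fin (K 0) ↪ Fin n, (∀ k, U k ∉ Q ω) → ∀ t ≤ T,
      frobNorm (fIter φ (β ω) (Ξ ω) (cleaned (O ω) fun k => I k ω) U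
          (initIter φ (cleaned (O ω) fun k => I k ω) U) t
        - fIter φ (β ω) (Ξ ω) (C ω) U (initIter φ (cleaned (O ω) fun k => I k ω) U) t)
        ≤ alephSeq K a t * √(a * n) ∧
      frobNorm (hIter φ (β ω) (Ξ ω) (cleaned (O ω) fun k => I k ω) U
          (initIter φ (cleaned (O ω) fun k => I k ω) U) t
        - hIter φ (β ω) (Ξ ω) (C ω) U (initIter φ (cleaned (O ω) fun k => I k ω) U) t)
        ≤ 1000 * alephSeq K a t * √(K t * Real.log a⁻¹) * √(a * n)} with hbad
  set N : Set Ω := {ω | ¬ IsSpectralOutput φ ρ T (β ω) (Ξ ω)} with hN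
  have hN0 : P N = 0 := hspec
  set big : Set Ω := {ω | 9 * √n < opNorm (C ω)} with hbig
  have hbigP : P big ≤ ENNReal.ofReal (Real.exp (-n)) := by
    have hms : MeasurableSet {M : Matrix (Fin n) (Fin n) ℝ | 9 * √n < opNorm M} :=
      measurable_opNorm measurableSet_Ioi
    have h1 : P big = P.map C {M | 9 * √n < opNorm M} := by
      rw [Measure.map_apply hCm hms]; rfl
    rw [h1, hlaw, Measure.map_apply measurable_offDiag hms]
    exact gaussianMatrix_opNorm_gt_le hn
  rcases lt_or_ge (a * n) 1 with hy | hy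
  · -- No index is corrupted, so the observed matrix is the clean one and nothing is removed.
    have hsub : bad ⊆ N ∪ big := by
      intro ω hω
      by_contra hcon
      simp only [Set.mem_union, not_or, hN, hbig, Set.mem_ofPred_eq, not_not, not_lt] at hcon
      refine hω fun U _ t _ => ?_
      have hQ0 : Q ω = ∅ := by
        have h1 := (hcard ω).trans_lt hy
        rw [← Finset.card_eq_zero]
        exact Nat.lt_one_iff.1 (by exact_mod_cast h1)
      have hOC : O ω = C ω := by
        ext i j
        exact hCO ω i j (Or.inl (by simp [hQ0]))
      have hnr : ¬ Running (O ω) (fun k => I k ω) 0 := by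
        unfold Running
        have := (opNorm_zeroOut_le (O ω) (removedUpTo (O ω) (fun k => I k ω) 0)).trans
          (hOC ▸ hcon.2)
        linarith
      have hcl : cleaned (O ω) (fun k => I k ω) = C ω := by
        rw [cleaned, removedSet_eq_of_not_running hnr, hOC]
        ext i j
        simp [zeroOut, removedUpTo]
      rw [hcl, sub_self, sub_self, frobNorm_zero, frobNorm_zero]
      have := alephSeq_nonneg K a t
      exact ⟨by positivity, by positivity⟩
    calc P bad ≤ P N + P big := (measure_mono hsub).trans (measure_union_le _ _)
      _ ≤ ENNReal.ofReal (Real.exp (-n) + 2 * a) := by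
          rw [hN0, zero_add]
          exact hbigP.trans (ENNReal.ofReal_le_ofReal (by linarith))
  · set m := maxRounds a n with hm
    set x : ℝ := 300 * (a * n) * Real.log a⁻¹ ^ 2 with hx
    have hx0 : 0 ≤ x := by positivity
    set G : Set Ω := {ω | opNorm (C ω) ≤ 9 * √n} with hG
    have hGm : MeasurableSet[MeasurableSpace.comap X inferInstance] G :=
      hC (measurable_opNorm measurableSet_Iic)
    set long : Set Ω := G ∩ {ω | Running (O ω) (fun l => I l ω) m} with hlong
    have hlongP : P long ≤ ENNReal.ofReal a := by
      refine (measure_running_le hrun hX hO hQ hGm (fun ω hω R hR v u hvu =>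
        singular_mass_ge hn (hCO ω) hω R hR hvu) (y := ⌊a * n⌋₊)
        (fun ω => Nat.le_floor (hcard ω)) m).trans ?_
      exact ENNReal.ofReal_le_ofReal (pow_maxRounds_le ha hL hy)
    set cross : Set Ω := ⋃ S ∈ Finset.univ.filter (fun S : Finset (Fin n) => S.card ≤ m),
      ⋃ U ∈ (Finset.univ : Finset (Fin (K 0) ↪ Fin n)), ⋃ t ∈ Finset.range (n + 1),
        {ω | ¬ CrossBound φ (β ω) (Ξ ω) (C ω) S U t x} with hcross
    have hcrossP : P cross ≤ ENNReal.ofReal a := by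
      calc P cross ≤ ∑ S : Finset (Fin n) with S.card ≤ m, ∑ U : Fin (K 0) ↪ Fin n,
            ∑ t ∈ Finset.range (n + 1), P {ω | ¬ CrossBound φ (β ω) (Ξ ω) (C ω) S U t x} := by
            refine (measure_biUnion_finset_le _ _).trans (Finset.sum_le_sum fun S _ => ?_)
            refine (measure_biUnion_finset_le _ _).trans (Finset.sum_le_sum fun U _ => ?_)
            exact measure_biUnion_finset_le _ _
        _ ≤ ∑ S : Finset (Fin n) with S.card ≤ m, ∑ U : Fin (K 0) ↪ Fin n,
            ∑ t ∈ Finset.range (n + 1), ENNReal.ofReal (2 ^ S.card * Real.exp (-x)) :=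
            Finset.sum_le_sum fun S _ => Finset.sum_le_sum fun U _ => Finset.sum_le_sum fun t _ =>
              measure_not_crossBound_le hφ hCm hlaw hβ hΞ hindC S U t hx0
        _ = ENNReal.ofReal (∑ S : Finset (Fin n) with S.card ≤ m, ∑ U : Fin (K 0) ↪ Fin n,
            ∑ t ∈ Finset.range (n + 1), 2 ^ S.card * Real.exp (-x)) := by
            rw [ENNReal.ofReal_sum_of_nonneg fun _ _ => by positivity]
            refine Finset.sum_congr rfl fun S _ => ?_
            rw [ENNReal.ofReal_sum_of_nonneg fun _ _ => by positivity]
            refine Finset.sum_congr rfl fun U _ => ?_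
            rw [ENNReal.ofReal_sum_of_nonneg fun _ _ => by positivity]
        _ ≤ ENNReal.ofReal a := by
            refine ENNReal.ofReal_le_ofReal (le_trans (le_of_eq ?_) (union_bound_le ha hL hK0 hy))
            simp only [Finset.sum_const, Finset.card_univ, Finset.card_range, nsmul_eq_mul]
            rw [Finset.sum_mul, Finset.sum_mul, Finset.sum_mul]
            refine Finset.sum_congr rfl fun S _ => ?_
            push_cast
            ring
    have hsub : bad ⊆ (N ∪ big) ∪ (long ∪ cross) := by
      intro ω hω
      by_contra hcon
      simp only [Set.mem_union, not_or] at hcon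
      obtain ⟨⟨hωN, hωbig⟩, hωlong, hωcross⟩ := hcon
      have hspecω : IsSpectralOutput φ ρ T (β ω) (Ξ ω) := not_not.1 hωN
      have hCω : opNorm (C ω) ≤ 9 * √n := not_lt.1 hωbig
      have hnr : ¬ Running (O ω) (fun l => I l ω) m := fun h => hωlong ⟨hCω, h⟩
      have hcl : cleaned (O ω) (fun k => I k ω)
          = zeroOut (O ω) (removedUpTo (O ω) (fun k => I k ω) m) := by
        rw [cleaned, removedSet_eq_of_not_running hnr]
      have hcardS := card_removedUpTo_le (O ω) (fun k => I k ω) m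
      refine hω fun U hU => ?_
      rw [hcl]
      refine error_of_typical hφ hspecω hK12 hK1 hKmono hL (by linarith) hn (hCO ω) hCω
        (not_le.1 hnr).le (hcard ω) ?_ U hU ?_
      · exact le_trans (by exact_mod_cast hcardS) (maxRounds_le hL hy)
      · intro t ht
        by_contra hnc
        refine hωcross ?_
        simp only [hcross, Set.mem_iUnion]
        exact ⟨_, Finset.mem_filter.2 ⟨Finset.mem_univ _, hcardS⟩, U, Finset.mem_univ _, t,
          Finset.mem_range.2 (by omega), hnc⟩
    calc P bad ≤ (P N + P big) + (P long + P cross) :=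
          (measure_mono hsub).trans ((measure_union_le _ _).trans
            (add_le_add (measure_union_le _ _) (measure_union_le _ _)))
      _ ≤ (0 + ENNReal.ofReal (Real.exp (-n))) + (ENNReal.ofReal a + ENNReal.ofReal a) :=
          add_le_add (add_le_add hN0.le hbigP) (add_le_add hlongP hcrossP)
      _ = ENNReal.ofReal (Real.exp (-n) + 2 * a) := by
          rw [zero_add, ← ENNReal.ofReal_add ha.le ha.le,
            ← ENNReal.ofReal_add (Real.exp_pos _).le (by linarith)]
          congr 1; ring

end OneSided

/-! ### The matrices of the model -/

theorem measurable_noisy {n : ℕ} :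
    Measurable fun p : Matrix (Fin n) (Fin n) ℝ × Matrix (Fin n) (Fin n) ℝ => noisy p.1 p.2 := by
  refine measurable_matrix_of fun i j => ?_
  have h1 := measurable_matrix_apply (measurable_fst (α := Matrix (Fin n) (Fin n) ℝ)
    (β := Matrix (Fin n) (Fin n) ℝ)) i j
  have h2 := measurable_matrix_apply (measurable_snd (α := Matrix (Fin n) (Fin n) ℝ)
    (β := Matrix (Fin n) (Fin n) ℝ)) i j
  by_cases hji : j < i
  · simp only [noisy, Matrix.of_apply, hji, if_true]
    exact (h1.add h2).div_const _
  · by_cases hij : i < j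
    · simp only [noisy, Matrix.of_apply, hji, hij, if_true, if_false]
      exact (h1.sub h2).div_const _
    · simp only [noisy, Matrix.of_apply, hji, hij, if_false]
      exact measurable_const

theorem noisy_add_apply {n : ℕ} {A E G : Matrix (Fin n) (Fin n) ℝ} (hE : E.IsSymm) {i j : Fin n}
    (hij : i ∉ supportSet E ∨ j ∉ supportSet E) : noisy (A + E) G i j = noisy A G i j := by
  have h0 : E i j = 0 := by
    simp only [supportSet, Finset.mem_filter, Finset.mem_univ, true_and, not_exists, not_not] at hij
    rcases hij with h | h
    · exact h j
    · rw [← hE.apply i j]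
      exact h i
  simp [noisy, h0]

theorem measurable_matrix_add {n : ℕ} :
    Measurable fun p : Matrix (Fin n) (Fin n) ℝ × Matrix (Fin n) (Fin n) ℝ => p.1 + p.2 :=
  measurable_matrix_of fun i j =>
    (measurable_matrix_apply measurable_fst i j).add (measurable_matrix_apply measurable_snd i j)

section Model

namespace RandomInput

variable {n : ℕ} {Ω : Type*} [MeasurableSpace Ω] {P : Measure Ω} {φ : ℝ → ℝ} {ρ a Λ : ℝ}
  {K : ℕ → ℕ} {π : Equiv.Perm (Fin n)} {X : RandomInput Ω n K}

theorem IsModel.measurable_data (hX : X.IsModel P φ ρ a π) : Measurable X.data :=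
  hX.wigner.measurable_fst.prodMk (hX.wigner.measurable_snd.prodMk
      (hX.corruption_fst.measurable.prodMk (hX.corruption_snd.measurable.prodMk
        (hX.noise.measurable_fst.prodMk hX.noise.measurable_snd))))

variable [IsProbabilityMeasure P]

theorem IsModel.measure_far_fst_le (hX : X.IsModel P φ ρ a π) (hφ : IsDenoiser φ)
    (hK : IsDimensionSeq φ ρ Λ K) (ha : 0 < a) (hL : 100 ≤ Real.log a⁻¹)
    (hK0 : K 0 ≤ Real.log a⁻¹) (hn : 0 < n) :
    P {ω | ¬ ∀ U : Fin (K 0) ↪ Fin n, (∀ k, U k ∉ supportSet (X.E ω)) → ∀ t ≤ tStar K n,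
      frobNorm (X.fHat φ ω U t - X.fClean φ ω U t) ≤ alephSeq K a t * √(a * n) ∧
      frobNorm (X.hHat φ ω U t - X.hClean φ ω U t)
        ≤ 1000 * alephSeq K a t * √(K t * Real.log a⁻¹) * √(a * n)}
      ≤ ENNReal.ofReal (Real.exp (-n) + 2 * a) := by
  have hK1 : ∀ t, 1 ≤ K t := fun t => by have := (hK.growth t).1; omega
  have hKmono : ∀ t, K t ≤ K (t + 1) := fun t => by have := (hK.growth t).2.2; omega
  have hdata := hX.measurable_data
  have hc : Measurable[MeasurableSpace.comap X.data inferInstance] X.data := comap_measurable _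
  have hcA : Measurable[MeasurableSpace.comap X.data inferInstance] X.A := measurable_fst.comp hc
  have hc1 := measurable_snd.comp hc
  have hc2 := measurable_snd.comp hc1
  have hcE : Measurable[MeasurableSpace.comap X.data inferInstance] X.E := measurable_fst.comp hc2
  have hc3 := measurable_snd.comp hc2
  have hc4 := measurable_snd.comp hc3
  have hcG : Measurable[MeasurableSpace.comap X.data inferInstance] X.G := measurable_fst.comp hc4
  exact measure_iterates_far_le (P := P) (ρ := ρ) (X := X.data) (C := X.cleanA)
    (O := X.obsA) (Q := fun ω => supportSet (X.E ω)) (I := X.I) (β := X.β) (Ξ := X.Ξ) hφ hK.dvd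
    hK1 hKmono ha hL hK0 hn (hK.tStar_le n) hdata (measurable_noisy.comp (hcA.prodMk hcG))
    (measurable_noisy.comp ((measurable_matrix_add.comp (hcA.prodMk hcE)).prodMk hcG))
    (measurable_supportSet.comp hcE)
    (fun ω i j hij => noisy_add_apply (hX.corruption_fst.symm ω) hij) hX.corruption_fst.card_le
    (hX.wigner.isWigner_fst.map_noisy hX.noise.isWigner_fst
      (hX.noise_indep.comp measurable_fst measurable_fst))
    hX.cleaning_fst hX.measurable_beta hX.measurable_Xi
    hX.spectral_indep hX.spectral

theorem IsModel.measure_far_snd_le (hX : X.IsModel P φ ρ a π) (hφ : IsDenoiser φ) (hρ : ρ ^ 2 ≤ 1)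
    (hK : IsDimensionSeq φ ρ Λ K) (ha : 0 < a) (hL : 100 ≤ Real.log a⁻¹)
    (hK0 : K 0 ≤ Real.log a⁻¹) (hn : 0 < n) :
    P {ω | ¬ ∀ V : Fin (K 0) ↪ Fin n, (∀ k, V k ∉ supportSet (X.F ω)) → ∀ t ≤ tStar K n,
      frobNorm (X.gHat φ ω V t - X.gClean φ ω V t) ≤ alephSeq K a t * √(a * n) ∧
      frobNorm (X.lHat φ ω V t - X.lClean φ ω V t)
        ≤ 1000 * alephSeq K a t * √(K t * Real.log a⁻¹) * √(a * n)}
      ≤ ENNReal.ofReal (Real.exp (-n) + 2 * a) := by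
  have hK1 : ∀ t, 1 ≤ K t := fun t => by have := (hK.growth t).1; omega
  have hKmono : ∀ t, K t ≤ K (t + 1) := fun t => by have := (hK.growth t).2.2; omega
  have hdata := hX.measurable_data
  have hc : Measurable[MeasurableSpace.comap X.data inferInstance] X.data := comap_measurable _
  have hc1 := measurable_snd.comp hc
  have hcB : Measurable[MeasurableSpace.comap X.data inferInstance] X.B := measurable_fst.comp hc1
  have hc2 := measurable_snd.comp hc1
  have hc3 := measurable_snd.comp hc2
  have hcF : Measurable[MeasurableSpace.comap X.data inferInstance] X.F := measurable_fst.comp hc3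
  have hc4 := measurable_snd.comp hc3
  have hcH : Measurable[MeasurableSpace.comap X.data inferInstance] X.H := measurable_snd.comp hc4
  exact measure_iterates_far_le (P := P) (ρ := ρ) (X := X.data) (C := X.cleanB)
    (O := X.obsB) (Q := fun ω => supportSet (X.F ω)) (I := X.J) (β := X.β) (Ξ := X.Ξ) hφ hK.dvd
    hK1 hKmono ha hL hK0 hn (hK.tStar_le n) hdata (measurable_noisy.comp (hcB.prodMk hcH))
    (measurable_noisy.comp ((measurable_matrix_add.comp (hcB.prodMk hcF)).prodMk hcH))
    (measurable_supportSet.comp hcF)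
    (fun ω i j hij => noisy_add_apply (hX.corruption_snd.symm ω) hij) hX.corruption_snd.card_le
    ((hX.wigner.isWigner_snd hρ).map_noisy (hX.noise.isWigner_snd (by norm_num))
      (hX.noise_indep.comp (measurable_fst.comp measurable_snd) measurable_snd))
    hX.cleaning_snd hX.measurable_beta hX.measurable_Xi
    hX.spectral_indep hX.spectral

end RandomInput

end Model

theorem tendsto_log_inv {ε : ℕ → ℝ} (hε0 : ∀ n, 0 < ε n) (hε : Tendsto ε atTop (𝓝 0)) :
    Tendsto (fun n => Real.log (ε n)⁻¹) atTop atTop :=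
  Real.tendsto_log_atTop.comp
    (tendsto_inv_nhdsGT_zero.comp (tendsto_nhdsWithin_iff.2 ⟨hε, Eventually.of_forall hε0⟩))

end RobustMatching

open RobustMatching in
theorem lemma3p3
    (φ : ℝ → ℝ) (hφ : IsDenoiser φ)
    (ρ : ℝ) (hρ0 : 0 < ρ) (hρ1 : ρ < 1)
    (Λ : ℝ) (hΛ : IsTaylorBound φ Λ)
    (K : ℕ → ℕ) (hK : IsDimensionSeq φ ρ Λ K)
    (ε : ℕ → ℝ) (hε0 : ∀ n, 0 < ε n)
    (hε : ε =o[atTop] fun n : ℕ => 1 / Real.log n ^ 20) :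
    ∃ r : ℕ → ENNReal, Tendsto r atTop (𝓝 0) ∧
      ∀ (n : ℕ) (π : Equiv.Perm (Fin n))
        (Ω : Type*) [MeasurableSpace Ω] (P : Measure Ω) [IsProbabilityMeasure P]
        (X : RandomInput Ω n K), X.IsModel P φ ρ (ε n) π →
        P {ω | ¬ ∀ U V : Fin (K 0) ↪ Fin n, X.IsGoodPair π ω U V →
          ∀ t ≤ tStar K n,
            frobNorm (X.fHat φ ω U t - X.fClean φ ω U t)
              ≤ alephSeq K (ε n) t * Real.sqrt (ε n * n) ∧
            frobNorm (X.gHat φ ω V t - X.gClean φ ω V t)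
              ≤ alephSeq K (ε n) t * Real.sqrt (ε n * n) ∧
            frobNorm (X.hHat φ ω U t - X.hClean φ ω U t)
              ≤ 1000 * alephSeq K (ε n) t * Real.sqrt (K t * Real.log (ε n)⁻¹)
                * Real.sqrt (ε n * n) ∧
            frobNorm (X.lHat φ ω V t - X.lClean φ ω V t)
              ≤ 1000 * alephSeq K (ε n) t * Real.sqrt (K t * Real.log (ε n)⁻¹)
                * Real.sqrt (ε n * n)} ≤ r n := by
  classical
  have hlog : Tendsto (fun n : ℕ => Real.log n) atTop atTop :=
    Real.tendsto_log_atTop.comp tendsto_natCast_atTop_atTop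
  have hεlim : Tendsto ε atTop (𝓝 0) := by
    refine hε.trans_tendsto ?_
    simp only [one_div]
    exact tendsto_inv_atTop_zero.comp ((tendsto_pow_atTop (by norm_num)).comp hlog)
  have hL := tendsto_log_inv hε0 hεlim
  -- For the finitely many small `n` the trivial bound `1` is used.
  set good : ℕ → Prop := fun n =>
    0 < n ∧ 100 ≤ Real.log (ε n)⁻¹ ∧ (K 0 : ℝ) ≤ Real.log (ε n)⁻¹ with hgood
  have hev : ∀ᶠ n in atTop, good n := by
    filter_upwards [eventually_gt_atTop 0, hL.eventually_ge_atTop 100,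
      hL.eventually_ge_atTop (K 0 : ℝ)] with n h1 h2 h3 using ⟨h1, h2, h3⟩
  refine ⟨fun n => if good n then ENNReal.ofReal (2 * (Real.exp (-n) + 2 * ε n)) else 1, ?_, ?_⟩
  · have h1 : Tendsto (fun n : ℕ => 2 * (Real.exp (-n) + 2 * ε n)) atTop (𝓝 0) := by
      have h2 : Tendsto (fun n : ℕ => Real.exp (-n)) atTop (𝓝 0) :=
        Real.tendsto_exp_neg_atTop_nhds_zero.comp tendsto_natCast_atTop_atTop
      simpa using (h2.add (hεlim.const_mul 2)).const_mul 2
    have h3 := ENNReal.tendsto_ofReal h1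
    rw [ENNReal.ofReal_zero] at h3
    refine h3.congr' ?_
    filter_upwards [hev] with n hn
    rw [if_pos hn]
  intro n π Ω _ P _ X hX
  by_cases hn : good n
  swap
  · simp only [if_neg hn]
    exact prob_le_one
  simp only [if_pos hn]
  obtain ⟨hn0, hn1, hn2⟩ := hn
  have hbad1 := hX.measure_far_fst_le hφ hK (hε0 n) hn1 hn2 hn0
  have hbad2 := hX.measure_far_snd_le hφ (by nlinarith) hK (hε0 n) hn1 hn2 hn0
  rw [two_mul, ENNReal.ofReal_add (by have := hε0 n; positivity) (by have := hε0 n; positivity)]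
  refine le_trans ((measure_mono ?_).trans (measure_union_le _ _)) (add_le_add hbad1 hbad2)
  intro ω hω
  by_contra hcon
  simp only [Set.mem_union, not_or, Set.mem_ofPred_eq, not_not] at hcon
  refine hω fun U V hUV t ht => ?_
  have h1 := hcon.1 U (fun k hk => hUV.1 k (Finset.mem_union_left _ hk)) t ht
  have h2 := hcon.2 V (fun k hk => hUV.2.1 k (Finset.mem_union_left _ hk)) t ht
  exact ⟨h1.1, h2.1, h1.2, h2.2⟩
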